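/- **Continuous tree-mining game (CTM).** Fix an integer $k\ge 2$. The state of the game is a finite rooted weighted tree $T$, in which $d_u$ denotes the length of the edge from $u\neq r$ to its parent and in which no node except possibly the root $r$ has exactly one child, together with a configuration $x\in\mathbb N^{\mathcal L(T)}$ of $k$ robots on the leaves, $\sum_\ell x_\ell=k$; put $x_u=\sum_{\ell\preceq u}x_\ell$ for every node $u$, where $\ell\preceq u$ means that $\ell$ is $u$ or a descendant of $u$. Moving from $x$ to $x'$ costs $\mathrm{OT}_T(x,x')=\sum_{u\ne r}d_u|x_u-x'_u|$. Initially $T$ consists of the root and one leaf, at distance $0$, that hosts all robots. The adversary may (i) elongate continuously the edge of a leaf $\ell$ as long as $x_\ell\ge2$, at a cost of $x_\ell$ per unit of length; (ii) give $m$ children to a leaf $\ell$ with $x_\ell\ge3$, where $2\le m\le x_\ell-1$, through edges of a common length $\delta\in(0,1]$ chosen by the player; (iii) kill a leaf, if it is not the only one (if its parent is not the root and has a single other child, the parent is suppressed and its two remaining edges are merged). A strategy of the player chooses the lengths $\delta$ and returns, for any state $(T,x)$ and any modified tree $T'$, a configuration $x'$ on $T'$, the transport from $x$ to $x'$ being added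 to the cost; taking $T'=T$ at every instant of an elongation tells when and how robots are moved during it, and it is part of the definition of a strategy that if it reacts to an elongation, then there is a first instant at which it does. For $f:\mathbb N\times\mathbb R\to\mathbb R$ the strategy is *$f(k,D)$-bounded* if, whatever the adversary does, all robots attain depth $D$ with a cost of at most $f(k,D)$; that is, for every reachable state and every $D$ that is at least the depth of the highest (closest to the root) leaf, the cost incurred so far is at most $f(k,D)$. **Collective tree exploration (CTE).** $k$ robots start at the root of an unknown finite rooted tree with edges of length $1$. In each synchronous round each robot stays or moves along one edge; visiting a node reveals its adjacent edges to the whole team, and the algorithm determines all moves from what has been revealed so far. $\mathtt{Runtime}(\mathcal A,T)$ is the first number of rounds after which all edges have been traversed and all robots are at the root. **Layered tree traversal (LTT).** $T$ is a finite rooted tree with edge lengths in $\{0,1\}$ and a target in its last layer; layer $i$ is the set of nodes with $i$ edges to the root. A searcher starts at the root. At step $i$, layer $i$ and the edges leading to it are revealed, and the searcher moves to a node of layer $i$, chosen by a deterministic algorithm as a function of the revealed layers and of its current position; at the end it goes from the last layer to the target. The cost is the distance travelled. A randomized algorithm is a probability distribution over deterministic ones. The length $L$ is the sum of all edge lengths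 and the depth $D$ is the distance from the root to the target. **Theorem.** Let $k\ge2$, $f:\mathbb N\times\mathbb R\to\mathbb R$, and suppose that the player has an $f(k,D)$-bounded strategy for the continuous tree-mining game with $k$ robots. Then: 1. there is a CTE algorithm $\mathcal A$ for $k$ robots that terminates on every finite rooted tree $T$, and, if $T$ has $n$ nodes and depth $D$ (the maximal number of edges from the root to a node), $$\mathtt{Runtime}(\mathcal A,T)\le\frac{2n+f(k,D)}{k}+D+1;$$ 2. there is a randomized LTT algorithm $\mathcal A_k$ such that, for every layered tree $T$ with edge lengths in $\{0,1\}$, length $L$ and depth $D$, $$\mathbb E\big(\mathtt{Cost}(\mathcal A_k,T)\big)\le\frac{2L+f(k,D)}{k}+1.$$ -/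

import Mathlib

noncomputable section

open scoped ENNReal
open Classical

namespace TreeMining

/-! ## The continuous tree-mining game -/

/-- Data of a finite weighted tree rooted at the node `0`: its nodes, the parent `p(u)` of each node
and the length `d_u` of the edge between `u` and `p(u)`. Values outside `verts` and the value
`len 0` carry no meaning. -/
structure GameTree where
  verts : Finset ℕ
  parent : ℕ → ℕ
  len : ℕ → ℝ

namespace GameTree

/-- The children of a node. -/
def children (T : GameTree) (v : ℕ) : Finset ℕ :=
  T.verts.filter fun u => u ≠ 0 ∧ T.parent u = v

/-- The leaves, i.e. the nodes without children. -/
def leaves (T : GameTree) : Finset ℕ :=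
  T.verts.filter fun v => T.children v = ∅

/-- `T` is a simple weighted tree rooted at `0`: iterating the parent function leads from every node
to the root, and no node other than the root has exactly one child (i.e. has degree two). -/
structure IsSimple (T : GameTree) : Prop where
  root_mem : 0 ∈ T.verts
  parent_root : T.parent 0 = 0
  parent_mem : ∀ v ∈ T.verts, T.parent v ∈ T.verts
  reaches_root : ∀ v ∈ T.verts, ∃ i : ℕ, T.parent^[i] v = 0
  len_nonneg : ∀ v ∈ T.verts, v ≠ 0 → 0 ≤ T.len v
  card_children : ∀ v ∈ T.verts, v ≠ 0 → (T.children v).card ≠ 1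

/-- `u ≼ v`: the node `v` is obtained from `u` by iterating the parent function. -/
def IsDesc (T : GameTree) (u v : ℕ) : Prop := ∃ i : ℕ, T.parent^[i] u = v

/-- Distance from the root to `v`. -/
def depth (T : GameTree) (v : ℕ) : ℝ :=
  ∑ u ∈ T.verts.filter (fun u => u ≠ 0 ∧ T.IsDesc v u), T.len u

/-- The extension `x_u = ∑_{v ≼ u} x_v` of a distribution of robots over nodes. -/
def load (T : GameTree) (x : ℕ → ℕ) (u : ℕ) : ℕ :=
  ∑ v ∈ T.verts.filter (fun v => T.IsDesc v u), x v

/-- The optimal transport cost `∑_u d_u |x_u - x'_u|`. -/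
def transport (T : GameTree) (x x' : ℕ → ℕ) : ℝ :=
  ∑ u ∈ T.verts.erase 0, T.len u * |(T.load x u : ℝ) - (T.load x' u : ℝ)|

/-- `x` is a discrete configuration of `k` robots on `T`: it is supported by the leaves, and its
total is `k`. -/
def IsConfig (T : GameTree) (k : ℕ) (x : ℕ → ℕ) : Prop :=
  (∀ v, v ∉ T.leaves → x v = 0) ∧ ∑ v ∈ T.leaves, x v = k

/-- The edge leading to `l` gets longer by `s`. -/
def elongate (T : GameTree) (l : ℕ) (s : ℝ) : GameTree where
  verts := T.verts
  parent := T.parent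
  len := Function.update T.len l (T.len l + s)

/-- The leaf `l` receives the elements of `C` as children, through edges of length `δ`. -/
def fork (T : GameTree) (l : ℕ) (C : Finset ℕ) (δ : ℝ) : GameTree where
  verts := T.verts ∪ C
  parent := fun u => if u ∈ C then l else T.parent u
  len := fun u => if u ∈ C then δ else T.len u

/-- The nodes that have the same parent as `l`, without `l` itself. -/
def siblings (T : GameTree) (l : ℕ) : Finset ℕ := (T.children (T.parent l)).erase l

/-- The leaf `l` disappears. If its parent `p` is not the root and has a single other child `u`,
then `p` is suppressed and the edges `(u, p)` and `(p, p(p))` are merged into one. -/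
def kill (T : GameTree) (l : ℕ) : GameTree :=
  if T.parent l ≠ 0 ∧ (T.siblings l).card = 1 then
    { verts := (T.verts.erase l).erase (T.parent l)
      parent := fun u => if u ∈ T.siblings l then T.parent (T.parent l) else T.parent u
      len := fun u => if u ∈ T.siblings l then T.len (T.parent l) + T.len u else T.len u }
  else
    { verts := T.verts.erase l
      parent := T.parent
      len := T.len }

/-- The tree at the beginning of the game: the root `0` and one leaf `1`, whose edge has not
started to grow yet. -/
def start : GameTree where
  verts := {0, 1}
  parent := fun _ => 0
  len := fun _ => 0

end GameTree

/-- A strategy of the player of the continuous tree-mining game with `k` robots. The new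
configuration is `respond T x T'`, where `(T, x)` is the previous state and `T'` the modified tree;
`T' = T` tells whether robots are moved while a leaf is being elongated. The player also chooses the
length of the edges created by a fork of the leaf `l` into `m` children. -/
structure CTMStrategy (k : ℕ) where
  forkLen : GameTree → (ℕ → ℕ) → (l m : ℕ) → ℝ
  respond : GameTree → (ℕ → ℕ) → GameTree → (ℕ → ℕ)
  forkLen_pos : ∀ T x l m, 0 < forkLen T x l m
  forkLen_le_one : ∀ T x l m, forkLen T x l m ≤ 1
  respond_isConfig : ∀ (T : GameTree) (x : ℕ → ℕ) (T' : GameTree), T.IsSimple → T.IsConfig k x → T'.IsSimple →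
    T'.IsConfig k (respond T x T')
  /-- If the player reacts at all to the continuous elongation of a leaf, then there is a first
  instant at which it does, so that the evolution in continuous time is well defined. -/
  exists_first_move : ∀ (T : GameTree) (x : ℕ → ℕ) (l : ℕ), T.IsSimple → T.IsConfig k x → l ∈ T.leaves → 2 ≤ x l →
    {s : ℝ | 0 ≤ s ∧ respond (T.elongate l s) x (T.elongate l s) ≠ x}.Nonempty →
    ∃ s₀, IsLeast {s : ℝ | 0 ≤ s ∧ respond (T.elongate l s) x (T.elongate l s) ≠ x} s₀

namespace CTMStrategy

variable {k : ℕ}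

/-- `S.Reach T x c`: some behaviour of the adversary leads to the tree `T` and the configuration
`x`, after the player that follows `S` has incurred the cost `c`. -/
inductive Reach (S : CTMStrategy k) : GameTree → (ℕ → ℕ) → ℝ → Prop
  | start : Reach S GameTree.start (fun v => if v = 1 then k else 0) 0
  /-- A leaf that hosts at least two robots is elongated by `s`, at the cost of `x_l` per unit of
  length. The player leaves the configuration unchanged until that instant, when it may move. -/
  | elongate {T : GameTree} {x : ℕ → ℕ} {c : ℝ} (l : ℕ) (s : ℝ) :
      Reach S T x c → l ∈ T.leaves → 2 ≤ x l → 0 ≤ s →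
      (∀ s', 0 ≤ s' → s' < s → S.respond (T.elongate l s') x (T.elongate l s') = x) →
      Reach S (T.elongate l s) (S.respond (T.elongate l s) x (T.elongate l s))
        (c + s * (x l : ℝ) + (T.elongate l s).transport x
          (S.respond (T.elongate l s) x (T.elongate l s)))
  /-- A leaf that hosts at least three robots receives `m` children, with `2 ≤ m ≤ x_l - 1`. -/
  | fork {T : GameTree} {x : ℕ → ℕ} {c : ℝ} (l : ℕ) (C : Finset ℕ) (T' : GameTree) :
      Reach S T x c → l ∈ T.leaves → Disjoint C T.verts → 2 ≤ C.card → C.card + 1 ≤ x l →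
      T' = T.fork l C (S.forkLen T x l C.card) →
      Reach S T' (S.respond T x T') (c + T'.transport x (S.respond T x T'))
  /-- A leaf is killed, and its robots have to go to other leaves. Merging two edges does not change
  distances, hence the cost is computed in the tree before the deletion. -/
  | kill {T : GameTree} {x : ℕ → ℕ} {c : ℝ} (l : ℕ) :
      Reach S T x c → l ∈ T.leaves → 2 ≤ T.leaves.card →
      Reach S (T.kill l) (S.respond T x (T.kill l)) (c + T.transport x (S.respond T x (T.kill l)))

/-- `S` is `f`-bounded: whatever the adversary does, all the robots attain depth `D` with a cost of
at most `f D`, i.e. as long as the depth of the highest leaf does not exceed `D`, neither does the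
cost exceed `f D`. -/
def IsBounded (S : CTMStrategy k) (f : ℝ → ℝ) : Prop :=
  ∀ (T : GameTree) (x : ℕ → ℕ) (c : ℝ), S.Reach T x c →
    ∀ D : ℝ, (∃ l ∈ T.leaves, T.depth l ≤ D) → c ≤ f D

end CTMStrategy

/-! ## Finite rooted trees with labelled edges -/

/-- A finite rooted tree. A node is the list of the labels of the edges on the way up from that node
to the root: the root is `[]`, the children of `u` are of the form `i :: u`, and the parent of a node
`u ≠ []` is `u.tail`. -/
structure RTree where
  nodes : Finset (List ℕ)
  root_mem : [] ∈ nodes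
  parent_mem : ∀ (i : ℕ) (u : List ℕ), i :: u ∈ nodes → u ∈ nodes

/-- The number of edges on a longest path down from the root. -/
def RTree.depth (T : RTree) : ℕ := T.nodes.sup List.length

/-! ## Collective tree exploration -/

/-- In each round a robot stays, goes to the parent, or goes down along the edge with label `i`. -/
inductive Step where
  | stay
  | up
  | down (i : ℕ)

/-- The new position of a robot. Impossible steps have no effect. -/
def Step.apply (T : RTree) (u : List ℕ) : Step → List ℕ
  | .stay => u
  | .up => u.tail
  | .down i => if i :: u ∈ T.nodes then i :: u else u

/-- What the team knows at some time: the nodes that were visited, the discovered nodes, i.e. the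
visited ones and the lower ends of the dangling edges, and the positions of the `k` robots. -/
structure CTEView (k : ℕ) where
  visited : Finset (List ℕ)
  discovered : Finset (List ℕ)
  pos : Fin k → List ℕ

/-- The view of the team in the tree `T`: visiting a node reveals all the edges adjacent to it. -/
def CTEView.of {k : ℕ} (T : RTree) (visited : Finset (List ℕ)) (pos : Fin k → List ℕ) :
    CTEView k where
  visited := visited
  discovered := T.nodes.filter fun u => u.tail ∈ visited
  pos := pos

/-- A (deterministic, centralized) collective exploration algorithm for `k` robots: the steps of all
the robots as a function of the present view and of the list of past views, the latest one first. -/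
def CTEAlgorithm (k : ℕ) : Type := CTEView k → List (CTEView k) → Fin k → Step

namespace CTEAlgorithm

variable {k : ℕ}

/-- The present view and the past views after `t` rounds. All robots start at the root. -/
def run (A : CTEAlgorithm k) (T : RTree) : ℕ → CTEView k × List (CTEView k)
  | 0 => (CTEView.of T {[]} (fun _ => []), [])
  | t + 1 =>
    let v := (run A T t).1
    let past := (run A T t).2
    let pos := fun i => (A v past i).apply T (v.pos i)
    (CTEView.of T (v.visited ∪ Finset.univ.image pos) pos, v :: past)

/-- After `t` rounds all edges have been traversed, i.e. all nodes have been visited, and all robots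
are at the root. -/
def Finished (A : CTEAlgorithm k) (T : RTree) (t : ℕ) : Prop :=
  (A.run T t).1.visited = T.nodes ∧ ∀ i, (A.run T t).1.pos i = []

/-- The number of rounds before termination (`⊤` if the algorithm does not terminate on `T`). -/
def runtime (A : CTEAlgorithm k) (T : RTree) : ℕ∞ :=
  sInf {r : ℕ∞ | ∃ t : ℕ, A.Finished T t ∧ r = t}

end CTEAlgorithm

/-! ## Layered tree traversal -/

/-- A tree whose edges have length `0` or `1` (`len u` is the length of the edge between `u` and its
parent), with a target in its last layer. The layer `i` consists of the nodes at combinatorial depth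
`i`. -/
structure LayeredTree extends RTree where
  len : List ℕ → ℕ
  len_le_one : ∀ u, len u ≤ 1
  target : List ℕ
  target_mem : target ∈ nodes
  target_last : ∀ u ∈ nodes, u.length ≤ target.length

/-- What the searcher is shown: some layers, with the lengths of their edges. -/
structure LTTView where
  nodes : Finset (List ℕ)
  len : List ℕ → ℕ

namespace LayeredTree

/-- The nodes at combinatorial depth `i`. -/
def layer (T : LayeredTree) (i : ℕ) : Finset (List ℕ) := T.nodes.filter fun u => u.length = i

/-- The layers `0, …, i` and the lengths of the edges between them. -/
def reveal (T : LayeredTree) (i : ℕ) : LTTView where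
  nodes := T.nodes.filter fun u => u.length ≤ i
  len := fun u => if u ∈ T.nodes ∧ u.length ≤ i then T.len u else 0

/-- The distance between two nodes: the nodes below which the path from `u` to `v` uses the edge to
the parent are those which have exactly one of `u` and `v` among their descendants. -/
def dist (T : LayeredTree) (u v : List ℕ) : ℕ :=
  ∑ w ∈ symmDiff u.tails.toFinset v.tails.toFinset, T.len w

/-- The sum of all edge lengths. -/
def length (T : LayeredTree) : ℕ := ∑ u ∈ T.nodes.erase [], T.len u

/-- The distance from the root to the target. -/
def depth (T : LayeredTree) : ℕ := T.dist [] T.target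

end LayeredTree

/-- A deterministic algorithm for layered tree traversal: it maps the layers that have been revealed
and the position of the searcher in the last but one of them to a position in the last one. -/
structure LTTAlgorithm where
  next : LTTView → List ℕ → List ℕ
  next_mem : ∀ (T : LayeredTree) (i : ℕ) (u : List ℕ), i < T.target.length → u ∈ T.layer i →
    next (T.reveal (i + 1)) u ∈ T.layer (i + 1)

namespace LTTAlgorithm

/-- The position of the searcher in the layer `i`. -/
def pos (A : LTTAlgorithm) (T : LayeredTree) : ℕ → List ℕ
  | 0 => []
  | i + 1 => A.next (T.reveal (i + 1)) (A.pos T i)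

/-- The distance travelled by the searcher, through all layers and finally to the target. The last
term vanishes when the last layer is reduced to the target. -/
def cost (A : LTTAlgorithm) (T : LayeredTree) : ℕ :=
  (∑ i ∈ Finset.range T.target.length, T.dist (A.pos T i) (A.pos T (i + 1))) +
    T.dist (A.pos T T.target.length) T.target

end LTTAlgorithm

/-- A randomized algorithm is a probability distribution over deterministic ones. -/
abbrev RandomizedLTTAlgorithm : Type := PMF LTTAlgorithm

/-- The expected cost of a randomized algorithm. -/
def RandomizedLTTAlgorithm.expectedCost (A : RandomizedLTTAlgorithm) (T : LayeredTree) : ℝ≥0∞ :=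
  ∑' B : LTTAlgorithm, A B * (B.cost T : ℝ≥0∞)

end TreeMining

end

noncomputable section

open scoped ENNReal
open Classical

namespace TreeMining

/-! ### Game trees: how transport costs and depths change under the three moves of the adversary. -/

namespace GameTree

variable {T : GameTree}

/-! ### Descendants -/

/-! The robots explore while an auxiliary game is played along the explored tree. Each leaf of the
game tree is located on an edge of the explored tree. For a visited node `v`, let `λ_v` be the
proportion of the edge above `v` covered by the game, `X_v` the number of game robots below `v`, and
`Y_v` the number of real robots below `v`. Up to contractions the game tree is the covered part of
the explored tree, so moving the game robots costs `∑ λ_v |X_v - X'_v|`. Everything rests on the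
invariant moves ≤ cost of the game + `∑_{v ≠ root} (1 + λ_v - λ_v |Y_v - X_v|)`. Each summand is at
most 2 and the cost is at most `f(k, D)`, so the total number of moves is at most `2(n - 1) + f(k,
D)`.

The invariant survives because robots only make moves that are paid for. Entering a new node creates
a summand equal to 1 (`Valid.move_new`). On an edge with `λ_v = 1`, a robot goes up when `Y_v > X_v`
and down when `Y_v < X_v`, and the sum grows by 1 (`Valid.move_up`, `Valid.move_down`). A reaction
of the player lowers the sum by at most its transport cost (`potential_triangle`). The other events
of the game use that an edge of an open subtree that is not fully covered has exactly one robot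
below it: elongating a leaf with `x` game robots by `s` costs `s x` and changes the sum by `s (2 -
x)` (`Valid.elongateLeaf`); forking and killing are checked in the same way (`Valid.forkLeaf`,
`Valid.killLeaf`).

A robot is never blocked before the end (`Valid.step`). With all children of its node visited, it
compares loads with the branches below. At the location of a leaf with `m` open children there are
at least `m + 1` robots. Either the game has fewer robots there, and one goes up, or the game has at
least `m + 1` too and the leaf may be forked into `m` children; a leaf without open children is
killed. Elongations are performed as long as possible (`Valid.exists_eager`). This terminates
because each reaction costs at least the shortest leaf edge while the cost stays bounded.

For collective exploration all `k` robots move in every round, so the number of such rounds is at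
most the number of moves divided by `k`; one incomplete round and `D` rounds for the return complete
the bound. For layered traversal, edges of length 0 are contracted, the robots explore the
contracted tree until all of them are in the current layer, and the searcher imitates a uniformly
chosen robot. The sum of the `k` individual costs is at most the number of moves. -/

theorem IsDesc.refl (T : GameTree) (u : ℕ) : T.IsDesc u u := ⟨0, rfl⟩

theorem IsDesc.trans {u v w : ℕ} (h : T.IsDesc u v) (h' : T.IsDesc v w) : T.IsDesc u w := by
  obtain ⟨i, rfl⟩ := h
  obtain ⟨j, rfl⟩ := h'
  exact ⟨j + i, by rw [Function.iterate_add_apply]⟩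

theorem isDesc_parent (T : GameTree) (u : ℕ) : T.IsDesc u (T.parent u) := ⟨1, rfl⟩

theorem isDesc_iff {u w : ℕ} : T.IsDesc u w ↔ u = w ∨ T.IsDesc (T.parent u) w := by
  constructor
  · rintro ⟨i, rfl⟩
    cases i with
    | zero => exact Or.inl rfl
    | succ i => exact Or.inr ⟨i, rfl⟩
  · rintro (rfl | h)
    · exact IsDesc.refl T u
    · exact (isDesc_parent T u).trans h

theorem IsSimple.iterate_zero (hT : T.IsSimple) (i : ℕ) : T.parent^[i] 0 = 0 := by
  induction i with
  | zero => rfl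
  | succ i ih => rw [Function.iterate_succ_apply, hT.parent_root, ih]

theorem IsSimple.isDesc_zero (hT : T.IsSimple) {u : ℕ} (h : T.IsDesc 0 u) : u = 0 := by
  obtain ⟨i, rfl⟩ := h
  exact hT.iterate_zero i

theorem IsSimple.iterate_mem (hT : T.IsSimple) {v : ℕ} (hv : v ∈ T.verts) (i : ℕ) :
    T.parent^[i] v ∈ T.verts := by
  induction i generalizing v with
  | zero => exact hv
  | succ i ih => exact ih (hT.parent_mem v hv)

theorem IsSimple.parent_ne (hT : T.IsSimple) {v : ℕ} (hv : v ∈ T.verts) (h0 : v ≠ 0) :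
    T.parent v ≠ v := by
  intro h
  obtain ⟨i, hi⟩ := hT.reaches_root v hv
  rw [Function.iterate_fixed h] at hi
  exact h0 hi

theorem mem_leaves {v : ℕ} : v ∈ T.leaves ↔ v ∈ T.verts ∧ T.children v = ∅ := by
  simp [leaves]

theorem mem_children {u v : ℕ} : u ∈ T.children v ↔ u ∈ T.verts ∧ u ≠ 0 ∧ T.parent u = v := by
  simp [children]

theorem leaves_subset (T : GameTree) : T.leaves ⊆ T.verts := Finset.filter_subset _ _

theorem IsSimple.parent_ne_leaf (hT : T.IsSimple) {v l : ℕ} (hv : v ∈ T.verts)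
    (hl : l ∈ T.leaves) (hl0 : l ≠ 0) : T.parent v ≠ l := by
  intro h
  have hv0 : v ≠ 0 := by
    rintro rfl
    exact hl0 (h.symm.trans hT.parent_root)
  have : v ∈ T.children l := mem_children.2 ⟨hv, hv0, h⟩
  rw [(mem_leaves.1 hl).2] at this
  simp at this

theorem IsSimple.isDesc_leaf (hT : T.IsSimple) {v l : ℕ} (hv : v ∈ T.verts)
    (hl : l ∈ T.leaves) (hl0 : l ≠ 0) (h : T.IsDesc v l) : v = l := by
  obtain ⟨i, hi⟩ := h
  cases i with
  | zero => exact hi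
  | succ i =>
    rw [Function.iterate_succ_apply'] at hi
    exact absurd hi (hT.parent_ne_leaf (hT.iterate_mem hv i) hl hl0)

theorem IsSimple.load_leaf (hT : T.IsSimple) {l : ℕ} (hl : l ∈ T.leaves) (hl0 : l ≠ 0)
    (x : ℕ → ℕ) : T.load x l = x l := by
  unfold load
  have : T.verts.filter (fun v => T.IsDesc v l) = {l} := by
    ext v
    simp only [Finset.mem_filter, Finset.mem_singleton]
    constructor
    · rintro ⟨hv, h⟩
      exact hT.isDesc_leaf hv hl hl0 h
    · rintro rfl
      exact ⟨T.leaves_subset hl, IsDesc.refl T v⟩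
  rw [this, Finset.sum_singleton]

/-- In a tree with at least two leaves, every leaf has a sibling. -/
theorem IsSimple.siblings_nonempty (hT : T.IsSimple) {l : ℕ} (hl : l ∈ T.leaves) (hl0 : l ≠ 0)
    (h2 : 2 ≤ T.leaves.card) : (T.siblings l).Nonempty := by
  have hlp : l ∈ T.children (T.parent l) := mem_children.2 ⟨T.leaves_subset hl, hl0, rfl⟩
  by_contra hne
  rw [Finset.not_nonempty_iff_eq_empty] at hne
  have hch : T.children (T.parent l) = {l} := by
    rw [← Finset.insert_erase hlp]
    change insert l (T.siblings l) = {l}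
    rw [hne]
    rfl
  -- Only the root may have a single child. If that child were the leaf `l`, every node other than
  -- the root would lie below `l`, which excludes a second leaf.
  by_cases hp : T.parent l = 0
  · rw [hp] at hch
    obtain ⟨m, hm, hml⟩ := Finset.exists_mem_ne (by omega : 1 < T.leaves.card) l
    have key : ∀ i v, v ∈ T.verts → v ≠ 0 → T.parent^[i] v = 0 → T.IsDesc v l := by
      intro i
      induction i with
      | zero => intro v _ hv0 h; exact absurd h hv0
      | succ i ih =>
        intro v hv hv0 h
        by_cases hpv : T.parent v = 0
        · have : v ∈ T.children 0 := mem_children.2 ⟨hv, hv0, hpv⟩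
          rw [hch, Finset.mem_singleton] at this
          rw [this]
          exact IsDesc.refl T l
        · exact (isDesc_parent T v).trans (ih _ (hT.parent_mem v hv) hpv h)
    have hm0 : m ≠ 0 := by
      rintro rfl
      have : l ∈ T.children 0 := by rw [hch]; simp
      rw [(mem_leaves.1 hm).2] at this
      simp at this
    obtain ⟨i, hi⟩ := hT.reaches_root m (T.leaves_subset hm)
    exact hml (hT.isDesc_leaf (T.leaves_subset hm) hl hl0 (key i m (T.leaves_subset hm) hm0 hi))
  · exact hT.card_children _ (hT.parent_mem l (T.leaves_subset hl)) hp (by rw [hch]; simp)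

/-! ### Depth as a transport cost -/

/-- A unit mass carried from `v` to the root crosses exactly the edges above `v`. Every formula for
the change of transport costs therefore also gives the change of depths. -/
theorem IsSimple.depth_eq_transport (hT : T.IsSimple) {v : ℕ} (hv : v ∈ T.verts) :
    T.depth v = T.transport (fun u => if u = v then 1 else 0) (fun u => if u = 0 then 1 else 0) := by
  unfold depth transport
  rw [show T.verts.filter (fun u => u ≠ 0 ∧ T.IsDesc v u) =
    (T.verts.erase 0).filter (fun u => T.IsDesc v u) by ext; simp; tauto]
  rw [Finset.sum_filter]
  refine Finset.sum_congr rfl fun u hu => ?_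
  have hu0 : u ≠ 0 := (Finset.mem_erase.1 hu).1
  have h0 : T.load (fun u => if u = 0 then 1 else 0) u = 0 := by
    unfold load
    refine Finset.sum_eq_zero fun w hw => ?_
    rw [if_neg]
    rintro rfl
    exact hu0 (hT.isDesc_zero (Finset.mem_filter.1 hw).2)
  have h1 : T.load (fun u => if u = v then 1 else 0) u = if T.IsDesc v u then 1 else 0 := by
    unfold load
    rw [Finset.sum_ite_eq']
    simp [hv]
  rw [h0, h1]
  split_ifs <;> simp

theorem load_congr {x x' : ℕ → ℕ} (h : ∀ v ∈ T.verts, x v = x' v) (u : ℕ) :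
    T.load x u = T.load x' u :=
  Finset.sum_congr rfl fun v hv => h v (Finset.mem_filter.1 hv).1

theorem transport_congr {x x' y y' : ℕ → ℕ} (h : ∀ v ∈ T.verts, x v = y v)
    (h' : ∀ v ∈ T.verts, x' v = y' v) : T.transport x x' = T.transport y y' := by
  unfold transport
  simp only [load_congr h, load_congr h']

/-- One term of a sum of nonnegative terms. It gives the lower bound on the cost of a reaction, from
which the termination of elongations follows. -/
theorem IsSimple.le_transport (hT : T.IsSimple) {l : ℕ} (hl : l ∈ T.leaves) (hl0 : l ≠ 0)
    (x x' : ℕ → ℕ) : T.len l * |(x l : ℝ) - x' l| ≤ T.transport x x' := by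
  unfold transport
  have := Finset.single_le_sum (s := T.verts.erase 0)
    (f := fun u => T.len u * |(T.load x u : ℝ) - (T.load x' u : ℝ)|)
    (fun u hu => mul_nonneg (hT.len_nonneg u (Finset.mem_erase.1 hu).2 (Finset.mem_erase.1 hu).1)
      (abs_nonneg _)) (Finset.mem_erase.2 ⟨hl0, T.leaves_subset hl⟩)
  simpa only [hT.load_leaf hl hl0] using this

theorem IsSimple.transport_nonneg (hT : T.IsSimple) (x x' : ℕ → ℕ) : 0 ≤ T.transport x x' :=
  Finset.sum_nonneg fun u hu => mul_nonneg
    (hT.len_nonneg u (Finset.mem_erase.1 hu).2 (Finset.mem_erase.1 hu).1) (abs_nonneg _)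

/-! ### Trees that occur in the game -/

/-- The simple trees whose root is not a leaf, and whose leaves have edges of positive length as
soon as there are two of them. -/
structure Good (T : GameTree) : Prop where
  simple : T.IsSimple
  root_not_leaf : 0 ∉ T.leaves
  len_pos : 2 ≤ T.leaves.card → ∀ l ∈ T.leaves, 0 < T.len l

theorem Good.ne_zero (hT : T.Good) {l : ℕ} (hl : l ∈ T.leaves) : l ≠ 0 := by
  rintro rfl
  exact hT.root_not_leaf hl

theorem start_leaves : start.leaves = {1} := by
  ext v
  have h1 : 1 ∈ start.children 0 := mem_children.2 ⟨by simp [start], one_ne_zero, rfl⟩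
  have h2 : start.children 1 = ∅ := by simp [children, start]
  rw [mem_leaves]
  constructor
  · rintro ⟨hv, h⟩
    simp only [start, Finset.mem_insert, Finset.mem_singleton] at hv ⊢
    rcases hv with rfl | rfl
    · rw [h] at h1
      simp at h1
    · rfl
  · intro hv
    rw [Finset.mem_singleton.1 hv]
    exact ⟨by simp [start], h2⟩

theorem start_good : start.Good where
  simple :=
    { root_mem := by simp [start]
      parent_root := rfl
      parent_mem := fun v _ => by simp [start]
      reaches_root := fun v _ => ⟨1, rfl⟩
      len_nonneg := fun v _ _ => le_rfl
      card_children := by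
        intro v hv h0
        have : v ∈ start.leaves := by
          rw [start_leaves]
          simp only [start, Finset.mem_insert, Finset.mem_singleton] at hv ⊢
          tauto
        rw [(mem_leaves.1 this).2]
        simp }
  root_not_leaf := by rw [start_leaves]; simp
  len_pos := by rw [start_leaves]; simp

theorem start_transport (x x' : ℕ → ℕ) : start.transport x x' = 0 :=
  Finset.sum_eq_zero fun u _ => by simp [start]

/-! ### Elongation -/

theorem Good.elongate (hT : T.Good) {l : ℕ} (hl : l ∈ T.leaves) {s : ℝ} (hs : 0 ≤ s) :
    (T.elongate l s).Good where
  simple :=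
    { root_mem := hT.simple.root_mem
      parent_root := hT.simple.parent_root
      parent_mem := hT.simple.parent_mem
      reaches_root := hT.simple.reaches_root
      len_nonneg := by
        intro v hv h0
        have h1 := hT.simple.len_nonneg v hv h0
        have h2 := hT.simple.len_nonneg l (T.leaves_subset hl) (hT.ne_zero hl)
        simp only [GameTree.elongate, Function.update_apply]
        split_ifs <;> linarith
      card_children := hT.simple.card_children }
  root_not_leaf := hT.root_not_leaf
  len_pos := by
    intro h2 v hv
    have h1 := hT.len_pos h2 v hv
    have h3 := hT.len_pos h2 l hl
    simp only [GameTree.elongate, Function.update_apply]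
    split_ifs <;> linarith

theorem Good.transport_elongate (hT : T.Good) {l : ℕ} (hl : l ∈ T.leaves) (s : ℝ) (x x' : ℕ → ℕ) :
    (T.elongate l s).transport x x' = T.transport x x' + s * |(x l : ℝ) - x' l| := by
  unfold transport
  have hmem : l ∈ T.verts.erase 0 := Finset.mem_erase.2 ⟨hT.ne_zero hl, T.leaves_subset hl⟩
  change ∑ u ∈ T.verts.erase 0, Function.update T.len l (T.len l + s) u *
    |(T.load x u : ℝ) - (T.load x' u : ℝ)| = _
  rw [← Finset.add_sum_erase _ _ hmem, ← Finset.add_sum_erase _ _ hmem, Function.update_self,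
    hT.simple.load_leaf hl (hT.ne_zero hl), hT.simple.load_leaf hl (hT.ne_zero hl),
    Finset.sum_congr rfl (g := fun u => T.len u * |(T.load x u : ℝ) - (T.load x' u : ℝ)|)]
  · ring
  · intro u hu
    rw [Function.update_of_ne (Finset.mem_erase.1 hu).1]

theorem Good.depth_elongate (hT : T.Good) {l v : ℕ} (hl : l ∈ T.leaves) (hv : v ∈ T.leaves)
    {s : ℝ} (hs : 0 ≤ s) :
    (T.elongate l s).depth v = T.depth v + if v = l then s else 0 := by
  rw [(hT.elongate hl hs).simple.depth_eq_transport (T.leaves_subset hv),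
    hT.simple.depth_eq_transport (T.leaves_subset hv), hT.transport_elongate hl,
    if_neg (hT.ne_zero hl)]
  by_cases h : v = l
  · simp [h]
  · simp [h, Ne.symm h]

/-! ### Fork -/

/-- The distribution in which the robots on the elements of `C` are sent to `l`. -/
def push (l : ℕ) (C : Finset ℕ) (x : ℕ → ℕ) (u : ℕ) : ℕ :=
  if u = l then x l + ∑ c ∈ C, x c else if u ∈ C then 0 else x u

section Fork

variable {l : ℕ} {C : Finset ℕ} {δ : ℝ}

theorem fork_parent_of_mem (hC : Disjoint C T.verts) {u : ℕ} (hu : u ∈ T.verts) :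
    (T.fork l C δ).parent u = T.parent u := by
  have : u ∉ C := fun h => Finset.disjoint_left.1 hC h hu
  simp [fork, this]

theorem IsSimple.fork_iterate (hT : T.IsSimple) (hC : Disjoint C T.verts) {u : ℕ}
    (hu : u ∈ T.verts) (i : ℕ) : (T.fork l C δ).parent^[i] u = T.parent^[i] u := by
  induction i generalizing u with
  | zero => rfl
  | succ i ih =>
    rw [Function.iterate_succ_apply, Function.iterate_succ_apply, fork_parent_of_mem hC hu,
      ih (hT.parent_mem u hu)]

theorem IsSimple.fork_isDesc (hT : T.IsSimple) (hC : Disjoint C T.verts) {u w : ℕ}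
    (hu : u ∈ T.verts) : (T.fork l C δ).IsDesc u w ↔ T.IsDesc u w := by
  unfold IsDesc
  simp only [hT.fork_iterate hC hu]

theorem IsSimple.fork_isDesc_new (hT : T.IsSimple) (hC : Disjoint C T.verts) (hl : l ∈ T.verts)
    {c w : ℕ} (hc : c ∈ C) : (T.fork l C δ).IsDesc c w ↔ c = w ∨ T.IsDesc l w := by
  rw [isDesc_iff, show (T.fork l C δ).parent c = l by simp [fork, hc], hT.fork_isDesc hC hl]

theorem Good.fork_children (hT : T.Good) (hC : Disjoint C T.verts) (hl : l ∈ T.leaves) (v : ℕ) :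
    (T.fork l C δ).children v = if v = l then C else if v ∈ C then ∅ else T.children v := by
  have h0 : 0 ∉ C := fun h => Finset.disjoint_left.1 hC h hT.simple.root_mem
  have hCl : ∀ u, T.parent u = l → u ∈ T.verts → False := fun u hu hv =>
    hT.simple.parent_ne_leaf hv hl (hT.ne_zero hl) hu
  have hd : ∀ u, u ∈ C → u ∉ T.verts := fun u h => Finset.disjoint_left.1 hC h
  have hpm := hT.simple.parent_mem
  have hlC : l ∉ C := fun h => hd l h (T.leaves_subset hl)
  ext u
  rw [mem_children]
  by_cases huC : u ∈ C
  · have hu0 : u ≠ 0 := by rintro rfl; exact h0 huC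
    have : T.fork l C δ = ⟨T.verts ∪ C, fun u => if u ∈ C then l else T.parent u,
      fun u => if u ∈ C then δ else T.len u⟩ := rfl
    simp only [this, Finset.mem_union, huC, or_true, hu0, ne_eq, not_false_eq_true, if_true,
      true_and]
    split_ifs with h1 h2
    · simp [h1, huC]
    · simp [Ne.symm h1]
    · rw [mem_children]
      simp [hd u huC, Ne.symm h1]
  · simp only [fork, Finset.mem_union, huC, or_false, if_false]
    split_ifs with h1 h2
    · subst h1
      simp only [huC, iff_false]
      rintro ⟨h3, -, h4⟩
      exact hCl u h4 h3
    · simp only [Finset.notMem_empty, iff_false]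
      rintro ⟨h3, -, h4⟩
      exact hd v h2 (h4 ▸ hpm u h3)
    · rw [mem_children]

theorem Good.fork_leaves (hT : T.Good) (hC : Disjoint C T.verts) (hl : l ∈ T.leaves)
    (hne : C.Nonempty) : (T.fork l C δ).leaves = T.leaves.erase l ∪ C := by
  have hd : ∀ u, u ∈ C → u ∉ T.verts := fun u h => Finset.disjoint_left.1 hC h
  ext v
  rw [mem_leaves, hT.fork_children hC hl, Finset.mem_union, Finset.mem_erase, mem_leaves]
  change v ∈ T.verts ∪ C ∧ _ ↔ _
  rw [Finset.mem_union]
  split_ifs with h1 h2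
  · subst h1
    have := hne.ne_empty
    have h3 : v ∉ C := fun h => hd v h (T.leaves_subset hl)
    tauto
  · simp [h2]
  · tauto

theorem Good.fork (hT : T.Good) (hC : Disjoint C T.verts) (hl : l ∈ T.leaves) (hC2 : 2 ≤ C.card)
    (hδ : 0 < δ) : (T.fork l C δ).Good := by
  have hd : ∀ u, u ∈ C → u ∉ T.verts := fun u h => Finset.disjoint_left.1 hC h
  have hne : C.Nonempty := Finset.card_pos.1 (by omega)
  have hlv := T.leaves_subset hl
  have h0 : 0 ∉ C := fun h => hd 0 h hT.simple.root_mem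
  refine ⟨⟨?_, ?_, ?_, ?_, ?_, ?_⟩, ?_, ?_⟩
  · exact Finset.mem_union_left _ hT.simple.root_mem
  · rw [fork_parent_of_mem hC hT.simple.root_mem, hT.simple.parent_root]
  · intro v hv
    refine Finset.mem_union_left _ ?_
    change (if v ∈ C then l else T.parent v) ∈ T.verts
    split_ifs with h
    · exact hlv
    · exact hT.simple.parent_mem v ((Finset.mem_union.1 hv).resolve_right h)
  · intro v hv
    change (T.fork l C δ).IsDesc v 0
    by_cases h : v ∈ C
    · exact (hT.simple.fork_isDesc_new hC hlv h).2 (Or.inr (hT.simple.reaches_root l hlv))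
    · have hv' := (Finset.mem_union.1 hv).resolve_right h
      exact (hT.simple.fork_isDesc hC hv').2 (hT.simple.reaches_root v hv')
  · intro v hv hv0
    change 0 ≤ if v ∈ C then δ else T.len v
    split_ifs with h
    · exact hδ.le
    · exact hT.simple.len_nonneg v ((Finset.mem_union.1 hv).resolve_right h) hv0
  · intro v hv hv0
    rw [hT.fork_children hC hl]
    split_ifs with h1 h2
    · omega
    · simp
    · exact hT.simple.card_children v ((Finset.mem_union.1 hv).resolve_right h2) hv0
  · rw [hT.fork_leaves hC hl hne]
    simp [h0, hT.root_not_leaf]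
  · intro _ v hv
    rw [hT.fork_leaves hC hl hne] at hv
    change 0 < if v ∈ C then δ else T.len v
    split_ifs with h
    · exact hδ
    · have h3 := (Finset.mem_union.1 hv).resolve_right h
      refine hT.len_pos ?_ v (Finset.mem_erase.1 h3).2
      exact Finset.one_lt_card.2 ⟨v, (Finset.mem_erase.1 h3).2, l, hl, (Finset.mem_erase.1 h3).1⟩

/-- An old node cannot distinguish a robot on a child of `l` from a robot on `l` itself. -/
theorem IsSimple.fork_load (hT : T.IsSimple) (hC : Disjoint C T.verts) (hl : l ∈ T.verts)
    (x : ℕ → ℕ) {u : ℕ} (hu : u ∈ T.verts) : (T.fork l C δ).load x u = T.load (push l C x) u := by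
  have hd : ∀ u, u ∈ C → u ∉ T.verts := fun u h => Finset.disjoint_left.1 hC h
  unfold load
  change ∑ v ∈ (T.verts ∪ C).filter _, x v = _
  rw [Finset.filter_union, Finset.sum_union (Finset.disjoint_filter_filter hC.symm)]
  have e1 : T.verts.filter (fun v => (T.fork l C δ).IsDesc v u) =
      T.verts.filter (fun v => T.IsDesc v u) :=
    Finset.filter_congr fun v hv => hT.fork_isDesc hC hv
  have e2 : C.filter (fun v => (T.fork l C δ).IsDesc v u) = if T.IsDesc l u then C else ∅ := by
    split_ifs with h
    · rw [Finset.filter_true_of_mem]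
      exact fun c hc => (hT.fork_isDesc_new hC hl hc).2 (Or.inr h)
    · rw [Finset.filter_false_of_mem]
      intro c hc h'
      rcases (hT.fork_isDesc_new hC hl hc).1 h' with rfl | h'
      · exact hd c hc hu
      · exact h h'
  rw [e1, e2]
  by_cases h : T.IsDesc l u
  · have hm : l ∈ T.verts.filter (fun v => T.IsDesc v u) := by simp [hl, h]
    rw [if_pos h, ← Finset.add_sum_erase _ _ hm, ← Finset.add_sum_erase _ _ hm]
    simp only [push, if_true]
    have e3 : ∀ v ∈ (T.verts.filter (fun v => T.IsDesc v u)).erase l,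
        (if v = l then x l + ∑ c ∈ C, x c else if v ∈ C then 0 else x v) = x v := by
      intro v hv
      rw [if_neg (Finset.mem_erase.1 hv).1, if_neg]
      exact fun hc => hd v hc (Finset.mem_filter.1 (Finset.mem_erase.1 hv).2).1
    rw [Finset.sum_congr rfl e3]
    ring
  · rw [if_neg h, Finset.sum_empty, add_zero]
    refine Finset.sum_congr rfl fun v hv => ?_
    obtain ⟨hv, hvu⟩ := Finset.mem_filter.1 hv
    rw [push, if_neg, if_neg]
    · exact fun hc => hd v hc hv
    · rintro rfl
      exact h hvu

/-- The old edges see the pushed distributions, and each new edge carries the robots of its own leaf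
only. -/
theorem Good.transport_fork (hT : T.Good) (hC : Disjoint C T.verts) (hl : l ∈ T.leaves)
    (hC2 : 2 ≤ C.card) (hδ : 0 < δ) (x x' : ℕ → ℕ) :
    (T.fork l C δ).transport x x' =
      T.transport (push l C x) (push l C x') + δ * ∑ c ∈ C, |(x c : ℝ) - x' c| := by
  have hd : ∀ u, u ∈ C → u ∉ T.verts := fun u h => Finset.disjoint_left.1 hC h
  have h0 : 0 ∉ C := fun h => hd 0 h hT.simple.root_mem
  have hlv := T.leaves_subset hl
  have hg := hT.fork hC hl hC2 hδ
  have hlea := hT.fork_leaves (δ := δ) hC hl (Finset.card_pos.1 (by omega))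
  unfold transport
  change ∑ u ∈ (T.verts ∪ C).erase 0, (if u ∈ C then δ else T.len u) *
    |((T.fork l C δ).load x u : ℝ) - ((T.fork l C δ).load x' u : ℝ)| = _
  rw [Finset.erase_union_distrib, Finset.erase_eq_of_notMem h0, Finset.sum_union
    (hC.symm.mono_left (Finset.erase_subset _ _)), Finset.mul_sum]
  congr 1
  · refine Finset.sum_congr rfl fun u hu => ?_
    have hu := (Finset.mem_erase.1 hu).2
    rw [if_neg fun hc => hd u hc hu, hT.simple.fork_load hC hlv x hu,
      hT.simple.fork_load hC hlv x' hu]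
  · refine Finset.sum_congr rfl fun c hc => ?_
    have : c ∈ (T.fork l C δ).leaves := by rw [hlea]; exact Finset.mem_union_right _ hc
    rw [if_pos hc, hg.simple.load_leaf this (hg.ne_zero this),
      hg.simple.load_leaf this (hg.ne_zero this)]

theorem Good.depth_fork_old (hT : T.Good) (hC : Disjoint C T.verts) (hl : l ∈ T.leaves)
    (hC2 : 2 ≤ C.card) (hδ : 0 < δ) {v : ℕ} (hv : v ∈ T.verts) :
    (T.fork l C δ).depth v = T.depth v := by
  have hd : ∀ u, u ∈ C → u ∉ T.verts := fun u h => Finset.disjoint_left.1 hC h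
  rw [(hT.fork hC hl hC2 hδ).simple.depth_eq_transport (Finset.mem_union_left _ hv),
    hT.simple.depth_eq_transport hv, hT.transport_fork hC hl hC2 hδ]
  have h1 : ∀ w ∈ T.verts, ∀ c ∈ C, (if c = w then 1 else 0) = 0 := by
    intro w hw c hc
    rw [if_neg]
    rintro rfl
    exact hd c hc hw
  have h2 : ∀ w ∈ T.verts, ∀ u ∈ T.verts, push l C (fun u => if u = w then 1 else 0) u =
      if u = w then 1 else 0 := by
    intro w hw u hu
    simp only [push]
    rw [Finset.sum_eq_zero (h1 w hw), if_neg (fun h : u ∈ C => hd u h hu)]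
    by_cases h : u = l
    · subst h; simp
    · simp [h]
  rw [transport_congr (h2 v hv) (h2 0 hT.simple.root_mem), Finset.sum_eq_zero, mul_zero, add_zero]
  intro c hc
  simp only [h1 v hv c hc, h1 0 hT.simple.root_mem c hc]
  simp

theorem Good.depth_fork_new (hT : T.Good) (hC : Disjoint C T.verts) (hl : l ∈ T.leaves)
    (hC2 : 2 ≤ C.card) (hδ : 0 < δ) {c : ℕ} (hc : c ∈ C) :
    (T.fork l C δ).depth c = T.depth l + δ := by
  have hd : ∀ u, u ∈ C → u ∉ T.verts := fun u h => Finset.disjoint_left.1 hC h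
  have h0 : 0 ∉ C := fun h => hd 0 h hT.simple.root_mem
  have hl0 := hT.ne_zero hl
  have hlv := T.leaves_subset hl
  have hlc : l ≠ c := by rintro rfl; exact hd l hc hlv
  rw [(hT.fork hC hl hC2 hδ).simple.depth_eq_transport (Finset.mem_union_right _ hc),
    hT.simple.depth_eq_transport hlv, hT.transport_fork hC hl hC2 hδ]
  congr 1
  · refine transport_congr ?_ ?_
    · intro u hu
      have : u ≠ c := by rintro rfl; exact hd u hc hu
      have h3 : u ∉ C := fun h => hd u h hu
      by_cases h : u = l
      · simp [push, h, hlc, hc]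
      · simp [push, h, h3, this]
    · intro u hu
      have h3 : u ∉ C := fun h => hd u h hu
      by_cases h : u = l
      · simp [push, h, hl0, h0]
      · simp [push, h, h3]
  · have : ∀ a ∈ C, |(((if a = c then 1 else 0 : ℕ)) : ℝ) - ((if a = 0 then 1 else 0 : ℕ) : ℝ)| =
        if a = c then 1 else 0 := by
      intro a ha
      have : a ≠ 0 := by rintro rfl; exact h0 ha
      simp only [this, if_false]
      split_ifs <;> simp
    rw [Finset.sum_congr rfl this]
    simp [hc]

end Fork

end GameTree

namespace GameTree

variable {T : GameTree} {l : ℕ}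

/-! ### Killing a leaf -/

theorem kill_of_not (h : ¬ (T.parent l ≠ 0 ∧ (T.siblings l).card = 1)) :
    T.kill l = ⟨T.verts.erase l, T.parent, T.len⟩ := if_neg h

theorem kill_of_merge (h : T.parent l ≠ 0 ∧ (T.siblings l).card = 1) {u : ℕ}
    (hu : T.siblings l = {u}) :
    T.kill l = ⟨(T.verts.erase l).erase (T.parent l),
      fun w => if w = u then T.parent (T.parent l) else T.parent w,
      fun w => if w = u then T.len (T.parent l) + T.len w else T.len w⟩ := by
  unfold kill
  rw [if_pos h, hu]
  simp only [Finset.mem_singleton]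

theorem kill_verts_subset (T : GameTree) (l : ℕ) : (T.kill l).verts ⊆ T.verts := by
  unfold kill
  split_ifs
  · exact (Finset.erase_subset _ _).trans (Finset.erase_subset _ _)
  · exact Finset.erase_subset _ _

/-- What is needed about the game tree after a leaf was killed. -/
structure KillSpec (T : GameTree) (l : ℕ) : Prop where
  good : (T.kill l).Good
  leaves_eq : (T.kill l).leaves = T.leaves.erase l
  -- Mass at the root is allowed, so that the statement also applies to the unit masses that express
  -- depths.
  transport_eq : ∀ x x' : ℕ → ℕ, x l = 0 → x' l = 0 →
    (∀ v, v ≠ 0 → v ∈ T.verts → v ∉ T.leaves → x v = 0 ∧ x' v = 0) →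
    (T.kill l).transport x x' = T.transport x x'

theorem Good.kill_spec_of_not (hT : T.Good) (hl : l ∈ T.leaves) (h2 : 2 ≤ T.leaves.card)
    (h : ¬ (T.parent l ≠ 0 ∧ (T.siblings l).card = 1)) : KillSpec T l := by
  have hl0 := hT.ne_zero hl
  have hlv := T.leaves_subset hl
  have hS := hT.simple
  have hsib := hS.siblings_nonempty hl hl0 h2
  have hch : ∀ w, (T.kill l).children w = (T.children w).erase l := by
    intro w
    ext u
    rw [mem_children, kill_of_not h, Finset.mem_erase, Finset.mem_erase, mem_children]
    change _ ∧ _ ∧ T.parent u = w ↔ _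
    tauto
  have hchl : ∀ w, w ≠ T.parent l → (T.children w).erase l = T.children w := by
    intro w hw
    refine Finset.erase_eq_of_notMem fun hm => hw (mem_children.1 hm).2.2.symm
  have hverts : (T.kill l).verts = T.verts.erase l := by rw [kill_of_not h]
  have hpar : (T.kill l).parent = T.parent := by rw [kill_of_not h]
  have hlen : (T.kill l).len = T.len := by rw [kill_of_not h]
  have hdesc : ∀ v w, (T.kill l).IsDesc v w ↔ T.IsDesc v w := by
    intro v w
    unfold IsDesc
    rw [hpar]
  have hleaves : (T.kill l).leaves = T.leaves.erase l := by
    ext v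
    rw [mem_leaves, hverts, hch, Finset.mem_erase, Finset.mem_erase, mem_leaves]
    by_cases hv : v = T.parent l
    · subst hv
      have h1 : (T.children (T.parent l)).erase l ≠ ∅ := hsib.ne_empty
      have h3 : T.children (T.parent l) ≠ ∅ := fun h => by simp [h] at h1
      tauto
    · rw [hchl v hv, and_assoc]
  have hsimple : (T.kill l).IsSimple := by
    refine ⟨?_, ?_, ?_, ?_, ?_, ?_⟩
    · rw [hverts]; exact Finset.mem_erase.2 ⟨hl0.symm, hS.root_mem⟩
    · rw [hpar, hS.parent_root]
    · intro v hv
      rw [hverts, Finset.mem_erase] at *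
      rw [hpar]
      exact ⟨hS.parent_ne_leaf hv.2 hl hl0, hS.parent_mem v hv.2⟩
    · intro v hv
      rw [hpar]
      exact hS.reaches_root v (T.kill_verts_subset l hv)
    · intro v hv hv0
      rw [hlen]
      exact hS.len_nonneg v (T.kill_verts_subset l hv) hv0
    · intro v hv hv0
      rw [hch]
      by_cases hp : v = T.parent l
      · subst hp
        exact fun h' => h ⟨hv0, h'⟩
      · rw [hchl v hp]
        exact hS.card_children v (T.kill_verts_subset l hv) hv0
  refine ⟨⟨hsimple, ?_, ?_⟩, hleaves, ?_⟩
  · rw [hleaves]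
    simp [hT.root_not_leaf]
  · intro _ v hv
    rw [hleaves, Finset.mem_erase] at hv
    rw [hlen]
    exact hT.len_pos h2 v hv.2
  · intro x x' hx hx' _
    have hload : ∀ z : ℕ → ℕ, z l = 0 → ∀ u, (T.kill l).load z u = T.load z u := by
      intro z hz u
      unfold load
      rw [hverts]
      simp only [hdesc]
      refine Finset.sum_subset (Finset.filter_subset_filter _ (Finset.erase_subset _ _)) ?_
      intro v hv hv'
      have : v = l := by
        by_contra hne
        simp only [Finset.mem_filter, Finset.mem_erase] at hv hv'
        tauto
      rw [this, hz]
    unfold transport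
    simp only [hload x hx, hload x' hx', hlen, hverts]
    refine Finset.sum_subset (Finset.erase_subset_erase _ (Finset.erase_subset _ _)) ?_
    intro v hv hv'
    have : v = l := by
      by_contra hne
      simp only [Finset.mem_erase] at hv hv'
      tauto
    rw [this, hS.load_leaf hl hl0, hS.load_leaf hl hl0, hx, hx']
    simp

/-- The suppressed node `p` and its remaining child `u` have the same load, since neither `l` nor
the inner node `p` hosts a robot. The terms of the two edges therefore add up to the term of the
merged edge. -/
theorem Good.kill_spec_of_merge (hT : T.Good) (hl : l ∈ T.leaves) (h2 : 2 ≤ T.leaves.card)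
    (h : T.parent l ≠ 0 ∧ (T.siblings l).card = 1) : KillSpec T l := by
  have hl0 := hT.ne_zero hl
  have hlv := T.leaves_subset hl
  have hS := hT.simple
  obtain ⟨u, hu⟩ := Finset.card_eq_one.1 h.2
  set p := T.parent l with hp
  have hp0 : p ≠ 0 := h.1
  have hpv : p ∈ T.verts := hS.parent_mem l hlv
  have hus : u ∈ T.siblings l := by rw [hu]; simp
  have hul : u ≠ l := (Finset.mem_erase.1 hus).1
  have hup := mem_children.1 (Finset.mem_erase.1 hus).2
  rw [← hp] at hup
  obtain ⟨huv, hu0, hupar⟩ := hup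
  have hpl : p ≠ l := hS.parent_ne hlv hl0
  have hchp : ∀ w, w ∈ T.verts → T.parent w = p → w = l ∨ w = u := by
    intro w hw hwp
    by_contra! hne
    have hw0 : w ≠ 0 := by rintro rfl; exact hp0 (hwp.symm.trans hS.parent_root)
    have : w ∈ T.siblings l := Finset.mem_erase.2 ⟨hne.1, mem_children.2 ⟨hw, hw0, hwp⟩⟩
    rw [hu, Finset.mem_singleton] at this
    exact hne.2 this
  have hppp : T.parent p ≠ p := hS.parent_ne hpv hp0
  have hppl : T.parent p ≠ l := hS.parent_ne_leaf hpv hl hl0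
  have hup' : u ≠ p := by
    intro h'
    rw [h'] at hupar
    exact hppp hupar
  have hkill := kill_of_merge h hu
  rw [← hp] at hkill
  have hverts : (T.kill l).verts = (T.verts.erase l).erase p := by rw [hkill]
  have hmem : ∀ v, v ∈ (T.kill l).verts ↔ v ∈ T.verts ∧ v ≠ l ∧ v ≠ p := by
    intro v
    rw [hverts, Finset.mem_erase, Finset.mem_erase]
    tauto
  have hparu : (T.kill l).parent u = T.parent p := by rw [hkill]; simp
  have hpar : ∀ w, w ≠ u → (T.kill l).parent w = T.parent w := by
    intro w hw
    rw [hkill]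
    simp [hw]
  have hlenu : (T.kill l).len u = T.len p + T.len u := by rw [hkill]; simp
  have hlen : ∀ w, w ≠ u → (T.kill l).len w = T.len w := by
    intro w hw
    rw [hkill]
    simp [hw]
  have hparmem : ∀ v ∈ (T.kill l).verts, (T.kill l).parent v ∈ (T.kill l).verts := by
    intro v hv
    rw [hmem] at hv ⊢
    by_cases hvu : v = u
    · rw [hvu, hparu]
      exact ⟨hS.parent_mem p hpv, hppl, hppp⟩
    · rw [hpar v hvu]
      refine ⟨hS.parent_mem v hv.1, hS.parent_ne_leaf hv.1 hl hl0, fun h' => ?_⟩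
      rcases hchp v hv.1 h' with h' | h'
      · exact hv.2.1 h'
      · exact hvu h'
  have hdesc1 : ∀ v w, (T.kill l).IsDesc v w → T.IsDesc v w := by
    rintro v w ⟨i, rfl⟩
    induction i generalizing v with
    | zero => exact IsDesc.refl T v
    | succ i ih =>
      rw [Function.iterate_succ_apply]
      by_cases hvu : v = u
      · have := ih ((T.kill l).parent v)
        refine IsDesc.trans ?_ this
        rw [hvu, hparu, ← hupar]
        exact ⟨2, rfl⟩
      · have := ih ((T.kill l).parent v)
        refine IsDesc.trans ?_ this
        rw [hpar v hvu]
        exact isDesc_parent T v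
  -- Strong induction is needed because one step of the new parent function from `u` replaces two
  -- steps of the old one.
  have hdesc2 : ∀ i v, v ∈ (T.kill l).verts → ∀ w ∈ (T.kill l).verts, T.parent^[i] v = w →
      (T.kill l).IsDesc v w := by
    intro i
    induction i using Nat.strong_induction_on with
    | _ i ih =>
      intro v hv w hw hi
      cases i with
      | zero =>
        rw [← hi]
        exact IsDesc.refl _ v
      | succ i =>
        rw [Function.iterate_succ_apply] at hi
        refine IsDesc.trans (isDesc_parent _ v) ?_
        by_cases hvu : v = u
        · rw [hvu, hupar] at hi
          cases i with
          | zero => exact absurd hi.symm ((hmem w).1 hw).2.2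
          | succ i =>
            rw [Function.iterate_succ_apply] at hi
            refine ih i (by omega) _ (hparmem v hv) w hw ?_
            rw [hvu, hparu, hi]
        · refine ih i (by omega) _ (hparmem v hv) w hw ?_
          rw [hpar v hvu, hi]
  have hdesc : ∀ v ∈ (T.kill l).verts, ∀ w ∈ (T.kill l).verts,
      ((T.kill l).IsDesc v w ↔ T.IsDesc v w) := by
    intro v hv w hw
    exact ⟨hdesc1 v w, fun ⟨i, hi⟩ => hdesc2 i v hv w hw hi⟩
  have h0v : 0 ∈ (T.kill l).verts := (hmem 0).2 ⟨hS.root_mem, hl0.symm, hp0.symm⟩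
  have huv' : u ∈ (T.kill l).verts := (hmem u).2 ⟨huv, hul, hup'⟩
  have hch : ∀ w ∈ (T.kill l).verts, (T.kill l).children w =
      if w = T.parent p then insert u ((T.children w).erase p) else T.children w := by
    intro w hw
    rw [hmem] at hw
    ext v
    rw [mem_children, hmem]
    have key : T.parent v = w → v ≠ l := by
      rintro rfl rfl
      exact hw.2.2 rfl
    by_cases hvu : v = u
    · subst hvu
      rw [hparu]
      split_ifs with hwp
      · simp [hwp, huv, hul, hup', hu0]
      · have : w ≠ p := hw.2.2
        rw [mem_children]
        constructor
        · rintro ⟨-, -, h⟩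
          exact absurd h.symm hwp
        · rintro ⟨-, -, h⟩
          exact absurd (h.symm.trans hupar) this
    · rw [hpar v hvu]
      split_ifs with hwp
      · rw [Finset.mem_insert, Finset.mem_erase, mem_children]
        tauto
      · rw [mem_children]
        have : T.parent v = w → v ≠ p := by
          rintro rfl rfl
          exact hwp rfl
        tauto
  -- Among the children of the parent of `p`, the node `p` is replaced by `u`, so the numbers of
  -- children do not change.
  have hcard : ∀ w ∈ (T.kill l).verts, ((T.kill l).children w).card = (T.children w).card := by
    intro w hw
    rw [hch w hw]
    split_ifs with hwp
    · have hpc : p ∈ T.children w := mem_children.2 ⟨hpv, hp0, hwp.symm⟩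
      rw [Finset.card_insert_of_notMem, Finset.card_erase_add_one hpc]
      intro hm
      have := (mem_children.1 (Finset.mem_erase.1 hm).2).2.2
      rw [hupar] at this
      exact ((hmem w).1 hw).2.2 this.symm
    · rfl
  have hpnl : p ∉ T.leaves := by
    intro hm
    have : l ∈ T.children p := mem_children.2 ⟨hlv, hl0, rfl⟩
    rw [(mem_leaves.1 hm).2] at this
    simp at this
  have hleaves : (T.kill l).leaves = T.leaves.erase l := by
    ext v
    rw [mem_leaves, Finset.mem_erase, mem_leaves]
    have hpn : v ∈ T.verts ∧ T.children v = ∅ → v ≠ p := by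
      rintro h' rfl
      exact hpnl (mem_leaves.2 h')
    have : v ∈ (T.kill l).verts → ((T.kill l).children v = ∅ ↔ T.children v = ∅) := by
      intro hv
      rw [← Finset.card_eq_zero, hcard v hv, Finset.card_eq_zero]
    constructor
    · rintro ⟨h1, h3⟩
      exact ⟨((hmem v).1 h1).2.1, ((hmem v).1 h1).1, (this h1).1 h3⟩
    · rintro ⟨h1, h3⟩
      have h4 := (hmem v).2 ⟨h3.1, h1, hpn h3⟩
      exact ⟨h4, (this h4).2 h3.2⟩
  refine ⟨⟨⟨h0v, ?_, hparmem, ?_, ?_, ?_⟩, ?_, ?_⟩, hleaves, ?_⟩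
  · rw [hpar 0 hu0.symm, hS.parent_root]
  · intro v hv
    obtain ⟨i, hi⟩ := hS.reaches_root v (T.kill_verts_subset l hv)
    exact hdesc2 i v hv 0 h0v hi
  · intro v hv hv0
    have h1 := hS.len_nonneg v (T.kill_verts_subset l hv) hv0
    by_cases hvu : v = u
    · rw [hvu, hlenu, ← hvu]
      have := hS.len_nonneg p hpv hp0
      linarith
    · rwa [hlen v hvu]
  · intro v hv hv0
    rw [hcard v hv]
    exact hS.card_children v (T.kill_verts_subset l hv) hv0
  · rw [hleaves]
    simp [hT.root_not_leaf]
  · intro _ v hv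
    rw [hleaves, Finset.mem_erase] at hv
    have h1 := hT.len_pos h2 v hv.2
    by_cases hvu : v = u
    · rw [hvu, hlenu, ← hvu]
      have := hS.len_nonneg p hpv hp0
      linarith
    · rwa [hlen v hvu]
  · intro x x' hx hx' hnl
    have hxp := hnl p hp0 hpv hpnl
    have hload : ∀ z : ℕ → ℕ, z l = 0 → z p = 0 → ∀ w ∈ (T.kill l).verts,
        (T.kill l).load z w = T.load z w := by
      intro z hz hzp w hw
      unfold load
      rw [Finset.filter_congr (q := fun v => T.IsDesc v w) fun v hv => hdesc v hv w hw]
      refine Finset.sum_subset (Finset.filter_subset_filter _ (T.kill_verts_subset l)) ?_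
      intro v hv hv'
      have : v = l ∨ v = p := by
        by_contra! hne
        simp only [Finset.mem_filter, hmem] at hv hv'
        tauto
      rcases this with rfl | rfl
      · exact hz
      · exact hzp
    have hloadp : ∀ z : ℕ → ℕ, z l = 0 → z p = 0 → T.load z p = T.load z u := by
      intro z hz hzp
      unfold load
      symm
      refine Finset.sum_subset ?_ ?_
      · intro v hv
        rw [Finset.mem_filter] at hv ⊢
        exact ⟨hv.1, hv.2.trans (hupar ▸ isDesc_parent T u)⟩
      · intro v hv hv'
        rw [Finset.mem_filter] at hv hv'
        obtain ⟨hv, i, hi⟩ := hv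
        cases i with
        | zero => rw [← hzp, ← hi]; rfl
        | succ i =>
          rw [Function.iterate_succ_apply'] at hi
          rcases hchp _ (hS.iterate_mem hv i) hi with h' | h'
          · have := hS.isDesc_leaf hv hl hl0 ⟨i, h'⟩
            rw [this, hz]
          · exact absurd ⟨hv, i, h'⟩ hv'
    unfold transport
    have hl_mem : l ∈ (T.verts.erase 0) := Finset.mem_erase.2 ⟨hl0, hlv⟩
    have hp_mem : p ∈ (T.verts.erase 0).erase l :=
      Finset.mem_erase.2 ⟨hpl, Finset.mem_erase.2 ⟨hp0, hpv⟩⟩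
    have hu_mem : u ∈ ((T.verts.erase 0).erase l).erase p :=
      Finset.mem_erase.2 ⟨hup', Finset.mem_erase.2 ⟨hul, Finset.mem_erase.2 ⟨hu0, huv⟩⟩⟩
    have hset : (T.kill l).verts.erase 0 = ((T.verts.erase 0).erase l).erase p := by
      ext v
      rw [Finset.mem_erase, hmem]
      simp only [Finset.mem_erase]
      tauto
    rw [← Finset.add_sum_erase (T.verts.erase 0) _ hl_mem, ← Finset.add_sum_erase _ _ hp_mem,
      ← Finset.add_sum_erase _ _ hu_mem, hset, ← Finset.add_sum_erase _ _ hu_mem,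
      hS.load_leaf hl hl0, hS.load_leaf hl hl0, hx, hx', hloadp x hx hxp.1, hloadp x' hx' hxp.2,
      hload x hx hxp.1 u huv', hload x' hx' hxp.2 u huv', hlenu]
    rw [Finset.sum_congr rfl (g := fun v => T.len v * |(T.load x v : ℝ) - (T.load x' v : ℝ)|)]
    · simp
      ring
    · intro v hv
      have hv' : v ∈ (T.kill l).verts := by
        have := (Finset.mem_erase.1 hv).2
        rw [← hset] at this
        exact (Finset.mem_erase.1 this).2
      rw [hload x hx hxp.1 v hv', hload x' hx' hxp.2 v hv', hlen v (Finset.mem_erase.1 hv).1]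

theorem Good.kill_spec (hT : T.Good) (hl : l ∈ T.leaves) (h2 : 2 ≤ T.leaves.card) :
    KillSpec T l := by
  by_cases h : T.parent l ≠ 0 ∧ (T.siblings l).card = 1
  · exact hT.kill_spec_of_merge hl h2 h
  · exact hT.kill_spec_of_not hl h2 h

theorem Good.depth_kill (hT : T.Good) (hl : l ∈ T.leaves) (h2 : 2 ≤ T.leaves.card) {v : ℕ}
    (hv : v ∈ T.leaves) (hvl : v ≠ l) : (T.kill l).depth v = T.depth v := by
  have hk := hT.kill_spec hl h2
  have hv' : v ∈ (T.kill l).leaves := by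
    rw [hk.leaves_eq]
    exact Finset.mem_erase.2 ⟨hvl, hv⟩
  rw [hk.good.simple.depth_eq_transport ((T.kill l).leaves_subset hv'),
    hT.simple.depth_eq_transport (T.leaves_subset hv)]
  refine hk.transport_eq _ _ ?_ ?_ ?_
  · simp [Ne.symm hvl]
  · simp [hT.ne_zero hl]
  · intro w hw0 hw hwl
    have : w ≠ v := by rintro rfl; exact hwl hv
    simp [hw0, this]

end GameTree

/-! ## Counting robots below a node

The nodes of explored trees are lists, `v <:+ w` means that `w` is `v` or a descendant of `v`. -/

theorem suffix_mem {V : Finset (List ℕ)} (hV : ∀ (a : ℕ) (v : List ℕ), a :: v ∈ V → v ∈ V)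
    {v w : List ℕ} (h : v <:+ w) (hw : w ∈ V) : v ∈ V := by
  obtain ⟨t, rfl⟩ := h
  induction t with
  | nil => exact hw
  | cons a t ih => exact ih (hV a _ hw)

theorem exists_cons_suffix {v w : List ℕ} (h : v <:+ w) (hne : v ≠ w) : ∃ a, a :: v <:+ w := by
  obtain ⟨t, rfl⟩ := h
  rcases List.eq_nil_or_concat t with rfl | ⟨t', a, rfl⟩
  · exact absurd rfl hne
  · exact ⟨a, t', by simp⟩

theorem cons_suffix_inj {a b : ℕ} {v w : List ℕ} (h : a :: v <:+ w) (h' : b :: v <:+ w) :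
    a = b := by
  have := List.suffix_of_suffix_length_le h h' (by simp)
  have := this.eq_of_length (by simp)
  exact (List.cons_eq_cons.1 this).1

theorem suffix_of_cons_suffix {a : ℕ} {v w : List ℕ} (h : a :: v <:+ w) : v <:+ w :=
  (List.suffix_cons a v).trans h

theorem not_cons_suffix_self (a : ℕ) (v : List ℕ) : ¬ a :: v <:+ v := fun h => by
  have := h.length_le
  simp at this

/-- The number of robots in the subtree of `v`. -/
def robotsBelow {k : ℕ} (pos : Fin k → List ℕ) (v : List ℕ) : ℕ :=
  (Finset.univ.filter fun i => v <:+ pos i).card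

/-- The number of robots that a configuration of the game puts on leaves located in the subtree of
`v`, where `φ` gives the location of the leaves. -/
def loadBelow (L : Finset ℕ) (φ : ℕ → List ℕ) (x : ℕ → ℕ) (v : List ℕ) : ℕ :=
  ∑ l ∈ L.filter (fun l => v <:+ φ l), x l

/-- The nodes above the location of some leaf. -/
def Covered (L : Finset ℕ) (φ : ℕ → List ℕ) (v : List ℕ) : Prop := ∃ l ∈ L, v <:+ φ l

theorem robotsBelow_nil {k : ℕ} (pos : Fin k → List ℕ) : robotsBelow pos [] = k := by
  simp [robotsBelow]

/-- Corrections stand on both sides so that no truncated subtraction occurs. -/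
theorem robotsBelow_update {k : ℕ} (pos : Fin k → List ℕ) (i : Fin k) (u v : List ℕ) :
    robotsBelow (Function.update pos i u) v + (if v <:+ pos i then 1 else 0) =
      robotsBelow pos v + (if v <:+ u then 1 else 0) := by
  unfold robotsBelow
  rw [Finset.card_filter, Finset.card_filter, ← Finset.add_sum_erase _ _ (Finset.mem_univ i),
    ← Finset.add_sum_erase _ _ (Finset.mem_univ i), Function.update_self]
  rw [Finset.sum_congr rfl (g := fun j => if v <:+ pos j then 1 else 0)]
  · ring
  · intro j hj
    rw [Function.update_of_ne (Finset.mem_erase.1 hj).1]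

theorem robotsBelow_tail {k : ℕ} (pos : Fin k → List ℕ) (i : Fin k) (hi : pos i ≠ [])
    (v : List ℕ) : robotsBelow (Function.update pos i (pos i).tail) v +
      (if v = pos i then 1 else 0) = robotsBelow pos v := by
  have h := robotsBelow_update pos i (pos i).tail v
  obtain ⟨a, u, hu⟩ := List.exists_cons_of_ne_nil hi
  rw [hu, List.tail_cons] at h ⊢
  simp only [List.suffix_cons_iff] at h
  by_cases h1 : v = a :: u
  · subst h1
    simp only [true_or, if_true, not_cons_suffix_self, if_false] at h ⊢
    omega
  · simp only [h1, false_or, if_false] at h ⊢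
    omega

theorem robotsBelow_cons {k : ℕ} (pos : Fin k → List ℕ) (i : Fin k) (a : ℕ) (v : List ℕ) :
    robotsBelow (Function.update pos i (a :: pos i)) v =
      robotsBelow pos v + (if v = a :: pos i then 1 else 0) := by
  have h := robotsBelow_update pos i (a :: pos i) v
  simp only [List.suffix_cons_iff] at h
  by_cases h1 : v = a :: pos i
  · subst h1
    simp only [true_or, if_true, not_cons_suffix_self, if_false] at h ⊢
    omega
  · simp only [h1, false_or, if_false] at h ⊢
    omega

theorem robotsBelow_pos {k : ℕ} (pos : Fin k → List ℕ) (i : Fin k) {v : List ℕ}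
    (h : v <:+ pos i) : 1 ≤ robotsBelow pos v :=
  Finset.card_pos.2 ⟨i, by simp [h]⟩

/-- A robot on `v` and those in the subtrees of children of `v` are all in the subtree of `v`. -/
theorem sum_robotsBelow_lt {k : ℕ} (pos : Fin k → List ℕ) (i : Fin k) (A : Finset ℕ) :
    ∑ a ∈ A, robotsBelow pos (a :: pos i) + 1 ≤ robotsBelow pos (pos i) := by
  unfold robotsBelow
  rw [← Finset.card_biUnion]
  · rw [Nat.succ_le_iff]
    refine Finset.card_lt_card (Finset.ssubset_iff_subset_ne.2 ⟨?_, ?_⟩)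
    · intro j hj
      obtain ⟨a, -, ha⟩ := Finset.mem_biUnion.1 hj
      simp only [Finset.mem_filter, Finset.mem_univ, true_and] at ha ⊢
      exact suffix_of_cons_suffix ha
    · intro h
      have : i ∈ Finset.univ.filter fun j => pos i <:+ pos j := by simp
      rw [← h] at this
      obtain ⟨a, -, ha⟩ := Finset.mem_biUnion.1 this
      simp [not_cons_suffix_self] at ha
  · intro a _ b _ hab
    simp only [Function.onFun]
    rw [Finset.disjoint_left]
    intro j hj hj'
    simp only [Finset.mem_filter, Finset.mem_univ, true_and] at hj hj'
    exact hab (cons_suffix_inj hj hj')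

theorem loadBelow_of_not_covered {L : Finset ℕ} {φ : ℕ → List ℕ} {x : ℕ → ℕ} {v : List ℕ}
    (h : ¬ Covered L φ v) : loadBelow L φ x v = 0 := by
  unfold loadBelow
  rw [Finset.filter_false_of_mem, Finset.sum_empty]
  exact fun l hl hv => h ⟨l, hl, hv⟩

theorem covered_of_loadBelow {L : Finset ℕ} {φ : ℕ → List ℕ} {x : ℕ → ℕ} {v : List ℕ}
    (h : 0 < loadBelow L φ x v) : Covered L φ v := by
  by_contra hc
  rw [loadBelow_of_not_covered hc] at h
  exact lt_irrefl _ h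

theorem Covered.mono {L : Finset ℕ} {φ : ℕ → List ℕ} {v w : List ℕ} (h : Covered L φ w)
    (hvw : v <:+ w) : Covered L φ v := by
  obtain ⟨l, hl, hw⟩ := h
  exact ⟨l, hl, hvw.trans hw⟩

theorem loadBelow_leaf {L : Finset ℕ} {φ : ℕ → List ℕ} {x : ℕ → ℕ} {l : ℕ} (hl : l ∈ L)
    (hanti : ∀ m ∈ L, φ l <:+ φ m → l = m) : loadBelow L φ x (φ l) = x l := by
  unfold loadBelow
  rw [Finset.sum_eq_single_of_mem l (by simp [hl])]
  intro m hm hne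
  rw [Finset.mem_filter] at hm
  exact absurd (hanti m hm.1 hm.2).symm hne

/-- Labels in `A` without a leaf below contribute zero, so `A` only has to contain the labels of the
covered children. -/
theorem loadBelow_children {L : Finset ℕ} {φ : ℕ → List ℕ} {x : ℕ → ℕ} {v : List ℕ}
    (hv : ∀ l ∈ L, φ l ≠ v) {A : Finset ℕ} (hA : ∀ a, Covered L φ (a :: v) → a ∈ A) :
    loadBelow L φ x v = ∑ a ∈ A, loadBelow L φ x (a :: v) := by
  unfold loadBelow
  rw [← Finset.sum_biUnion]
  · refine Finset.sum_congr ?_ fun _ _ => rfl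
    ext l
    simp only [Finset.mem_filter, Finset.mem_biUnion]
    constructor
    · rintro ⟨hl, h⟩
      obtain ⟨a, ha⟩ := exists_cons_suffix h (hv l hl).symm
      exact ⟨a, hA a ⟨l, hl, ha⟩, hl, ha⟩
    · rintro ⟨a, -, hl, h⟩
      exact ⟨hl, suffix_of_cons_suffix h⟩
  · intro a _ b _ hab
    simp only [Function.onFun]
    rw [Finset.disjoint_left]
    intro j hj hj'
    exact hab (cons_suffix_inj (Finset.mem_filter.1 hj).2 (Finset.mem_filter.1 hj').2)

/-! ## The potential -/

/-- The weighted distance of two families of loads. -/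
def loadDist (V : Finset (List ℕ)) (lam : List ℕ → ℝ) (X X' : List ℕ → ℕ) : ℝ :=
  ∑ v ∈ V.erase [], lam v * |(X v : ℝ) - X' v|

/-- The number of moves that are accounted for by the nodes of `V`. -/
def potential (V : Finset (List ℕ)) (lam : List ℕ → ℝ) (Y X : List ℕ → ℕ) : ℝ :=
  ∑ v ∈ V.erase [], (1 + lam v - lam v * |(Y v : ℝ) - X v|)

/-- When the player moves from `X` to `X'`, the potential decreases by at most the transport cost,
which is what the cost of the game gains. -/
theorem potential_triangle {V : Finset (List ℕ)} {lam : List ℕ → ℝ} (hlam : ∀ v, 0 ≤ lam v)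
    (Y X X' : List ℕ → ℕ) :
    potential V lam Y X ≤ potential V lam Y X' + loadDist V lam X X' := by
  unfold potential loadDist
  rw [← Finset.sum_add_distrib]
  refine Finset.sum_le_sum fun v _ => ?_
  have h : |(Y v : ℝ) - X' v| ≤ |(Y v : ℝ) - X v| + |(X v : ℝ) - X' v| := abs_sub_le _ _ _
  nlinarith [mul_le_mul_of_nonneg_left h (hlam v)]

/-- The factor `1 - |Y - X|` decides whether more coverage is affordable: with a single robot it
vanishes for `X = 0`, and it equals `2 - X` for `X ≥ 1`. -/
theorem potential_update {V : Finset (List ℕ)} {lam : List ℕ → ℝ} {Y X : List ℕ → ℕ} {v : List ℕ}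
    (hv : v ∈ V) (h0 : v ≠ []) (r : ℝ) :
    potential V (Function.update lam v r) Y X = potential V lam Y X +
      (r - lam v) * (1 - |(Y v : ℝ) - X v|) := by
  unfold potential
  have hm : v ∈ V.erase [] := Finset.mem_erase.2 ⟨h0, hv⟩
  rw [← Finset.add_sum_erase _ _ hm, ← Finset.add_sum_erase _ _ hm, Function.update_self]
  rw [Finset.sum_congr rfl (g := fun w => 1 + lam w - lam w * |(Y w : ℝ) - X w|)]
  · ring
  · intro w hw
    rw [Function.update_of_ne (Finset.mem_erase.1 hw).1]

theorem loadDist_update {V : Finset (List ℕ)} {lam : List ℕ → ℝ} {X X' : List ℕ → ℕ} {v : List ℕ}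
    (hv : v ∈ V) (h0 : v ≠ []) (r : ℝ) :
    loadDist V (Function.update lam v r) X X' = loadDist V lam X X' +
      (r - lam v) * |(X v : ℝ) - X' v| := by
  unfold loadDist
  have hm : v ∈ V.erase [] := Finset.mem_erase.2 ⟨h0, hv⟩
  rw [← Finset.add_sum_erase _ _ hm, ← Finset.add_sum_erase _ _ hm, Function.update_self]
  rw [Finset.sum_congr rfl (g := fun w => lam w * |(X w : ℝ) - X' w|)]
  · ring
  · intro w hw
    rw [Function.update_of_ne (Finset.mem_erase.1 hw).1]

theorem potential_congr {V : Finset (List ℕ)} {lam lam' : List ℕ → ℝ} {Y Y' X X' : List ℕ → ℕ}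
    (h : ∀ v ∈ V, v ≠ [] → lam v * |(Y v : ℝ) - X v| - lam v = lam' v * |(Y' v : ℝ) - X' v| - lam' v) :
    potential V lam Y X = potential V lam' Y' X' := by
  refine Finset.sum_congr rfl fun v hv => ?_
  linarith [h v (Finset.mem_erase.1 hv).2 (Finset.mem_erase.1 hv).1]

theorem loadDist_congr {V : Finset (List ℕ)} {lam lam' : List ℕ → ℝ} {Y Y' X X' : List ℕ → ℕ}
    (h : ∀ v ∈ V, v ≠ [] → lam v * |(Y v : ℝ) - X v| = lam' v * |(Y' v : ℝ) - X' v|) :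
    loadDist V lam Y X = loadDist V lam' Y' X' :=
  Finset.sum_congr rfl fun v hv => h v (Finset.mem_erase.1 hv).2 (Finset.mem_erase.1 hv).1

/-- A change of the number of robots below a single node `v`. -/
theorem potential_change {V : Finset (List ℕ)} {lam : List ℕ → ℝ} {Y Y' X : List ℕ → ℕ}
    {v : List ℕ} (hv : v ∈ V) (h0 : v ≠ []) (hY : ∀ w, w ≠ v → Y' w = Y w) :
    potential V lam Y' X = potential V lam Y X +
      lam v * (|(Y v : ℝ) - X v| - |(Y' v : ℝ) - X v|) := by
  unfold potential
  have hm : v ∈ V.erase [] := Finset.mem_erase.2 ⟨h0, hv⟩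
  rw [← Finset.add_sum_erase _ _ hm, ← Finset.add_sum_erase _ _ hm]
  rw [Finset.sum_congr rfl (g := fun w => 1 + lam w - lam w * |(Y w : ℝ) - X w|)]
  · ring
  · intro w hw
    rw [hY w (Finset.mem_erase.1 hw).1]

/-- This is the origin of the constant 2 in front of the size of the tree in both bounds. -/
theorem potential_le {V : Finset (List ℕ)} {lam : List ℕ → ℝ} (h0 : ∀ v, 0 ≤ lam v)
    (h1 : ∀ v, lam v ≤ 1) (Y X : List ℕ → ℕ) :
    potential V lam Y X ≤ 2 * ((V.erase []).card : ℝ) := by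
  unfold potential
  rw [mul_comm, ← nsmul_eq_mul]
  refine Finset.sum_le_card_nsmul _ _ _ fun v _ => ?_
  have := mul_nonneg (h0 v) (abs_nonneg ((Y v : ℝ) - X v))
  linarith [h1 v]

/-! ## The state of an exploration -/

/-- A team of robots in a tree, which is discovered progressively, together with a game of
tree-mining. Leaves of the game tree are located at nodes of the explored tree. -/
structure Exploration (k : ℕ) where
  /-- the nodes that have been visited -/
  visited : Finset (List ℕ)
  /-- visited nodes whose children have all been visited -/
  full : Finset (List ℕ)
  /-- visited nodes whose subtrees need no further visit -/
  closed : Finset (List ℕ)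
  pos : Fin k → List ℕ
  /-- the number of moves of all the robots -/
  moves : ℕ
  tree : GameTree
  conf : ℕ → ℕ
  cost : ℝ
  /-- the location of a leaf `l` of the game tree: it is on the edge between the node `loc l` and its
  parent -/
  loc : ℕ → List ℕ
  /-- the proportion of the edge between a node and its parent that is covered by the game tree; it
  is set to `1` for the root and for closed nodes -/
  cover : List ℕ → ℝ

namespace Exploration

variable {k : ℕ}

/-- The number of robots in the subtree of `v`. -/
def robots (σ : Exploration k) : List ℕ → ℕ := robotsBelow σ.pos

/-- The number of robots of the game in the subtree of `v`. -/
def load (σ : Exploration k) : List ℕ → ℕ := loadBelow σ.tree.leaves σ.loc σ.conf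

/-- `v` is above a leaf of the game tree. -/
def IsCovered (σ : Exploration k) : List ℕ → Prop := Covered σ.tree.leaves σ.loc

/-- The invariants that hold throughout. -/
structure Valid (S : CTMStrategy k) (σ : Exploration k) : Prop where
  reach : S.Reach σ.tree σ.conf σ.cost
  good : σ.tree.Good
  config : σ.tree.IsConfig k σ.conf
  root_mem : [] ∈ σ.visited
  parent_mem : ∀ (a : ℕ) (v : List ℕ), a :: v ∈ σ.visited → v ∈ σ.visited
  full_subset : σ.full ⊆ σ.visited
  closed_subset : σ.closed ⊆ σ.full
  closed_cons : ∀ (a : ℕ) (v : List ℕ), v ∈ σ.closed → a :: v ∈ σ.visited → a :: v ∈ σ.closed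
  pos_mem : ∀ i, σ.pos i ∈ σ.visited
  loc_mem : ∀ l ∈ σ.tree.leaves, σ.loc l ∈ σ.visited
  loc_not_closed : ∀ l ∈ σ.tree.leaves, σ.loc l ∉ σ.closed
  loc_antichain : ∀ l ∈ σ.tree.leaves, ∀ m ∈ σ.tree.leaves, σ.loc l <:+ σ.loc m → l = m
  -- A covered node that is not the location of a leaf lies strictly above one; the game has gone
  -- past it.
  full_of_covered : ∀ v, σ.IsCovered v → (∀ l ∈ σ.tree.leaves, σ.loc l ≠ v) → v ∈ σ.full
  covered_cons : ∀ v, σ.IsCovered v → (∀ l ∈ σ.tree.leaves, σ.loc l ≠ v) →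
    ∀ a, a :: v ∈ σ.visited → a :: v ∈ σ.closed ∨ σ.IsCovered (a :: v)
  -- Open subtrees are never abandoned. This is what guarantees enough robots at a node for a fork.
  robots_pos : ∀ v ∈ σ.visited, v ∉ σ.closed → 1 ≤ σ.robots v
  cover_nil : σ.cover [] = 1
  cover_nonneg : ∀ v, 0 ≤ σ.cover v
  cover_le_one : ∀ v, σ.cover v ≤ 1
  cover_closed : ∀ v ∈ σ.closed, σ.cover v = 1
  cover_of_not_covered : ∀ v, v ∉ σ.closed → ¬ σ.IsCovered v → σ.cover v = 0
  cover_of_covered : ∀ v, σ.IsCovered v → (∀ l ∈ σ.tree.leaves, σ.loc l ≠ v) → σ.cover v = 1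
  -- As long as the game has not covered the edge above `v`, only the robot that discovered `v`
  -- works below it. All events that increase `cover` rely on this.
  robots_eq_one : ∀ v ∈ σ.visited, v ∉ σ.closed → σ.cover v < 1 → σ.robots v = 1
  -- Inner nodes of the game tree need no location: this identity and the next one are all that is
  -- used of the correspondence between the two trees.
  transport_eq : ∀ x x', σ.tree.IsConfig k x → σ.tree.IsConfig k x' → σ.tree.transport x x' =
    loadDist σ.visited σ.cover (loadBelow σ.tree.leaves σ.loc x) (loadBelow σ.tree.leaves σ.loc x')
  -- A leaf at proportion `cover` of the edge above `loc l` has depth `|loc l| - 1 + cover`. The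
  -- value 1 at the root makes this correct for the initial leaf as well.
  depth_eq : ∀ l ∈ σ.tree.leaves, σ.tree.depth l + 1 = (σ.loc l).length + σ.cover (σ.loc l)
  moves_le : (σ.moves : ℝ) ≤ σ.cost + potential σ.visited σ.cover σ.robots σ.load

/-- Leaves that host at least two robots are located at nodes. -/
def Eager (σ : Exploration k) : Prop :=
  ∀ l ∈ σ.tree.leaves, 2 ≤ σ.conf l → σ.cover (σ.loc l) = 1

variable {S : CTMStrategy k} {σ : Exploration k}

namespace Valid

theorem visited_of_suffix (h : σ.Valid S) {v w : List ℕ} (hvw : v <:+ w) (hw : w ∈ σ.visited) :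
    v ∈ σ.visited := suffix_mem h.parent_mem hvw hw

theorem closed_of_suffix (h : σ.Valid S) {v w : List ℕ} (hvw : v <:+ w) (hv : v ∈ σ.closed)
    (hw : w ∈ σ.visited) : w ∈ σ.closed := by
  obtain ⟨t, rfl⟩ := hvw
  induction t with
  | nil => exact hv
  | cons a t ih => exact h.closed_cons a _ (ih (h.parent_mem a _ hw)) hw

theorem visited_of_covered (h : σ.Valid S) {v : List ℕ} (hv : σ.IsCovered v) : v ∈ σ.visited := by
  obtain ⟨l, hl, hvl⟩ := hv
  exact h.visited_of_suffix hvl (h.loc_mem l hl)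

theorem not_closed_of_covered (h : σ.Valid S) {v : List ℕ} (hv : σ.IsCovered v) :
    v ∉ σ.closed := by
  obtain ⟨l, hl, hvl⟩ := hv
  exact fun hc => h.loc_not_closed l hl (h.closed_of_suffix hvl hc (h.loc_mem l hl))

theorem load_loc (h : σ.Valid S) {l : ℕ} (hl : l ∈ σ.tree.leaves) (x : ℕ → ℕ) :
    loadBelow σ.tree.leaves σ.loc x (σ.loc l) = x l :=
  loadBelow_leaf hl (h.loc_antichain l hl)

theorem load_nil (h : σ.Valid S) : σ.load [] = k := by
  unfold load loadBelow
  rw [Finset.filter_true_of_mem fun l _ => List.nil_suffix]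
  exact h.config.2

theorem leaves_nonempty (h : σ.Valid S) (hk : 2 ≤ k) : σ.tree.leaves.Nonempty := by
  by_contra hne
  have := h.config.2
  rw [Finset.not_nonempty_iff_eq_empty.1 hne, Finset.sum_empty] at this
  omega

theorem covered_nil (h : σ.Valid S) (hk : 2 ≤ k) : σ.IsCovered [] := by
  obtain ⟨l, hl⟩ := h.leaves_nonempty hk
  exact ⟨l, hl, List.nil_suffix⟩

theorem nil_not_closed (h : σ.Valid S) (hk : 2 ≤ k) : [] ∉ σ.closed :=
  h.not_closed_of_covered (h.covered_nil hk)

theorem closed_subset_visited (h : σ.Valid S) : σ.closed ⊆ σ.visited :=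
  h.closed_subset.trans h.full_subset

theorem load_eq_zero_of_closed (h : σ.Valid S) {v : List ℕ} (hv : v ∈ σ.closed) : σ.load v = 0 :=
  loadBelow_of_not_covered fun hc => h.not_closed_of_covered hc hv

/-- In a branch that is entered, the edge is covered. -/
theorem cover_eq_one (h : σ.Valid S) (he : σ.Eager) {v : List ℕ} (hv : 2 ≤ σ.load v) :
    σ.cover v = 1 := by
  have hc : σ.IsCovered v := covered_of_loadBelow (lt_of_lt_of_le two_pos hv)
  by_cases hl : ∃ l ∈ σ.tree.leaves, σ.loc l = v
  · obtain ⟨l, hl, rfl⟩ := hl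
    refine he l hl ?_
    rwa [← h.load_loc hl σ.conf]
  · push Not at hl
    exact h.cover_of_covered v hc hl

end Valid

/-! ### Moves of robots -/

/-- The robot `i` goes to `u`. -/
def move (σ : Exploration k) (i : Fin k) (u : List ℕ) : Exploration k :=
  { σ with
    visited := insert u σ.visited
    pos := Function.update σ.pos i u
    moves := σ.moves + 1 }

/-- The excess of real robots below the node drops by one on an edge of weight 1, which pays for the
move. The last hypothesis ensures that no open subtree becomes empty. -/
theorem Valid.move_up (h : σ.Valid S) {i : Fin k} (h0 : σ.pos i ≠ [])
    (hc : σ.cover (σ.pos i) = 1) (hlt : σ.load (σ.pos i) < σ.robots (σ.pos i))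
    (hocc : σ.pos i ∈ σ.closed ∨ 2 ≤ σ.robots (σ.pos i)) :
    (σ.move i (σ.pos i).tail).Valid S := by
  have htail : (σ.pos i).tail ∈ σ.visited :=
    h.visited_of_suffix (List.tail_suffix _) (h.pos_mem i)
  have hvis : (σ.move i (σ.pos i).tail).visited = σ.visited := Finset.insert_eq_of_mem htail
  have hrob : ∀ v, (σ.move i (σ.pos i).tail).robots v + (if v = σ.pos i then 1 else 0) =
      σ.robots v := robotsBelow_tail σ.pos i h0
  refine { h with
    root_mem := hvis ▸ h.root_mem
    parent_mem := by rw [hvis]; exact h.parent_mem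
    full_subset := hvis ▸ h.full_subset
    closed_cons := by rw [hvis]; exact h.closed_cons
    pos_mem := ?_
    loc_mem := by rw [hvis]; exact h.loc_mem
    covered_cons := by rw [hvis]; exact h.covered_cons
    robots_pos := ?_
    robots_eq_one := ?_
    transport_eq := by rw [hvis]; exact h.transport_eq
    moves_le := ?_ }
  · intro j
    rw [hvis]
    by_cases hj : j = i
    · subst hj
      simpa [move] using htail
    · simpa [move, hj] using h.pos_mem j
  · intro v hv hvc
    rw [hvis] at hv
    have h1 := hrob v
    have h2 := h.robots_pos v hv hvc
    split_ifs at h1 with h3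
    · subst h3
      rcases hocc with h4 | h4
      · exact absurd h4 hvc
      · omega
    · omega
  · intro v hv hvc hlt'
    rw [hvis] at hv
    have h1 := hrob v
    rw [if_neg, add_zero] at h1
    · rw [h1]
      exact h.robots_eq_one v hv hvc hlt'
    · rintro rfl
      exact absurd hc hlt'.ne
  · have h1 := hrob (σ.pos i)
    rw [if_pos rfl] at h1
    rw [hvis]
    change ((σ.moves + 1 : ℕ) : ℝ) ≤ σ.cost + potential σ.visited σ.cover _ σ.load
    rw [potential_change (Y := σ.robots) (h.pos_mem i) h0, hc]
    · have h2 : (((σ.move i (σ.pos i).tail).robots (σ.pos i) : ℝ)) + 1 = σ.robots (σ.pos i) := by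
        exact_mod_cast h1
      have h3 : ((σ.load (σ.pos i) : ℝ)) + 1 ≤ σ.robots (σ.pos i) := by exact_mod_cast hlt
      rw [abs_of_nonneg (by linarith), abs_of_nonneg (by linarith)]
      have := h.moves_le
      push_cast
      linarith
    · intro w hw
      have := hrob w
      rwa [if_neg hw, add_zero] at this

/-- Here a deficit of real robots drops by one on an edge of weight 1. -/
theorem Valid.move_down (h : σ.Valid S) {i : Fin k} {a : ℕ} (ha : a :: σ.pos i ∈ σ.visited)
    (hc : σ.cover (a :: σ.pos i) = 1)
    (hlt : σ.robots (a :: σ.pos i) < σ.load (a :: σ.pos i)) :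
    (σ.move i (a :: σ.pos i)).Valid S := by
  have hvis : (σ.move i (a :: σ.pos i)).visited = σ.visited := Finset.insert_eq_of_mem ha
  have hrob : ∀ v, (σ.move i (a :: σ.pos i)).robots v =
      σ.robots v + (if v = a :: σ.pos i then 1 else 0) := robotsBelow_cons σ.pos i a
  refine { h with
    root_mem := hvis ▸ h.root_mem
    parent_mem := by rw [hvis]; exact h.parent_mem
    full_subset := hvis ▸ h.full_subset
    closed_cons := by rw [hvis]; exact h.closed_cons
    pos_mem := ?_
    loc_mem := by rw [hvis]; exact h.loc_mem
    covered_cons := by rw [hvis]; exact h.covered_cons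
    robots_pos := ?_
    robots_eq_one := ?_
    transport_eq := by rw [hvis]; exact h.transport_eq
    moves_le := ?_ }
  · intro j
    rw [hvis]
    by_cases hj : j = i
    · subst hj
      simpa [move] using ha
    · simpa [move, hj] using h.pos_mem j
  · intro v hv hvc
    rw [hvis] at hv
    rw [hrob v]
    have h2 := h.robots_pos v hv hvc
    omega
  · intro v hv hvc hlt'
    rw [hvis] at hv
    rw [hrob v, if_neg, add_zero]
    · exact h.robots_eq_one v hv hvc hlt'
    · rintro rfl
      exact absurd hc hlt'.ne
  · have h1 := hrob (a :: σ.pos i)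
    rw [if_pos rfl] at h1
    rw [hvis]
    change ((σ.moves + 1 : ℕ) : ℝ) ≤ σ.cost + potential σ.visited σ.cover _ σ.load
    rw [potential_change (Y := σ.robots) ha (by simp), hc]
    · have h2 : (((σ.move i (a :: σ.pos i)).robots (a :: σ.pos i) : ℝ)) =
          σ.robots (a :: σ.pos i) + 1 := by exact_mod_cast h1
      have h3 : ((σ.robots (a :: σ.pos i) : ℝ)) + 1 ≤ σ.load (a :: σ.pos i) := by
        exact_mod_cast hlt
      rw [abs_of_nonpos (by linarith), abs_of_nonpos (by linarith)]
      have := h.moves_le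
      push_cast
      linarith
    · intro w hw
      rw [hrob w, if_neg hw, add_zero]

/-- The new node has coverage 0, hence brings a summand equal to 1, which pays for the move. All
other nodes keep their counts, as the robot stays below its previous position. -/
theorem Valid.move_new (h : σ.Valid S) {i : Fin k} {a : ℕ} (ha : a :: σ.pos i ∉ σ.visited)
    (hfull : σ.pos i ∉ σ.full) : (σ.move i (a :: σ.pos i)).Valid S := by
  have hvis : (σ.move i (a :: σ.pos i)).visited = insert (a :: σ.pos i) σ.visited := rfl
  have hrob : ∀ v, (σ.move i (a :: σ.pos i)).robots v =
      σ.robots v + (if v = a :: σ.pos i then 1 else 0) := robotsBelow_cons σ.pos i a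
  have hcl : σ.pos i ∉ σ.closed := fun hc => hfull (h.closed_subset hc)
  have hcov : ¬ σ.IsCovered (a :: σ.pos i) := fun hc => ha (h.visited_of_covered hc)
  have hncl : a :: σ.pos i ∉ σ.closed := fun hc => ha (h.closed_subset_visited hc)
  have hcover : σ.cover (a :: σ.pos i) = 0 := h.cover_of_not_covered _ hncl hcov
  have hrob0 : σ.robots (a :: σ.pos i) = 0 := by
    unfold robots robotsBelow
    refine Finset.card_eq_zero.2 (Finset.filter_eq_empty_iff.2 fun j _ hj => ?_)
    exact ha (h.visited_of_suffix hj (h.pos_mem j))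
  have hne : a :: σ.pos i ∉ σ.visited.erase [] := fun hm => ha (Finset.mem_erase.1 hm).2
  have herase : (insert (a :: σ.pos i) σ.visited).erase [] =
      insert (a :: σ.pos i) (σ.visited.erase []) := by
    rw [Finset.erase_insert_of_ne (by simp)]
  have hload : ∀ x, loadBelow σ.tree.leaves σ.loc x (a :: σ.pos i) = 0 :=
    fun x => loadBelow_of_not_covered hcov
  refine { h with
    root_mem := Finset.mem_insert_of_mem h.root_mem
    parent_mem := ?_
    full_subset := h.full_subset.trans (Finset.subset_insert _ _)
    closed_cons := ?_
    pos_mem := ?_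
    loc_mem := fun l hl => Finset.mem_insert_of_mem (h.loc_mem l hl)
    covered_cons := ?_
    robots_pos := ?_
    robots_eq_one := ?_
    transport_eq := ?_
    moves_le := ?_ }
  · intro b v hv
    rw [hvis, Finset.mem_insert] at hv ⊢
    rcases hv with hv | hv
    · rw [(List.cons_eq_cons.1 hv).2]
      exact Or.inr (h.pos_mem i)
    · exact Or.inr (h.parent_mem b v hv)
  · intro b v hv hb
    rw [hvis, Finset.mem_insert] at hb
    rcases hb with hb | hb
    · rw [(List.cons_eq_cons.1 hb).2] at hv
      exact absurd hv hcl
    · exact h.closed_cons b v hv hb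
  · intro j
    rw [hvis, Finset.mem_insert]
    by_cases hj : j = i
    · subst hj
      simp [move]
    · simpa [move, hj] using Or.inr (h.pos_mem j)
  · intro v hv hl b hb
    rw [hvis, Finset.mem_insert] at hb
    rcases hb with hb | hb
    · have := h.full_of_covered v hv hl
      rw [(List.cons_eq_cons.1 hb).2] at this
      exact absurd this hfull
    · exact h.covered_cons v hv hl b hb
  · intro v hv hvc
    rw [hvis, Finset.mem_insert] at hv
    rw [hrob v]
    rcases hv with hv | hv
    · simp [hv]
    · have h2 := h.robots_pos v hv hvc
      omega
  · intro v hv hvc hlt'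
    rw [hvis, Finset.mem_insert] at hv
    rw [hrob v]
    rcases hv with hv | hv
    · simp [hv, hrob0]
    · rw [if_neg, add_zero]
      · exact h.robots_eq_one v hv hvc hlt'
      · rintro rfl
        exact ha hv
  · intro x x' hx hx'
    change σ.tree.transport x x' = loadDist (insert (a :: σ.pos i) σ.visited) σ.cover
      (loadBelow σ.tree.leaves σ.loc x) (loadBelow σ.tree.leaves σ.loc x')
    rw [h.transport_eq x x' hx hx', loadDist, loadDist, herase, Finset.sum_insert hne, hcover]
    simp
  · change ((σ.moves + 1 : ℕ) : ℝ) ≤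
      σ.cost + potential (insert (a :: σ.pos i) σ.visited) σ.cover _ σ.load
    rw [potential, herase, Finset.sum_insert hne, hcover]
    have := h.moves_le
    rw [potential_congr (V := σ.visited) (lam' := σ.cover)
      (Y' := (σ.move i (a :: σ.pos i)).robots) (X' := σ.load), potential] at this
    · push_cast
      linarith
    · intro v hv _
      rw [hrob v, if_neg, add_zero]
      rintro rfl
      exact ha hv

/-- The node `v` is recorded as full. -/
def markFull (σ : Exploration k) (v : List ℕ) : Exploration k :=
  { σ with full := insert v σ.full }

theorem Valid.markFull (h : σ.Valid S) {v : List ℕ} (hv : v ∈ σ.visited) :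
    (σ.markFull v).Valid S :=
  { h with
    full_subset := Finset.insert_subset hv h.full_subset
    closed_subset := h.closed_subset.trans (Finset.subset_insert _ _)
    full_of_covered := fun w hw hl => Finset.mem_insert_of_mem (h.full_of_covered w hw hl) }

/-- The node `v` is closed. -/
def close (σ : Exploration k) (v : List ℕ) : Exploration k :=
  { σ with
    closed := insert v σ.closed
    cover := Function.update σ.cover v 1 }

/-- The coverage jumps from 0 to 1 where one robot and no game robot are present, so the potential
changes by `1 - |1 - 0| = 0`. From then on the robot is in excess on an edge of weight 1 and can
afford to go up. -/
theorem Valid.close (h : σ.Valid S) (hk : 2 ≤ k) {v : List ℕ} (hv : v ∈ σ.full)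
    (hcl : v ∉ σ.closed) (hcov : ¬ σ.IsCovered v)
    (hch : ∀ a, a :: v ∈ σ.visited → a :: v ∈ σ.closed) : (σ.close v).Valid S := by
  have hvis := h.full_subset hv
  have h0 : v ≠ [] := fun h0 => hcov (h0 ▸ h.covered_nil hk)
  have hzero := h.cover_of_not_covered v hcl hcov
  have hne : ∀ w, σ.IsCovered w → w ≠ v := fun w hw h' => hcov (h' ▸ hw)
  have hcover : ∀ w, w ≠ v → (σ.close v).cover w = σ.cover w :=
    fun w hw => Function.update_of_ne hw _ _
  have hcoverv : (σ.close v).cover v = 1 := Function.update_self _ _ _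
  have hclosed : ∀ w, w ∈ (σ.close v).closed ↔ w = v ∨ w ∈ σ.closed := fun w => Finset.mem_insert
  have hloc : ∀ l ∈ σ.tree.leaves, σ.loc l ≠ v :=
    fun l hl => hne _ ⟨l, hl, List.suffix_rfl⟩
  refine { h with
    closed_subset := Finset.insert_subset hv h.closed_subset
    closed_cons := ?_
    loc_not_closed := ?_
    covered_cons := ?_
    robots_pos := ?_
    cover_nil := ?_
    cover_nonneg := ?_
    cover_le_one := ?_
    cover_closed := ?_
    cover_of_not_covered := ?_
    cover_of_covered := ?_
    robots_eq_one := ?_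
    transport_eq := ?_
    depth_eq := ?_
    moves_le := ?_ }
  · intro a w hw ha
    rw [hclosed] at hw ⊢
    rcases hw with rfl | hw
    · exact Or.inr (hch a ha)
    · exact Or.inr (h.closed_cons a w hw ha)
  · intro l hl
    rw [hclosed]
    rintro (h' | h')
    · exact hloc l hl h'
    · exact h.loc_not_closed l hl h'
  · intro w hw hl a ha
    rw [hclosed]
    rcases h.covered_cons w hw hl a ha with h' | h'
    · exact Or.inl (Or.inr h')
    · exact Or.inr h'
  · intro w hw hwc
    rw [hclosed] at hwc
    exact h.robots_pos w hw fun h' => hwc (Or.inr h')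
  · rw [hcover _ h0.symm, h.cover_nil]
  · intro w
    by_cases hw : w = v
    · rw [hw, hcoverv]; norm_num
    · rw [hcover w hw]; exact h.cover_nonneg w
  · intro w
    by_cases hw : w = v
    · rw [hw, hcoverv]
    · rw [hcover w hw]; exact h.cover_le_one w
  · intro w hw
    by_cases hwv : w = v
    · rw [hwv, hcoverv]
    · rw [hcover w hwv]
      exact h.cover_closed w (((hclosed w).1 hw).resolve_left hwv)
  · intro w hw hwc
    rw [hclosed] at hw
    rw [hcover w fun h' => hw (Or.inl h')]
    exact h.cover_of_not_covered w (fun h' => hw (Or.inr h')) hwc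
  · intro w hw hl
    rw [hcover w (hne w hw)]
    exact h.cover_of_covered w hw hl
  · intro w hw hwc hlt
    rw [hclosed] at hwc
    rw [hcover w fun h' => hwc (Or.inl h')] at hlt
    exact h.robots_eq_one w hw (fun h' => hwc (Or.inr h')) hlt
  · intro x x' hx hx'
    refine (h.transport_eq x x' hx hx').trans (loadDist_congr fun w hw _ => ?_)
    change _ = (σ.close v).cover w *
      |(loadBelow σ.tree.leaves σ.loc x w : ℝ) - loadBelow σ.tree.leaves σ.loc x' w|
    by_cases hwv : w = v
    · rw [hwv, loadBelow_of_not_covered hcov, loadBelow_of_not_covered hcov]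
      simp
    · rw [hcover w hwv]
  · intro l hl
    change _ = ((σ.loc l).length : ℝ) + (σ.close v).cover (σ.loc l)
    rw [hcover _ (hloc l hl)]
    exact h.depth_eq l hl
  · refine h.moves_le.trans ?_
    change _ ≤ σ.cost + potential σ.visited (Function.update σ.cover v 1) σ.robots σ.load
    rw [potential_update hvis h0, hzero, h.robots_eq_one v hvis hcl (by rw [hzero]; norm_num),
      show σ.load v = 0 from loadBelow_of_not_covered hcov]
    simp

end Exploration

/-! ### Events of the game and their effect on the invariants. -/

theorem sum_eq_add_of_subset {ι : Type*} {W B : Finset ι} (hB : B ⊆ W) {f g h : ι → ℝ}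
    (h1 : ∀ w ∈ W, w ∉ B → f w = g w) (h2 : ∀ w ∈ B, f w = g w + h w) :
    ∑ w ∈ W, f w = ∑ w ∈ W, g w + ∑ w ∈ B, h w := by
  rw [← Finset.sum_sdiff hB, ← Finset.sum_sdiff (f := g) hB, add_assoc, ← Finset.sum_add_distrib,
    Finset.sum_congr rfl h2, Finset.sum_congr rfl fun w hw => h1 w (Finset.mem_sdiff.1 hw).1
      (Finset.mem_sdiff.1 hw).2]

theorem loadBelow_erase {L : Finset ℕ} {φ : ℕ → List ℕ} {x : ℕ → ℕ} {l : ℕ} (hx : x l = 0)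
    (v : List ℕ) : loadBelow (L.erase l) φ x v = loadBelow L φ x v := by
  unfold loadBelow
  refine Finset.sum_subset (Finset.filter_subset_filter _ (Finset.erase_subset _ _)) ?_
  intro m hm hm'
  have : m = l := by
    by_contra hne
    simp only [Finset.mem_filter, Finset.mem_erase] at hm hm'
    tauto
  rw [this, hx]

namespace GameTree

theorem KillSpec.isConfig {T : GameTree} {l k : ℕ} (h : KillSpec T l) (hl : l ∈ T.leaves)
    {x : ℕ → ℕ} (hx : (T.kill l).IsConfig k x) : x l = 0 ∧ T.IsConfig k x := by
  have h0 : x l = 0 := hx.1 l (by rw [h.leaves_eq]; simp)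
  refine ⟨h0, fun v hv => hx.1 v fun hv' => hv ?_, ?_⟩
  · rw [h.leaves_eq] at hv'
    exact (Finset.mem_erase.1 hv').2
  · rw [← Finset.add_sum_erase _ _ hl, h0, zero_add, ← h.leaves_eq]
    exact hx.2

end GameTree

namespace Exploration

variable {k : ℕ} {S : CTMStrategy k} {σ : Exploration k}

theorem Valid.loc_not_covered_cons (h : σ.Valid S) {l : ℕ} (hl : l ∈ σ.tree.leaves) (a : ℕ) :
    ¬ σ.IsCovered (a :: σ.loc l) := by
  rintro ⟨m, hm, hv⟩
  have := h.loc_antichain l hl m hm (suffix_of_cons_suffix hv)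
  subst this
  exact not_cons_suffix_self _ _ hv

/-! ### Killing a leaf -/

/-- The leaf `l` of the game tree is killed, and the nodes that lie above no other leaf are
closed. -/
def killLeaf (S : CTMStrategy k) (σ : Exploration k) (l : ℕ) : Exploration k :=
  { σ with
    tree := σ.tree.kill l
    conf := S.respond σ.tree σ.conf (σ.tree.kill l)
    cost := σ.cost + σ.tree.transport σ.conf (S.respond σ.tree σ.conf (σ.tree.kill l))
    closed := σ.closed ∪ σ.visited.filter fun v =>
      σ.IsCovered v ∧ ¬ Covered (σ.tree.leaves.erase l) σ.loc v
    cover := Function.update σ.cover (σ.loc l) 1 }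

/-- The reaction is paid for by the triangle inequality. Afterwards the load at the location of `l`
is 0, and completing its coverage is free. Every node that was covered only through `l` has all its
visited children closed, old or new, so the closed set stays downward stable. -/
theorem Valid.killLeaf (h : σ.Valid S) {l : ℕ} (hl : l ∈ σ.tree.leaves)
    (h2 : 2 ≤ σ.tree.leaves.card) (hfull : σ.loc l ∈ σ.full)
    (hch : ∀ a, a :: σ.loc l ∈ σ.visited → a :: σ.loc l ∈ σ.closed) :
    (σ.killLeaf S l).Valid S ∧ σ.loc l ∈ (σ.killLeaf S l).closed := by
  have hk := h.good.kill_spec hl h2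
  have hresp := S.respond_isConfig σ.tree σ.conf (σ.tree.kill l) h.good.simple h.config
    hk.good.simple
  obtain ⟨m₀, hm₀, hm₀l⟩ := Finset.exists_mem_ne (by omega : 1 < σ.tree.leaves.card) l
  have h0 : σ.loc l ≠ [] := fun h0 =>
    hm₀l (h.loc_antichain l hl m₀ hm₀ (h0 ▸ List.nil_suffix)).symm
  have hlea : (σ.killLeaf S l).tree.leaves = σ.tree.leaves.erase l := hk.leaves_eq
  have hclosed : ∀ w, w ∈ (σ.killLeaf S l).closed ↔ w ∈ σ.closed ∨
      (σ.IsCovered w ∧ ¬ Covered (σ.tree.leaves.erase l) σ.loc w) := by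
    intro w
    change w ∈ σ.closed ∪ _ ↔ _
    rw [Finset.mem_union, Finset.mem_filter]
    have := fun hw => h.visited_of_covered (v := w) hw
    tauto
  have hcov : ∀ w, (σ.killLeaf S l).IsCovered w ↔ Covered (σ.tree.leaves.erase l) σ.loc w := by
    intro w
    change Covered (σ.tree.kill l).leaves σ.loc w ↔ _
    rw [hk.leaves_eq]
  have hcov' : ∀ w, Covered (σ.tree.leaves.erase l) σ.loc w → σ.IsCovered w := by
    rintro w ⟨m, hm, hw⟩
    exact ⟨m, (Finset.mem_erase.1 hm).2, hw⟩
  have hlcov : ¬ Covered (σ.tree.leaves.erase l) σ.loc (σ.loc l) := by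
    rintro ⟨m, hm, hw⟩
    rw [Finset.mem_erase] at hm
    exact hm.1 (h.loc_antichain l hl m hm.2 hw).symm
  have hlclosed : σ.loc l ∈ (σ.killLeaf S l).closed :=
    (hclosed _).2 (Or.inr ⟨⟨l, hl, List.suffix_rfl⟩, hlcov⟩)
  have hpt : ∀ w, Covered (σ.tree.leaves.erase l) σ.loc w →
      (∀ m ∈ σ.tree.leaves.erase l, σ.loc m ≠ w) → ∀ m ∈ σ.tree.leaves, σ.loc m ≠ w := by
    intro w hw hm m hm'
    by_cases hml : m = l
    · rintro rfl
      rw [hml] at hw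
      exact hlcov hw
    · exact hm m (Finset.mem_erase.2 ⟨hml, hm'⟩)
  have hpt' : ∀ w, σ.IsCovered w → ¬ Covered (σ.tree.leaves.erase l) σ.loc w → w ≠ σ.loc l →
      ∀ m ∈ σ.tree.leaves, σ.loc m ≠ w := by
    rintro w - hw hwl m hm rfl
    have hml : m ≠ l := by rintro rfl; exact hwl rfl
    exact hw ⟨m, Finset.mem_erase.2 ⟨hml, hm⟩, List.suffix_rfl⟩
  have hcover : ∀ w, w ≠ σ.loc l → (σ.killLeaf S l).cover w = σ.cover w :=
    fun w hw => Function.update_of_ne hw _ _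
  have hcoverl : (σ.killLeaf S l).cover (σ.loc l) = 1 := Function.update_self _ _ _
  refine ⟨⟨CTMStrategy.Reach.kill l h.reach hl h2, hk.good, hresp, h.root_mem, h.parent_mem,
    h.full_subset, ?_, ?_, h.pos_mem, ?_, ?_, ?_, ?_, ?_, ?_, ?_, ?_, ?_, ?_, ?_, ?_, ?_, ?_, ?_,
    ?_⟩, hlclosed⟩
  · intro w hw
    rcases (hclosed w).1 hw with hw | ⟨hw, hw'⟩
    · exact h.closed_subset hw
    · by_cases hwl : w = σ.loc l
      · rw [hwl]; exact hfull
      · exact h.full_of_covered w hw (hpt' w hw hw' hwl)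
  · intro a w hw ha
    rw [hclosed] at hw ⊢
    rcases hw with hw | ⟨hw, hw'⟩
    · exact Or.inl (h.closed_cons a w hw ha)
    · by_cases hwl : w = σ.loc l
      · subst hwl
        exact Or.inl (hch a ha)
      · rcases h.covered_cons w hw (hpt' w hw hw' hwl) a ha with h' | h'
        · exact Or.inl h'
        · exact Or.inr ⟨h', fun hc => hw' (hc.mono (List.suffix_cons a w))⟩
  · intro m hm
    rw [hlea] at hm
    exact h.loc_mem m (Finset.mem_erase.1 hm).2
  · intro m hm
    rw [hlea] at hm
    rw [hclosed]
    rintro (h' | h')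
    · exact h.loc_not_closed m (Finset.mem_erase.1 hm).2 h'
    · exact h'.2 ⟨m, hm, List.suffix_rfl⟩
  · intro m hm m' hm'
    rw [hlea] at hm hm'
    exact h.loc_antichain m (Finset.mem_erase.1 hm).2 m' (Finset.mem_erase.1 hm').2
  · intro w hw hm
    rw [hlea] at hm
    rw [hcov] at hw
    exact h.full_of_covered w (hcov' w hw) (hpt w hw hm)
  · intro w hw hm a ha
    rw [hlea] at hm
    rw [hcov] at hw
    rw [hclosed, hcov]
    rcases h.covered_cons w (hcov' w hw) (hpt w hw hm) a ha with h' | h'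
    · exact Or.inl (Or.inl h')
    · tauto
  · intro w hw hwc
    rw [hclosed] at hwc
    exact h.robots_pos w hw fun h' => hwc (Or.inl h')
  · rw [hcover _ h0.symm, h.cover_nil]
  · intro w
    by_cases hw : w = σ.loc l
    · rw [hw, hcoverl]; norm_num
    · rw [hcover w hw]; exact h.cover_nonneg w
  · intro w
    by_cases hw : w = σ.loc l
    · rw [hw, hcoverl]
    · rw [hcover w hw]; exact h.cover_le_one w
  · intro w hw
    by_cases hwl : w = σ.loc l
    · rw [hwl, hcoverl]
    · rw [hcover w hwl]
      rcases (hclosed w).1 hw with hw | ⟨hw, hw'⟩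
      · exact h.cover_closed w hw
      · exact h.cover_of_covered w hw (hpt' w hw hw' hwl)
  · intro w hw hwc
    have hwl : w ≠ σ.loc l := by rintro rfl; exact hw hlclosed
    rw [hclosed] at hw
    rw [hcov] at hwc
    rw [hcover w hwl]
    exact h.cover_of_not_covered w (by tauto) (by tauto)
  · intro w hw hm
    rw [hlea] at hm
    rw [hcov] at hw
    rw [hcover w (by rintro rfl; exact hlcov hw)]
    exact h.cover_of_covered w (hcov' w hw) (hpt w hw hm)
  · intro w hw hwc hlt
    have hwl : w ≠ σ.loc l := by rintro rfl; exact hwc hlclosed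
    rw [hclosed] at hwc
    rw [hcover w hwl] at hlt
    exact h.robots_eq_one w hw (fun h' => hwc (Or.inl h')) hlt
  · intro x x' hx hx'
    obtain ⟨hx0, hxc⟩ := hk.isConfig hl hx
    obtain ⟨hx0', hxc'⟩ := hk.isConfig hl hx'
    change (σ.tree.kill l).transport x x' = _
    rw [hk.transport_eq x x' hx0 hx0' fun v _ _ hv => ⟨hxc.1 v hv, hxc'.1 v hv⟩,
      h.transport_eq x x' hxc hxc', hlea]
    refine loadDist_congr fun w hw _ => ?_
    change _ = _ * |(loadBelow _ σ.loc x w : ℝ) - loadBelow _ σ.loc x' w|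
    rw [loadBelow_erase hx0, loadBelow_erase hx0']
    by_cases hwl : w = σ.loc l
    · rw [hwl, h.load_loc hl, h.load_loc hl, hx0, hx0']
      simp
    · rw [hcover w hwl]
  · intro m hm
    rw [hlea] at hm
    have hm' := Finset.mem_erase.1 hm
    change (σ.tree.kill l).depth m + 1 = ((σ.loc m).length : ℝ) + (σ.killLeaf S l).cover (σ.loc m)
    rw [h.good.depth_kill hl h2 hm'.2 hm'.1, hcover, h.depth_eq m hm'.2]
    exact fun h' => hm'.1 (h.loc_antichain m hm'.2 l hl (h' ▸ List.suffix_rfl))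
  · obtain ⟨hx0, hxc⟩ := hk.isConfig hl hresp
    set x' := S.respond σ.tree σ.conf (σ.tree.kill l) with hx'
    have hload : (σ.killLeaf S l).load = loadBelow σ.tree.leaves σ.loc x' := by
      funext w
      change loadBelow (σ.tree.kill l).leaves σ.loc x' w = _
      rw [hk.leaves_eq, loadBelow_erase hx0]
    have h3 := potential_triangle (V := σ.visited) h.cover_nonneg σ.robots σ.load
      (loadBelow σ.tree.leaves σ.loc x')
    have h4 := h.transport_eq σ.conf x' h.config hxc
    have h5 := h.moves_le
    have h6 : loadDist σ.visited σ.cover σ.load (loadBelow σ.tree.leaves σ.loc x') =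
      σ.tree.transport σ.conf x' := h4.symm
    rw [hload]
    change (σ.moves : ℝ) ≤ (σ.cost + σ.tree.transport σ.conf x') +
      potential σ.visited (Function.update σ.cover (σ.loc l) 1) σ.robots _
    rw [potential_update (h.loc_mem l hl) h0, h.load_loc hl, hx0]
    -- Either the edge is already fully covered, or exactly one robot is below it; one of the
    -- factors vanishes.
    have h7 : (1 - σ.cover (σ.loc l)) * (1 - |(σ.robots (σ.loc l) : ℝ) - (0 : ℕ)|) = 0 := by
      rcases lt_or_eq_of_le (h.cover_le_one (σ.loc l)) with h8 | h8
      · rw [h.robots_eq_one _ (h.loc_mem l hl) (h.loc_not_closed l hl) h8]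
        simp
      · rw [h8]; simp
    rw [h7]
    linarith

/-! ### Going beyond a node -/

/-- The leaf `l` of the game tree is now on the edge that goes down along the label `a`. -/
def advance (σ : Exploration k) (l a : ℕ) : Exploration k :=
  { σ with loc := Function.update σ.loc l (a :: σ.loc l) }

/-- The game does not change at all: a fork needs two children, so a single open child is reached by
relocating the leaf. The new edge has coverage 0, hence contributes nothing to transport costs and
depth, and the rest is unaffected. -/
theorem Valid.advance (h : σ.Valid S) {l a : ℕ} (hl : l ∈ σ.tree.leaves)
    (hfull : σ.loc l ∈ σ.full) (hone : σ.cover (σ.loc l) = 1) (ha : a :: σ.loc l ∈ σ.visited)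
    (hacl : a :: σ.loc l ∉ σ.closed)
    (hch : ∀ b, b :: σ.loc l ∈ σ.visited → b :: σ.loc l ∉ σ.closed → b = a) :
    (σ.advance l a).Valid S := by
  have hlocl : (σ.advance l a).loc l = a :: σ.loc l := Function.update_self _ _ _
  have hloc : ∀ m, m ≠ l → (σ.advance l a).loc m = σ.loc m :=
    fun m hm => Function.update_of_ne hm _ _
  have hcov : ∀ w, (σ.advance l a).IsCovered w ↔ σ.IsCovered w ∨ w = a :: σ.loc l := by
    intro w
    constructor
    · rintro ⟨m, hm, hw⟩
      by_cases hml : m = l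
      · rw [hml, hlocl, List.suffix_cons_iff] at hw
        rcases hw with hw | hw
        · exact Or.inr hw
        · exact Or.inl ⟨l, hl, hw⟩
      · rw [hloc m hml] at hw
        exact Or.inl ⟨m, hm, hw⟩
    · rintro (⟨m, hm, hw⟩ | rfl)
      · by_cases hml : m = l
        · refine ⟨l, hl, ?_⟩
          rw [hlocl, List.suffix_cons_iff]
          exact Or.inr (hml ▸ hw)
        · exact ⟨m, hm, by rwa [hloc m hml]⟩
      · exact ⟨l, hl, by rw [hlocl]⟩
  have hnc := h.loc_not_covered_cons hl a
  have hzero : σ.cover (a :: σ.loc l) = 0 := h.cover_of_not_covered _ hacl hnc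
  have hload : ∀ x w, w ≠ a :: σ.loc l → loadBelow σ.tree.leaves (σ.advance l a).loc x w =
      loadBelow σ.tree.leaves σ.loc x w := by
    intro x w hw
    unfold loadBelow
    refine Finset.sum_congr (Finset.filter_congr fun m hm => ?_) fun _ _ => rfl
    by_cases hml : m = l
    · rw [hml, hlocl, List.suffix_cons_iff]
      simp [hw]
    · rw [hloc m hml]
  have hpt : ∀ w, (σ.advance l a).IsCovered w → (∀ m ∈ σ.tree.leaves, (σ.advance l a).loc m ≠ w) →
      σ.IsCovered w ∧ (w = σ.loc l ∨ ∀ m ∈ σ.tree.leaves, σ.loc m ≠ w) := by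
    intro w hw hm
    rw [hcov] at hw
    have h1 : w ≠ a :: σ.loc l := fun h' => hm l hl (by rw [hlocl, h'])
    refine ⟨hw.resolve_right h1, ?_⟩
    by_cases h2 : w = σ.loc l
    · exact Or.inl h2
    · refine Or.inr fun m hm' => ?_
      by_cases hml : m = l
      · rw [hml]; exact Ne.symm h2
      · have := hm m hm'
        rwa [hloc m hml] at this
  refine { h with
    loc_mem := ?_
    loc_not_closed := ?_
    loc_antichain := ?_
    full_of_covered := ?_
    covered_cons := ?_
    cover_of_not_covered := ?_
    cover_of_covered := ?_
    transport_eq := ?_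
    depth_eq := ?_
    moves_le := ?_ }
  · intro m hm
    by_cases hml : m = l
    · rw [hml, hlocl]; exact ha
    · rw [hloc m hml]; exact h.loc_mem m hm
  · intro m hm
    by_cases hml : m = l
    · rw [hml, hlocl]; exact hacl
    · rw [hloc m hml]; exact h.loc_not_closed m hm
  · intro m hm m' hm' hmm
    by_cases hml : m = l
    · by_cases hml' : m' = l
      · rw [hml, hml']
      · rw [hml, hlocl, hloc m' hml'] at hmm
        rw [hml]
        exact h.loc_antichain l hl m' hm' (suffix_of_cons_suffix hmm)
    · rw [hloc m hml] at hmm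
      by_cases hml' : m' = l
      · rw [hml', hlocl, List.suffix_cons_iff] at hmm
        rcases hmm with hmm | hmm
        · exact absurd (h.loc_antichain l hl m hm (hmm ▸ List.suffix_cons _ _)).symm hml
        · rw [hml']
          exact h.loc_antichain m hm l hl hmm
      · rw [hloc m' hml'] at hmm
        exact h.loc_antichain m hm m' hm' hmm
  · intro w hw hm
    obtain ⟨h1, rfl | h2⟩ := hpt w hw hm
    · exact hfull
    · exact h.full_of_covered w h1 h2
  · intro w hw hm b hb
    rw [hcov]
    obtain ⟨h1, rfl | h2⟩ := hpt w hw hm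
    · by_cases hbc : b :: σ.loc l ∈ σ.closed
      · exact Or.inl hbc
      · rw [hch b hb hbc]
        simp
    · rcases h.covered_cons w h1 h2 b hb with h3 | h3
      · exact Or.inl h3
      · exact Or.inr (Or.inl h3)
  · intro w hw hwc
    rw [hcov, not_or] at hwc
    exact h.cover_of_not_covered w hw hwc.1
  · intro w hw hm
    obtain ⟨h1, rfl | h2⟩ := hpt w hw hm
    · exact hone
    · exact h.cover_of_covered w h1 h2
  · intro x x' hx hx'
    refine (h.transport_eq x x' hx hx').trans (loadDist_congr fun w _ _ => ?_)
    change _ = σ.cover w * |(loadBelow σ.tree.leaves (σ.advance l a).loc x w : ℝ) -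
      loadBelow σ.tree.leaves (σ.advance l a).loc x' w|
    by_cases hw : w = a :: σ.loc l
    · rw [hw, hzero]; simp
    · rw [hload x w hw, hload x' w hw]
  · intro m hm
    change σ.tree.depth m + 1 = ((σ.advance l a).loc m).length + σ.cover ((σ.advance l a).loc m)
    by_cases hml : m = l
    · rw [hml, hlocl, hzero, h.depth_eq l hl, hone]
      simp
    · rw [hloc m hml]
      exact h.depth_eq m hm
  · refine h.moves_le.trans (le_of_eq ?_)
    change _ = σ.cost + potential σ.visited σ.cover σ.robots (σ.advance l a).load
    congr 1
    refine potential_congr fun w _ _ => ?_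
    by_cases hw : w = a :: σ.loc l
    · rw [hw, hzero]; simp
    · rw [show (σ.advance l a).load w = σ.load w from hload _ w hw]

end Exploration

namespace GameTree

theorem Good.isConfig_push {T : GameTree} (hT : T.Good) {l k : ℕ} {C : Finset ℕ} {δ : ℝ}
    (hl : l ∈ T.leaves) (hC : Disjoint C T.verts) (hC2 : 2 ≤ C.card) {x : ℕ → ℕ}
    (hx : (T.fork l C δ).IsConfig k x) : x l = 0 ∧ T.IsConfig k (push l C x) := by
  have hlea := hT.fork_leaves (δ := δ) hC hl (Finset.card_pos.1 (by omega))
  have hd : ∀ u, u ∈ C → u ∉ T.verts := fun u h => Finset.disjoint_left.1 hC h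
  have h0 : x l = 0 := hx.1 l (by
    have := fun h => hd l h (T.leaves_subset hl)
    rw [hlea]
    simpa using this)
  refine ⟨h0, fun v hv => ?_, ?_⟩
  · have hvl : v ≠ l := by rintro rfl; exact hv hl
    simp only [push, hvl, if_false]
    split_ifs with h
    · rfl
    · exact hx.1 v (by rw [hlea]; simp [h, hv])
  · rw [← hx.2, hlea, Finset.sum_union, ← Finset.add_sum_erase _ _ hl,
      show push l C x l = x l + ∑ c ∈ C, x c from if_pos rfl, h0]
    · have h1 : ∀ v ∈ T.leaves.erase l, push l C x v = x v := by
        intro v hv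
        rw [push, if_neg (Finset.mem_erase.1 hv).1, if_neg]
        exact fun h => hd v h (T.leaves_subset (Finset.mem_erase.1 hv).2)
      rw [Finset.sum_congr rfl h1]
      ring
    · rw [Finset.disjoint_right]
      exact fun v hv hv' => hd v hv (T.leaves_subset (Finset.mem_erase.1 hv').2)

end GameTree

namespace Exploration

variable {k : ℕ} {S : CTMStrategy k} {σ : Exploration k}

/-! ### Fork -/

/-- The leaf `l` of the game tree receives the elements of `C` as children. The child `c` is located
on the edge that goes down from `loc l` along the label `e c`. -/
def forkLeaf (S : CTMStrategy k) (σ : Exploration k) (l : ℕ) (C : Finset ℕ) (e : ℕ → ℕ) :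
    Exploration k :=
  { σ with
    tree := σ.tree.fork l C (S.forkLen σ.tree σ.conf l C.card)
    conf := S.respond σ.tree σ.conf (σ.tree.fork l C (S.forkLen σ.tree σ.conf l C.card))
    cost := σ.cost + (σ.tree.fork l C (S.forkLen σ.tree σ.conf l C.card)).transport σ.conf
      (S.respond σ.tree σ.conf (σ.tree.fork l C (S.forkLen σ.tree σ.conf l C.card)))
    loc := fun u => if u ∈ C then e u :: σ.loc l else σ.loc u
    cover := fun w => if w ∈ C.image (fun c => e c :: σ.loc l) then
      S.forkLen σ.tree σ.conf l C.card else σ.cover w }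

/-- The first robots that the game sends through a new edge have to pay for it: the edge to the
child `c` costs `δ x'_c` in transport and changes the potential by `δ (1 - |1 - x'_c|)`, because one
robot is below it. The sum of the two is nonnegative. -/
theorem Valid.forkLeaf (h : σ.Valid S) {l : ℕ} {C : Finset ℕ} {e : ℕ → ℕ}
    (hl : l ∈ σ.tree.leaves) (hC : Disjoint C σ.tree.verts) (hC2 : 2 ≤ C.card)
    (hCx : C.card + 1 ≤ σ.conf l) (he : Set.InjOn e C)
    (hfull : σ.loc l ∈ σ.full) (hone : σ.cover (σ.loc l) = 1)
    (hvis : ∀ c ∈ C, e c :: σ.loc l ∈ σ.visited ∧ e c :: σ.loc l ∉ σ.closed)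
    (hch : ∀ b, b :: σ.loc l ∈ σ.visited → b :: σ.loc l ∉ σ.closed → ∃ c ∈ C, e c = b) :
    (σ.forkLeaf S l C e).Valid S := by
  set δ := S.forkLen σ.tree σ.conf l C.card with hδ
  have hδ0 : 0 < δ := S.forkLen_pos _ _ _ _
  have hδ1 : δ ≤ 1 := S.forkLen_le_one _ _ _ _
  set T' := σ.tree.fork l C δ with hT'
  set x' := S.respond σ.tree σ.conf T' with hx'
  set B := C.image (fun c => e c :: σ.loc l) with hB
  set σ' := σ.forkLeaf S l C e with hσ'
  have hgood : T'.Good := h.good.fork hC hl hC2 hδ0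
  have hresp : T'.IsConfig k x' := S.respond_isConfig σ.tree σ.conf T' h.good.simple h.config
    hgood.simple
  have hne : C.Nonempty := Finset.card_pos.1 (by omega)
  have hlea : T'.leaves = σ.tree.leaves.erase l ∪ C := h.good.fork_leaves hC hl hne
  have hd : ∀ u, u ∈ C → u ∉ σ.tree.verts := fun u h => Finset.disjoint_left.1 hC h
  have hdl : ∀ m ∈ σ.tree.leaves, m ∉ C := fun m hm hmC => hd m hmC (σ.tree.leaves_subset hm)
  have hdisj : Disjoint (σ.tree.leaves.erase l) C := by
    rw [Finset.disjoint_left]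
    exact fun m hm => hdl m (Finset.mem_erase.1 hm).2
  have hmemB : ∀ w, w ∈ B ↔ ∃ c ∈ C, e c :: σ.loc l = w := fun w => Finset.mem_image
  have hlocC : ∀ c ∈ C, σ'.loc c = e c :: σ.loc l := fun c hc => if_pos hc
  have hloc : ∀ m, m ∉ C → σ'.loc m = σ.loc m := fun m hm => if_neg hm
  have hcoverB : ∀ w ∈ B, σ'.cover w = δ := fun w hw => if_pos hw
  have hcover : ∀ w, w ∉ B → σ'.cover w = σ.cover w := fun w hw => if_neg hw
  have hnc : ∀ w ∈ B, ¬ σ.IsCovered w := by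
    intro w hw
    obtain ⟨c, -, rfl⟩ := (hmemB w).1 hw
    exact h.loc_not_covered_cons hl _
  have hBv : ∀ w ∈ B, w ∈ σ.visited ∧ w ∉ σ.closed ∧ w ≠ [] := by
    intro w hw
    obtain ⟨c, hc, rfl⟩ := (hmemB w).1 hw
    exact ⟨(hvis c hc).1, (hvis c hc).2, by simp⟩
  have hzero : ∀ w ∈ B, σ.cover w = 0 := fun w hw =>
    h.cover_of_not_covered _ (hBv w hw).2.1 (hnc w hw)
  have hrobB : ∀ w ∈ B, σ.robots w = 1 := fun w hw =>
    h.robots_eq_one w (hBv w hw).1 (hBv w hw).2.1 (by rw [hzero w hw]; norm_num)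
  have hBsub : B ⊆ σ.visited.erase [] := fun w hw =>
    Finset.mem_erase.2 ⟨(hBv w hw).2.2, (hBv w hw).1⟩
  have hcov : ∀ w, σ'.IsCovered w ↔ σ.IsCovered w ∨ w ∈ B := by
    intro w
    constructor
    · rintro ⟨m, hm, hw⟩
      change m ∈ T'.leaves at hm
      rw [hlea, Finset.mem_union] at hm
      by_cases hmC : m ∈ C
      · rw [hlocC m hmC, List.suffix_cons_iff] at hw
        rcases hw with hw | hw
        · exact Or.inr ((hmemB w).2 ⟨m, hmC, hw.symm⟩)
        · exact Or.inl ⟨l, hl, hw⟩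
      · rw [hloc m hmC] at hw
        exact Or.inl ⟨m, (Finset.mem_erase.1 (hm.resolve_right hmC)).2, hw⟩
    · rintro (⟨m, hm, hw⟩ | hw)
      · by_cases hml : m = l
        · obtain ⟨c, hc⟩ := hne
          refine ⟨c, ?_, ?_⟩
          · change c ∈ T'.leaves
            rw [hlea]
            exact Finset.mem_union_right _ hc
          · rw [hlocC c hc, List.suffix_cons_iff]
            exact Or.inr (hml ▸ hw)
        · refine ⟨m, ?_, ?_⟩
          · change m ∈ T'.leaves
            rw [hlea]
            exact Finset.mem_union_left _ (Finset.mem_erase.2 ⟨hml, hm⟩)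
          · rwa [hloc m (hdl m hm)]
      · obtain ⟨c, hc, rfl⟩ := (hmemB w).1 hw
        refine ⟨c, ?_, ?_⟩
        · change c ∈ T'.leaves
          rw [hlea]
          exact Finset.mem_union_right _ hc
        · rw [hlocC c hc]
  have hpt : ∀ w, σ'.IsCovered w → (∀ m ∈ T'.leaves, σ'.loc m ≠ w) →
      w ∉ B ∧ σ.IsCovered w ∧ (w = σ.loc l ∨ ∀ m ∈ σ.tree.leaves, σ.loc m ≠ w) := by
    intro w hw hm
    rw [hcov] at hw
    have h1 : w ∉ B := by
      intro hwB
      obtain ⟨c, hc, rfl⟩ := (hmemB w).1 hwB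
      exact hm c (by rw [hlea]; exact Finset.mem_union_right _ hc) (hlocC c hc)
    refine ⟨h1, hw.resolve_right h1, ?_⟩
    by_cases h2 : w = σ.loc l
    · exact Or.inl h2
    · refine Or.inr fun m hm' => ?_
      by_cases hml : m = l
      · rw [hml]; exact Ne.symm h2
      · rw [← hloc m (hdl m hm')]
        exact hm m (by
          rw [hlea]; exact Finset.mem_union_left _ (Finset.mem_erase.2 ⟨hml, hm'⟩))
  have hloadB : ∀ x, ∀ c ∈ C, loadBelow T'.leaves σ'.loc x (e c :: σ.loc l) = x c := by
    intro x c hc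
    unfold loadBelow
    rw [Finset.sum_eq_single_of_mem c]
    · rw [hlea, Finset.mem_filter, hlocC c hc]
      exact ⟨Finset.mem_union_right _ hc, List.suffix_rfl⟩
    · intro m hm hmc
      rw [hlea, Finset.mem_filter, Finset.mem_union] at hm
      by_cases hmC : m ∈ C
      · have h1 := hm.2
        rw [hlocC m hmC] at h1
        have h2 := h1.eq_of_length (by simp)
        exact absurd (he hmC hc (List.cons_eq_cons.1 h2).1.symm) hmc
      · have h1 := hm.2
        rw [hloc m hmC] at h1
        exact absurd ⟨m, (Finset.mem_erase.1 (hm.1.resolve_right hmC)).2, h1⟩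
          (h.loc_not_covered_cons hl _)
  have hload : ∀ x, x l = 0 → ∀ w, w ∉ B → loadBelow T'.leaves σ'.loc x w =
      loadBelow σ.tree.leaves σ.loc (GameTree.push l C x) w := by
    intro x hx w hw
    unfold loadBelow
    rw [hlea, Finset.filter_union, Finset.sum_union (Finset.disjoint_filter_filter hdisj)]
    have e1 : (σ.tree.leaves.erase l).filter (fun m => w <:+ σ'.loc m) =
        (σ.tree.leaves.filter fun m => w <:+ σ.loc m).erase l := by
      ext m
      simp only [Finset.mem_filter, Finset.mem_erase]
      constructor
      · rintro ⟨⟨h1, h2⟩, h3⟩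
        rw [hloc m (hdl m h2)] at h3
        exact ⟨h1, h2, h3⟩
      · rintro ⟨h1, h2, h3⟩
        rw [hloc m (hdl m h2)]
        exact ⟨⟨h1, h2⟩, h3⟩
    have e2 : C.filter (fun m => w <:+ σ'.loc m) = if w <:+ σ.loc l then C else ∅ := by
      have h1 : ∀ c ∈ C, (w <:+ σ'.loc c ↔ w <:+ σ.loc l) := by
        intro c hc
        rw [hlocC c hc, List.suffix_cons_iff]
        have : w ≠ e c :: σ.loc l := fun h' => hw ((hmemB w).2 ⟨c, hc, h'.symm⟩)
        simp [this]
      split_ifs with h2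
      · exact Finset.filter_true_of_mem fun c hc => (h1 c hc).2 h2
      · exact Finset.filter_false_of_mem fun c hc h' => h2 ((h1 c hc).1 h')
    have e3 : ∀ m ∈ (σ.tree.leaves.filter fun m => w <:+ σ.loc m).erase l,
        GameTree.push l C x m = x m := by
      intro m hm
      simp only [Finset.mem_filter, Finset.mem_erase] at hm
      rw [GameTree.push, if_neg hm.1, if_neg (hdl m hm.2.1)]
    rw [e1, e2]
    by_cases h2 : w <:+ σ.loc l
    · rw [if_pos h2, ← Finset.add_sum_erase (σ.tree.leaves.filter fun m => w <:+ σ.loc m) _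
        (by simp [hl, h2] : l ∈ _), Finset.sum_congr rfl e3, GameTree.push, if_pos rfl, hx]
      ring
    · rw [if_neg h2, Finset.sum_empty, add_zero, ← Finset.sum_congr rfl e3,
        Finset.erase_eq_of_notMem]
      simp [h2]
  have hsumB : ∀ g : List ℕ → ℝ, ∑ w ∈ B, g w = ∑ c ∈ C, g (e c :: σ.loc l) := by
    intro g
    refine Finset.sum_image fun c hc c' hc' hcc => ?_
    exact he hc hc' (List.cons_eq_cons.1 hcc).1
  refine ⟨CTMStrategy.Reach.fork l C T' h.reach hl hC hC2 hCx rfl, hgood, hresp, h.root_mem,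
    h.parent_mem, h.full_subset, h.closed_subset, h.closed_cons, h.pos_mem, ?_, ?_, ?_, ?_, ?_,
    h.robots_pos, ?_, ?_, ?_, ?_, ?_, ?_, ?_, ?_, ?_, ?_⟩
  · intro m hm
    by_cases hmC : m ∈ C
    · rw [hlocC m hmC]; exact (hvis m hmC).1
    · change m ∈ T'.leaves at hm
      rw [hlea, Finset.mem_union] at hm
      rw [hloc m hmC]; exact h.loc_mem m (Finset.mem_erase.1 (hm.resolve_right hmC)).2
  · intro m hm
    by_cases hmC : m ∈ C
    · rw [hlocC m hmC]; exact (hvis m hmC).2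
    · change m ∈ T'.leaves at hm
      rw [hlea, Finset.mem_union] at hm
      rw [hloc m hmC]; exact h.loc_not_closed m (Finset.mem_erase.1 (hm.resolve_right hmC)).2
  · intro m hm m' hm' hmm
    change m ∈ T'.leaves at hm
    change m' ∈ T'.leaves at hm'
    rw [hlea, Finset.mem_union] at hm hm'
    by_cases hmC : m ∈ C
    · rw [hlocC m hmC] at hmm
      by_cases hmC' : m' ∈ C
      · rw [hlocC m' hmC'] at hmm
        have h2 := hmm.eq_of_length (by simp)
        exact he hmC hmC' (List.cons_eq_cons.1 h2).1
      · rw [hloc m' hmC'] at hmm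
        exact absurd ⟨m', (Finset.mem_erase.1 (hm'.resolve_right hmC')).2, hmm⟩
          (h.loc_not_covered_cons hl _)
    · have hm := Finset.mem_erase.1 (hm.resolve_right hmC)
      rw [hloc m hmC] at hmm
      by_cases hmC' : m' ∈ C
      · rw [hlocC m' hmC', List.suffix_cons_iff] at hmm
        rcases hmm with hmm | hmm
        · exact absurd (h.loc_antichain l hl m hm.2 (hmm ▸ List.suffix_cons _ _)).symm hm.1
        · exact absurd (h.loc_antichain m hm.2 l hl hmm) hm.1
      · rw [hloc m' hmC'] at hmm
        exact h.loc_antichain m hm.2 m' (Finset.mem_erase.1 (hm'.resolve_right hmC')).2 hmm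
  · intro w hw hm
    obtain ⟨-, h1, rfl | h2⟩ := hpt w hw hm
    · exact hfull
    · exact h.full_of_covered w h1 h2
  · intro w hw hm b hb
    rw [hcov]
    obtain ⟨-, h1, rfl | h2⟩ := hpt w hw hm
    · by_cases hbc : b :: σ.loc l ∈ σ.closed
      · exact Or.inl hbc
      · obtain ⟨c, hc, rfl⟩ := hch b hb hbc
        exact Or.inr (Or.inr ((hmemB _).2 ⟨c, hc, rfl⟩))
    · rcases h.covered_cons w h1 h2 b hb with h3 | h3
      · exact Or.inl h3
      · exact Or.inr (Or.inl h3)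
  · rw [hcover _ fun hn => (hBv _ hn).2.2 rfl, h.cover_nil]
  · intro w
    by_cases hw : w ∈ B
    · rw [hcoverB w hw]; exact hδ0.le
    · rw [hcover w hw]; exact h.cover_nonneg w
  · intro w
    by_cases hw : w ∈ B
    · rw [hcoverB w hw]; exact hδ1
    · rw [hcover w hw]; exact h.cover_le_one w
  · intro w hw
    rw [hcover w fun hwB => (hBv w hwB).2.1 hw]
    exact h.cover_closed w hw
  · intro w hw hwc
    rw [hcov, not_or] at hwc
    rw [hcover w hwc.2]
    exact h.cover_of_not_covered w hw hwc.1
  · intro w hw hm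
    obtain ⟨h3, h1, rfl | h2⟩ := hpt w hw hm
    · rw [hcover _ h3, hone]
    · rw [hcover _ h3]
      exact h.cover_of_covered w h1 h2
  · intro w hw hwc hlt
    by_cases hwB : w ∈ B
    · exact hrobB w hwB
    · rw [hcover w hwB] at hlt
      exact h.robots_eq_one w hw hwc hlt
  · intro x y hx hy
    obtain ⟨hx0, hxc⟩ := h.good.isConfig_push hl hC hC2 hx
    obtain ⟨hy0, hyc⟩ := h.good.isConfig_push hl hC hC2 hy
    change T'.transport x y = loadDist σ.visited σ'.cover (loadBelow T'.leaves σ'.loc x)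
      (loadBelow T'.leaves σ'.loc y)
    rw [h.good.transport_fork hC hl hC2 hδ0, h.transport_eq _ _ hxc hyc, loadDist, loadDist,
      sum_eq_add_of_subset hBsub (f := fun w => σ'.cover w *
        |(loadBelow T'.leaves σ'.loc x w : ℝ) - loadBelow T'.leaves σ'.loc y w|)
        (g := fun w => σ.cover w * |(loadBelow σ.tree.leaves σ.loc (GameTree.push l C x) w : ℝ) -
          loadBelow σ.tree.leaves σ.loc (GameTree.push l C y) w|)
        (h := fun w => δ * |(loadBelow T'.leaves σ'.loc x w : ℝ) -
          loadBelow T'.leaves σ'.loc y w|), hsumB, Finset.mul_sum]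
    · congr 1
      refine Finset.sum_congr rfl fun c hc => ?_
      rw [hloadB x c hc, hloadB y c hc]
    · intro w _ hw
      rw [hcover w hw, hload x hx0 w hw, hload y hy0 w hw]
    · intro w hw
      rw [hcoverB w hw, hzero w hw]
      ring
  · intro m hm
    change m ∈ T'.leaves at hm
    rw [hlea, Finset.mem_union] at hm
    change T'.depth m + 1 = _
    by_cases hmC : m ∈ C
    · have h1 := h.depth_eq l hl
      rw [hone] at h1
      rw [hlocC m hmC, hcoverB _ ((hmemB _).2 ⟨m, hmC, rfl⟩),
        h.good.depth_fork_new hC hl hC2 hδ0 hmC]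
      push_cast [List.length_cons]
      linarith
    · have hm := Finset.mem_erase.1 (hm.resolve_right hmC)
      rw [hloc m hmC, hcover _ fun hmB => hnc _ hmB ⟨m, hm.2, List.suffix_rfl⟩,
        h.good.depth_fork_old hC hl hC2 hδ0 (σ.tree.leaves_subset hm.2), h.depth_eq m hm.2]
  · obtain ⟨hx0, hxc⟩ := h.good.isConfig_push hl hC hC2 hresp
    -- Before the reaction no game robot is on the new leaves; all `x'_c` robots that end up on `c`
    -- cross its edge.
    have h1 : T'.transport σ.conf x' = σ.tree.transport σ.conf (GameTree.push l C x') +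
        δ * ∑ c ∈ C, (x' c : ℝ) := by
      have hz : ∀ c ∈ C, σ.conf c = 0 := fun c hc =>
        h.config.1 c fun hc' => hdl c hc' hc
      rw [h.good.transport_fork hC hl hC2 hδ0]
      congr 1
      · refine GameTree.transport_congr (fun v hv => ?_) fun _ _ => rfl
        have hvC : v ∉ C := fun hvC => hd v hvC hv
        rw [GameTree.push, if_neg hvC, Finset.sum_eq_zero hz]
        split_ifs with hvl
        · rw [hvl, add_zero]
        · rfl
      · congr 1
        refine Finset.sum_congr rfl fun c hc => ?_
        rw [hz c hc]
        simp
    have h2 := potential_triangle (V := σ.visited) h.cover_nonneg σ.robots σ.load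
      (loadBelow σ.tree.leaves σ.loc (GameTree.push l C x'))
    have h3 : loadDist σ.visited σ.cover σ.load
        (loadBelow σ.tree.leaves σ.loc (GameTree.push l C x')) =
      σ.tree.transport σ.conf (GameTree.push l C x') := (h.transport_eq _ _ h.config hxc).symm
    have h4 : potential σ.visited σ'.cover σ.robots (loadBelow T'.leaves σ'.loc x') =
        potential σ.visited σ.cover σ.robots
          (loadBelow σ.tree.leaves σ.loc (GameTree.push l C x')) +
        ∑ c ∈ C, (δ - δ * |(1 : ℝ) - x' c|) := by
      unfold potential
      rw [sum_eq_add_of_subset hBsub (f := fun w => 1 + σ'.cover w - σ'.cover w *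
          |(σ.robots w : ℝ) - loadBelow T'.leaves σ'.loc x' w|) (g := fun w => 1 + σ.cover w - σ.cover w *
          |(σ.robots w : ℝ) - loadBelow σ.tree.leaves σ.loc (GameTree.push l C x') w|)
        (h := fun w => δ - δ * |(1 : ℝ) - loadBelow T'.leaves σ'.loc x' w|), hsumB]
      · congr 1
        refine Finset.sum_congr rfl fun c hc => ?_
        rw [hloadB x' c hc]
      · intro w _ hw
        rw [hcover w hw, hload x' hx0 w hw]
      · intro w hw
        rw [hcoverB w hw, hzero w hw, hrobB w hw]
        push_cast
        ring
    have h5 : 0 ≤ δ * ∑ c ∈ C, (x' c : ℝ) + ∑ c ∈ C, (δ - δ * |(1 : ℝ) - x' c|) := by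
      rw [Finset.mul_sum, ← Finset.sum_add_distrib]
      refine Finset.sum_nonneg fun c _ => ?_
      have h6 : |(1 : ℝ) - x' c| ≤ 1 + x' c := by
        rw [abs_le]
        have : (0 : ℝ) ≤ x' c := Nat.cast_nonneg _
        constructor <;> linarith
      nlinarith [mul_le_mul_of_nonneg_left h6 hδ0.le]
    have h6 := h.moves_le
    change (σ.moves : ℝ) ≤ (σ.cost + T'.transport σ.conf x') +
      potential σ.visited σ'.cover σ.robots (loadBelow T'.leaves σ'.loc x')
    rw [h1, h4]
    linarith

/-! ### Elongation -/

/-- The edge of the leaf `l` of the game tree grows by `s`, and the player reacts. -/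
def elongateLeaf (S : CTMStrategy k) (σ : Exploration k) (l : ℕ) (s : ℝ) : Exploration k :=
  { σ with
    tree := σ.tree.elongate l s
    conf := S.respond (σ.tree.elongate l s) σ.conf (σ.tree.elongate l s)
    cost := σ.cost + s * (σ.conf l : ℝ) + (σ.tree.elongate l s).transport σ.conf
      (S.respond (σ.tree.elongate l s) σ.conf (σ.tree.elongate l s))
    cover := Function.update σ.cover (σ.loc l) (σ.cover (σ.loc l) + s) }

/-- The leaf is below an edge with one real robot and `x ≥ 2` game robots. Growth by `s` costs `s x`
and changes the potential by `s (1 - (x - 1))`, a net gain of `2 s`. The reaction is then measured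
with the new coverage and paid for by the triangle inequality. -/
theorem Valid.elongateLeaf (h : σ.Valid S) {l : ℕ} {s : ℝ} (hl : l ∈ σ.tree.leaves)
    (h2 : 2 ≤ σ.conf l) (hs : 0 ≤ s) (hlt : σ.cover (σ.loc l) < 1)
    (hle : σ.cover (σ.loc l) + s ≤ 1)
    (hwait : ∀ s', 0 ≤ s' → s' < s →
      S.respond (σ.tree.elongate l s') σ.conf (σ.tree.elongate l s') = σ.conf) :
    (σ.elongateLeaf S l s).Valid S := by
  set T' := σ.tree.elongate l s with hT'
  set x' := S.respond T' σ.conf T' with hx'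
  have hgood : T'.Good := h.good.elongate hl hs
  have hresp : T'.IsConfig k x' := S.respond_isConfig T' σ.conf T' hgood.simple h.config
    hgood.simple
  have h0 : σ.loc l ≠ [] := by
    intro h0
    rw [h0, h.cover_nil] at hlt
    exact lt_irrefl _ hlt
  have hlv := h.loc_mem l hl
  have hlc := h.loc_not_closed l hl
  have hcov : σ.IsCovered (σ.loc l) := ⟨l, hl, List.suffix_rfl⟩
  have hrob := h.robots_eq_one _ hlv hlc hlt
  have hcover : ∀ w, w ≠ σ.loc l → (σ.elongateLeaf S l s).cover w = σ.cover w :=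
    fun w hw => Function.update_of_ne hw _ _
  have hcoverl : (σ.elongateLeaf S l s).cover (σ.loc l) = σ.cover (σ.loc l) + s :=
    Function.update_self _ _ _
  have htr : ∀ x y, σ.tree.IsConfig k x → σ.tree.IsConfig k y → T'.transport x y =
      loadDist σ.visited (Function.update σ.cover (σ.loc l) (σ.cover (σ.loc l) + s))
        (loadBelow σ.tree.leaves σ.loc x) (loadBelow σ.tree.leaves σ.loc y) := by
    intro x y hx hy
    rw [h.good.transport_elongate hl, loadDist_update hlv h0, h.load_loc hl, h.load_loc hl,
      h.transport_eq x y hx hy]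
    ring
  have hnonneg : ∀ w, 0 ≤ (σ.elongateLeaf S l s).cover w := by
    intro w
    by_cases hw : w = σ.loc l
    · rw [hw, hcoverl]; linarith [h.cover_nonneg (σ.loc l)]
    · rw [hcover w hw]; exact h.cover_nonneg w
  refine ⟨CTMStrategy.Reach.elongate l s h.reach hl h2 hs hwait, hgood, hresp, h.root_mem,
    h.parent_mem, h.full_subset, h.closed_subset, h.closed_cons, h.pos_mem, h.loc_mem,
    h.loc_not_closed, h.loc_antichain, h.full_of_covered, h.covered_cons, h.robots_pos, ?_, hnonneg,
    ?_, ?_, ?_, ?_, ?_, htr, ?_, ?_⟩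
  · rw [hcover _ h0.symm, h.cover_nil]
  · intro w
    by_cases hw : w = σ.loc l
    · rw [hw, hcoverl]; exact hle
    · rw [hcover w hw]; exact h.cover_le_one w
  · intro w hw
    rw [hcover w (by rintro rfl; exact hlc hw)]
    exact h.cover_closed w hw
  · intro w hw hwc
    rw [hcover w (by rintro rfl; exact hwc hcov)]
    exact h.cover_of_not_covered w hw hwc
  · intro w hw hm
    rw [hcover w (hm l hl).symm]
    exact h.cover_of_covered w hw hm
  · intro w hw hwc hlt'
    by_cases hwl : w = σ.loc l
    · rw [hwl]; exact hrob
    · rw [hcover w hwl] at hlt'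
      exact h.robots_eq_one w hw hwc hlt'
  · intro m hm
    change T'.depth m + 1 = ((σ.loc m).length : ℝ) + (σ.elongateLeaf S l s).cover (σ.loc m)
    have h3 := h.depth_eq m hm
    rw [h.good.depth_elongate hl hm hs]
    by_cases hml : m = l
    · rw [if_pos hml, hml, hcoverl, ← add_assoc, ← hml, ← h3]
      ring
    · rw [if_neg hml, add_zero, hcover, h3]
      exact fun h' => hml (h.loc_antichain m hm l hl (h' ▸ List.suffix_rfl))
  · have h3 := h.moves_le
    have h4 := potential_update (lam := σ.cover) (Y := σ.robots) (X := σ.load) hlv h0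
      (σ.cover (σ.loc l) + s)
    have h5 := potential_triangle (V := σ.visited) hnonneg σ.robots σ.load
      (loadBelow σ.tree.leaves σ.loc x')
    have h6 : T'.transport σ.conf x' = loadDist σ.visited (σ.elongateLeaf S l s).cover σ.load
      (loadBelow σ.tree.leaves σ.loc x') := htr σ.conf x' h.config hresp
    have h7 : (2 : ℝ) ≤ σ.conf l := by exact_mod_cast h2
    rw [show σ.load (σ.loc l) = σ.conf l from h.load_loc hl σ.conf, hrob,
      abs_of_nonpos (by push_cast; linarith)] at h4
    change (σ.moves : ℝ) ≤ (σ.cost + s * (σ.conf l : ℝ) + T'.transport σ.conf x') +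
      potential σ.visited (σ.elongateLeaf S l s).cover σ.robots
        (loadBelow σ.tree.leaves σ.loc x')
    have h8 : potential σ.visited (σ.elongateLeaf S l s).cover σ.robots σ.load =
      potential σ.visited σ.cover σ.robots σ.load + (σ.cover (σ.loc l) + s - σ.cover (σ.loc l)) *
        (1 - -(((1 : ℕ) : ℝ) - σ.conf l)) := h4
    push_cast at h8
    nlinarith

end Exploration

/-! ### Driving the game and the robots: maximal elongations, and the next move of a robot. -/

namespace Exploration

variable {k : ℕ} {S : CTMStrategy k} {σ : Exploration k} {f : ℝ → ℝ}

/-! ### Exhausting the elongations -/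

/-- `τ` differs from `σ` by the state of the game only. -/
structure SameTeam (σ τ : Exploration k) : Prop where
  visited : τ.visited = σ.visited
  full : τ.full = σ.full
  closed : τ.closed = σ.closed
  pos : τ.pos = σ.pos
  moves : τ.moves = σ.moves

theorem SameTeam.trans {σ τ υ : Exploration k} (h : σ.SameTeam τ) (h' : τ.SameTeam υ) :
    σ.SameTeam υ :=
  ⟨h'.visited.trans h.visited, h'.full.trans h.full, h'.closed.trans h.closed,
    h'.pos.trans h.pos, h'.moves.trans h.moves⟩

theorem Valid.depth_le (h : σ.Valid S) {l : ℕ} (hl : l ∈ σ.tree.leaves) :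
    σ.tree.depth l ≤ (σ.loc l).length := by
  have h1 := h.depth_eq l hl
  have h2 := h.cover_le_one (σ.loc l)
  linarith

theorem Valid.cost_le (h : σ.Valid S) (hf : S.IsBounded f) {l : ℕ} (hl : l ∈ σ.tree.leaves) :
    σ.cost ≤ f (σ.loc l).length :=
  hf _ _ _ h.reach _ ⟨l, hl, h.depth_le hl⟩

/-- A reaction of the player has a cost. -/
theorem exists_transport_ge {T : GameTree} (hT : T.Good) {x x' : ℕ → ℕ} (hx : T.IsConfig k x)
    (hx' : T.IsConfig k x') (hne : x ≠ x') {ε : ℝ}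
    (hε : 2 ≤ T.leaves.card → ∀ l ∈ T.leaves, ε ≤ T.len l) : ε ≤ T.transport x x' := by
  obtain ⟨m, hm⟩ := Function.ne_iff.1 hne
  have hml : m ∈ T.leaves := by
    by_contra h
    exact hm (by rw [hx.1 m h, hx'.1 m h])
  -- On a tree with a single leaf there is only one configuration, so a reaction requires two
  -- leaves, and then leaf edges have positive length.
  have h2 : 2 ≤ T.leaves.card := by
    by_contra h
    have : T.leaves = {m} := by
      refine (Finset.eq_of_subset_of_card_le (Finset.singleton_subset_iff.2 hml) ?_).symm
      rw [Finset.card_singleton]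
      omega
    have h3 := hx.2
    have h4 := hx'.2
    rw [this, Finset.sum_singleton] at h3 h4
    exact hm (h3.trans h4.symm)
  have h3 := hT.simple.le_transport hml (hT.ne_zero hml) x x'
  have h4 : (1 : ℝ) ≤ |(x m : ℝ) - x' m| := by
    have h5 : (x m : ℤ) - x' m ≠ 0 := sub_ne_zero.2 (by exact_mod_cast hm)
    have h6 := Int.one_le_abs h5
    exact_mod_cast h6
  have h5 := hε h2 m hml
  have h6 := hT.len_pos h2 m hml
  nlinarith

/-- The measure adds the number of reactions that the budget `f` still allows, each costing at least
`ε`, and the number of leaves that have not reached their node. Leaves and locations do not change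
during elongations, so the fixed leaf `l₀` bounds the cost throughout. -/
theorem Valid.exists_eager_aux (hf : S.IsBounded f) (L : Finset ℕ) (φ : ℕ → List ℕ) {l₀ : ℕ}
    (hl₀ : l₀ ∈ L) {ε : ℝ} (hε : 0 < ε) (N : ℕ) :
    ∀ σ : Exploration k, σ.Valid S → σ.tree.leaves = L → σ.loc = φ →
      (2 ≤ L.card → ∀ l ∈ L, ε ≤ σ.tree.len l) →
      ⌊(f (φ l₀).length - σ.cost) / ε⌋₊ + (L.filter fun l => σ.cover (φ l) < 1).card < N →
      ∃ τ : Exploration k, τ.Valid S ∧ τ.Eager ∧ σ.SameTeam τ ∧ τ.tree.leaves = L ∧ τ.loc = φ := by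
  induction N with
  | zero => intro σ _ _ _ _ h; omega
  | succ N ih =>
    intro σ h hL hφ hlen hN
    by_cases he : σ.Eager
    · exact ⟨σ, h, he, ⟨rfl, rfl, rfl, rfl, rfl⟩, hL, hφ⟩
    · unfold Eager at he
      push Not at he
      obtain ⟨l, hl, hx, hc⟩ := he
      have hlt : σ.cover (σ.loc l) < 1 := lt_of_le_of_ne (h.cover_le_one _) hc
      have hlL : l ∈ L := hL ▸ hl
      have cover_ge : ∀ s, 0 ≤ s → ∀ w, σ.cover w ≤ (σ.elongateLeaf S l s).cover w := by
        intro s hs w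
        change _ ≤ Function.update σ.cover (σ.loc l) (σ.cover (σ.loc l) + s) w
        rw [Function.update_apply]
        split_ifs with hw
        · rw [hw]; linarith
        · exact le_rfl
      have hlen' : ∀ s, 0 ≤ s → 2 ≤ L.card → ∀ m ∈ L, ε ≤ (σ.tree.elongate l s).len m := by
        intro s hs h2 m hm
        have h3 := hlen h2 m hm
        have h4 := hlen h2 l hlL
        simp only [GameTree.elongate, Function.update_apply]
        split_ifs <;> linarith
      -- Either the player reacts before the leaf reaches its node, and the elongation stops at the
      -- first reaction, or the leaf is elongated up to its node.
      by_cases hR : ∃ s, (0 ≤ s ∧ S.respond (σ.tree.elongate l s) σ.conf (σ.tree.elongate l s) ≠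
          σ.conf) ∧ s ≤ 1 - σ.cover (σ.loc l)
      · obtain ⟨s, hs, hs1⟩ := hR
        obtain ⟨s₀, ⟨hs₀, hmove⟩, hmin⟩ := S.exists_first_move σ.tree σ.conf l h.good.simple
          h.config hl hx ⟨s, hs⟩
        have hs₀s : s₀ ≤ s := hmin hs
        have hv := h.elongateLeaf hl hx hs₀ hlt (by linarith) (by
          intro s' h0 hs'
          by_contra hne
          exact absurd (hmin ⟨h0, hne⟩) (not_le.2 hs'))
        have hcost : σ.cost + ε ≤ (σ.elongateLeaf S l s₀).cost := by
          have h1 := exists_transport_ge (hv.good) (x := σ.conf) h.config hv.config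
            (Ne.symm hmove) (ε := ε) (by
              intro h2
              have := hlen' s₀ hs₀
              rw [← hL] at this
              exact this h2)
          have h2 : 0 ≤ s₀ * (σ.conf l : ℝ) := by positivity
          change _ ≤ σ.cost + s₀ * (σ.conf l : ℝ) + _
          linarith! [h1]
        have hB := hv.cost_le hf (l := l₀) (by
          change l₀ ∈ σ.tree.leaves
          rw [hL]; exact hl₀)
        -- The cost after the reaction is still within the budget, so the natural floor is not
        -- truncated at zero and really drops by one.
        have hfl : ⌊(f (φ l₀).length - (σ.elongateLeaf S l s₀).cost) / ε⌋₊ + 1 ≤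
            ⌊(f (φ l₀).length - σ.cost) / ε⌋₊ := by
          change (σ.elongateLeaf S l s₀).cost ≤ f (σ.loc l₀).length at hB
          rw [hφ] at hB
          rw [← Nat.floor_add_one (div_nonneg (by linarith) hε.le)]
          refine Nat.floor_le_floor ?_
          rw [← sub_nonneg, show ∀ a b : ℝ, a / ε - (b / ε + 1) = (a - b - ε) / ε by
            intro a b; field_simp; ring]
          exact div_nonneg (by linarith) hε.le
        have hcard : (L.filter fun m => (σ.elongateLeaf S l s₀).cover (φ m) < 1).card ≤
            (L.filter fun m => σ.cover (φ m) < 1).card :=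
          Finset.card_le_card (Finset.monotone_filter_right _ fun m _ hm =>
            lt_of_le_of_lt (cover_ge s₀ hs₀ _) hm)
        obtain ⟨τ, h1, h2, h3, h4⟩ := ih (σ.elongateLeaf S l s₀) hv hL hφ
          (hlen' s₀ hs₀) (by omega)
        exact ⟨τ, h1, h2, ⟨h3.visited, h3.full, h3.closed, h3.pos, h3.moves⟩, h4⟩
      · push Not at hR
        have hs₀ : 0 ≤ 1 - σ.cover (σ.loc l) := by linarith
        set s₀ := 1 - σ.cover (σ.loc l) with hs₀'
        have hv := h.elongateLeaf hl hx hs₀ hlt (by linarith) (by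
          intro s' h0 hs'
          by_contra hne
          exact absurd (hR s' ⟨h0, hne⟩) (not_lt.2 hs'.le))
        have hcost : σ.cost ≤ (σ.elongateLeaf S l s₀).cost := by
          have h1 := (h.good.elongate hl hs₀).simple.transport_nonneg σ.conf
            (S.respond (σ.tree.elongate l s₀) σ.conf (σ.tree.elongate l s₀))
          have h2 : 0 ≤ s₀ * (σ.conf l : ℝ) := by positivity
          change _ ≤ σ.cost + s₀ * (σ.conf l : ℝ) + _
          linarith
        have hfl : ⌊(f (φ l₀).length - (σ.elongateLeaf S l s₀).cost) / ε⌋₊ ≤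
            ⌊(f (φ l₀).length - σ.cost) / ε⌋₊ := by
          refine Nat.floor_le_floor ?_
          exact div_le_div_of_nonneg_right (by linarith) hε.le
        have hcard : (L.filter fun m => (σ.elongateLeaf S l s₀).cover (φ m) < 1).card <
            (L.filter fun m => σ.cover (φ m) < 1).card := by
          refine Finset.card_lt_card (Finset.ssubset_iff_of_subset (Finset.monotone_filter_right _
            fun m _ hm => lt_of_le_of_lt (cover_ge s₀ hs₀ _) hm) |>.2 ⟨l, ?_, ?_⟩)
          · rw [Finset.mem_filter, ← hφ]
            exact ⟨hlL, hlt⟩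
          · rw [Finset.mem_filter, ← hφ]
            change ¬ (_ ∧ Function.update σ.cover (σ.loc l) (σ.cover (σ.loc l) + s₀) _ < 1)
            rw [Function.update_self, hs₀']
            simp
        obtain ⟨τ, h1, h2, h3, h4⟩ := ih (σ.elongateLeaf S l s₀) hv hL hφ
          (hlen' s₀ hs₀) (by omega)
        exact ⟨τ, h1, h2, ⟨h3.visited, h3.full, h3.closed, h3.pos, h3.moves⟩, h4⟩

theorem Valid.exists_eager (h : σ.Valid S) (hk : 2 ≤ k) (hf : S.IsBounded f) :
    ∃ τ : Exploration k, τ.Valid S ∧ τ.Eager ∧ σ.SameTeam τ ∧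
      τ.tree.leaves = σ.tree.leaves ∧ τ.loc = σ.loc := by
  obtain ⟨l₀, hl₀⟩ := h.leaves_nonempty hk
  obtain ⟨ε, hε, hlen⟩ : ∃ ε : ℝ, 0 < ε ∧
      (2 ≤ σ.tree.leaves.card → ∀ l ∈ σ.tree.leaves, ε ≤ σ.tree.len l) := by
    by_cases h2 : 2 ≤ σ.tree.leaves.card
    · obtain ⟨m, hm, hmin⟩ := Finset.exists_min_image σ.tree.leaves σ.tree.len ⟨l₀, hl₀⟩
      exact ⟨σ.tree.len m, h.good.len_pos h2 m hm, fun _ => hmin⟩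
    · exact ⟨1, one_pos, fun h3 => absurd h3 h2⟩
  exact Valid.exists_eager_aux hf σ.tree.leaves σ.loc hl₀ hε _ σ h rfl rfl hlen (Nat.lt_succ_self _)

/-! ### One step of a robot -/

/-- The labels that lead from `v` to visited nodes that are not closed. -/
def openLabels (σ : Exploration k) (v : List ℕ) : Finset ℕ :=
  (σ.visited.image fun w => w.headD 0).filter fun a => a :: v ∈ σ.visited ∧ a :: v ∉ σ.closed

theorem mem_openLabels {v : List ℕ} {a : ℕ} :
    a ∈ σ.openLabels v ↔ a :: v ∈ σ.visited ∧ a :: v ∉ σ.closed := by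
  unfold openLabels
  rw [Finset.mem_filter, Finset.mem_image]
  exact ⟨fun h => h.2, fun h => ⟨⟨a :: v, h.1, rfl⟩, h⟩⟩

/-- Each open child has a robot below it, and the robot `i` itself stands on the node. This matches
the rule that a leaf with `x` robots has at most `x - 1` children. -/
theorem Valid.card_openLabels_lt (h : σ.Valid S) (i : Fin k) :
    (σ.openLabels (σ.pos i)).card < σ.robots (σ.pos i) := by
  have h1 := sum_robotsBelow_lt σ.pos i (σ.openLabels (σ.pos i))
  have h2 : (σ.openLabels (σ.pos i)).card ≤
      ∑ a ∈ σ.openLabels (σ.pos i), robotsBelow σ.pos (a :: σ.pos i) := by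
    rw [Finset.card_eq_sum_ones]
    refine Finset.sum_le_sum fun a ha => ?_
    rw [mem_openLabels] at ha
    exact h.robots_pos _ ha.1 ha.2
  exact Nat.lt_of_succ_le ((Nat.succ_le_succ h2).trans h1)

/-- A robot at a node above which the game tree extends further. -/
theorem Valid.move_interior (h : σ.Valid S) (he : σ.Eager) {i : Fin k}
    (hcov : σ.IsCovered (σ.pos i)) (hloc : ∀ l ∈ σ.tree.leaves, σ.loc l ≠ σ.pos i) :
    (∃ a, a :: σ.pos i ∈ σ.visited ∧ (σ.move i (a :: σ.pos i)).Valid S) ∨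
      (σ.pos i ≠ [] ∧ (σ.move i (σ.pos i).tail).Valid S) := by
  -- A branch is entered only if its load exceeds its number of robots, which is at least 1. The
  -- load is then at least 2, and eagerness makes the coverage of its edge equal to 1.
  by_cases hex : ∃ a ∈ σ.openLabels (σ.pos i), σ.robots (a :: σ.pos i) < σ.load (a :: σ.pos i)
  · obtain ⟨a, ha, hlt⟩ := hex
    rw [mem_openLabels] at ha
    have := h.robots_pos _ ha.1 ha.2
    exact Or.inl ⟨a, ha.1, h.move_down ha.1 (h.cover_eq_one he (by omega)) hlt⟩
  · push Not at hex
    have h1 : σ.load (σ.pos i) = ∑ a ∈ σ.openLabels (σ.pos i), σ.load (a :: σ.pos i) :=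
      loadBelow_children hloc fun a ha =>
        mem_openLabels.2 ⟨h.visited_of_covered ha, h.not_closed_of_covered ha⟩
    have h2 : ∑ a ∈ σ.openLabels (σ.pos i), σ.robots (a :: σ.pos i) + 1 ≤ σ.robots (σ.pos i) :=
      sum_robotsBelow_lt σ.pos i (σ.openLabels (σ.pos i))
    have h3 := Finset.sum_le_sum hex
    -- No branch lacks robots and the robot `i` is in none of them, so the node has an excess. This
    -- cannot happen at the root, where both counts are `k`.
    have h4 : σ.load (σ.pos i) < σ.robots (σ.pos i) := by omega
    have h0 : σ.pos i ≠ [] := by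
      intro h0
      rw [h0, h.load_nil, robots, robotsBelow_nil] at h4
      exact lt_irrefl _ h4
    have h5 : 0 < (σ.openLabels (σ.pos i)).card := by
      obtain ⟨l, hl, hv⟩ := hcov
      obtain ⟨a, ha⟩ := exists_cons_suffix hv (hloc l hl).symm
      have : σ.IsCovered (a :: σ.pos i) := ⟨l, hl, ha⟩
      exact Finset.card_pos.2 ⟨a, mem_openLabels.2 ⟨h.visited_of_covered this,
        h.not_closed_of_covered this⟩⟩
    have h6 := h.card_openLabels_lt i
    exact Or.inr ⟨h0, h.move_up h0 (h.cover_of_covered _ hcov hloc) h4 (Or.inr (by omega))⟩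

/-- When all the children of the location of a leaf have been visited, and there are enough robots,
the leaf is forked, or elongated beyond that node. -/
theorem Valid.exists_descend (h : σ.Valid S) (hk : 2 ≤ k) (hf : S.IsBounded f) {l : ℕ}
    (hl : l ∈ σ.tree.leaves) (hfull : σ.loc l ∈ σ.full) (hone : σ.cover (σ.loc l) = 1)
    (hpos : 0 < (σ.openLabels (σ.loc l)).card)
    (hx : (σ.openLabels (σ.loc l)).card + 1 ≤ σ.conf l) :
    ∃ τ : Exploration k, τ.Valid S ∧ τ.Eager ∧ σ.SameTeam τ ∧ τ.IsCovered (σ.loc l) ∧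
      ∀ m ∈ τ.tree.leaves, τ.loc m ≠ σ.loc l := by
  suffices ∃ τ : Exploration k, τ.Valid S ∧ σ.SameTeam τ ∧ τ.IsCovered (σ.loc l) ∧
      ∀ m ∈ τ.tree.leaves, τ.loc m ≠ σ.loc l by
    obtain ⟨τ, h1, h2, h3, h4⟩ := this
    obtain ⟨υ, h5, h6, h7, h8, h9⟩ := h1.exists_eager hk hf
    refine ⟨υ, h5, h6, h2.trans h7, ?_, ?_⟩
    · unfold IsCovered at h3 ⊢
      rwa [h8, h9]
    · rwa [h8, h9]
  set A := σ.openLabels (σ.loc l) with hA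
  have hother : ∀ m ∈ σ.tree.leaves, m ≠ l → σ.loc m ≠ σ.loc l := fun m hm hml h' =>
    hml (h.loc_antichain m hm l hl (h' ▸ List.suffix_rfl))
  by_cases h1 : A.card = 1
  · obtain ⟨a, ha⟩ := Finset.card_eq_one.1 h1
    have haA : a ∈ σ.openLabels (σ.loc l) := by rw [← hA, ha]; simp
    have haA := mem_openLabels.1 haA
    refine ⟨σ.advance l a, h.advance hl hfull hone haA.1 haA.2 ?_, ⟨rfl, rfl, rfl, rfl, rfl⟩, ?_, ?_⟩
    · intro b hb hb'
      have : b ∈ A := mem_openLabels.2 ⟨hb, hb'⟩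
      rwa [ha, Finset.mem_singleton] at this
    · refine ⟨l, hl, ?_⟩
      simp [Exploration.advance]
    · intro m hm
      by_cases hml : m = l
      · rw [hml]
        simp [Exploration.advance]
      · simpa [Exploration.advance, hml] using hother m hm hml
  -- Shifting labels by `N` gives names that are not used in the game tree, and subtracting `N`
  -- recovers the label.
  · set N := σ.tree.verts.sup id + 1 with hN
    set C := A.image (· + N) with hC
    have hmemC : ∀ c, c ∈ C ↔ ∃ a ∈ A, a + N = c := fun c => Finset.mem_image
    have hcard : C.card = A.card := Finset.card_image_of_injective _ (add_left_injective N)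
    have hdisj : Disjoint C σ.tree.verts := by
      rw [Finset.disjoint_left]
      intro c hc hv
      obtain ⟨a, -, rfl⟩ := (hmemC c).1 hc
      have : a + N ≤ σ.tree.verts.sup id := Finset.le_sup (f := id) hv
      omega
    have hgood := h.good.fork_leaves (δ := S.forkLen σ.tree σ.conf l C.card) hdisj hl
      (Finset.card_pos.1 (by omega))
    have hval := h.forkLeaf (e := fun u => u - N) hl hdisj (by omega) (by omega) (by
        intro c hc c' hc' hcc
        obtain ⟨a, -, rfl⟩ := (hmemC c).1 hc
        obtain ⟨a', -, rfl⟩ := (hmemC c').1 hc'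
        simpa using hcc) hfull hone (by
        intro c hc
        obtain ⟨a, ha, rfl⟩ := (hmemC c).1 hc
        rw [Nat.add_sub_cancel]
        exact mem_openLabels.1 ha) (by
        intro b hb hb'
        exact ⟨b + N, (hmemC _).2 ⟨b, mem_openLabels.2 ⟨hb, hb'⟩, rfl⟩, Nat.add_sub_cancel _ _⟩)
    refine ⟨_, hval, ⟨rfl, rfl, rfl, rfl, rfl⟩, ?_, ?_⟩
    · obtain ⟨a, ha⟩ := Finset.card_pos.1 hpos
      have haC : a + N ∈ C := (hmemC _).2 ⟨a, ha, rfl⟩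
      refine ⟨a + N, ?_, ?_⟩
      · change a + N ∈ (σ.tree.fork l C _).leaves
        rw [hgood]
        exact Finset.mem_union_right _ haC
      · change _ <:+ if a + N ∈ C then _ else _
        rw [if_pos haC]
        exact List.suffix_cons _ _
    · intro m hm
      change m ∈ (σ.tree.fork l C _).leaves at hm
      rw [hgood, Finset.mem_union, Finset.mem_erase] at hm
      change (if m ∈ C then _ else _) ≠ _
      split_ifs with hmC
      · simp
      · have := hm.resolve_right hmC
        exact hother m this.2 this.1

/-- The robot `i` moves once: up, or down to a node of `K` or to a visited node. `K` is the set of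
the nodes that are known to exist. -/
structure IsStep (S : CTMStrategy k) (K : Finset (List ℕ)) (i : Fin k) (σ τ : Exploration k) :
    Prop where
  valid : τ.Valid S
  eager : τ.Eager
  moves : τ.moves = σ.moves + 1
  full : ∀ w ∈ τ.full, w ∈ σ.full ∨ (w = σ.pos i ∧ ∀ a, a :: w ∈ K → a :: w ∈ σ.visited)
  pos : τ.pos = Function.update σ.pos i (τ.pos i)
  visited : τ.visited = insert (τ.pos i) σ.visited
  up_or_down : (σ.pos i ≠ [] ∧ τ.pos i = (σ.pos i).tail) ∨
    ∃ a, τ.pos i = a :: σ.pos i ∧ (a :: σ.pos i ∈ K ∨ a :: σ.pos i ∈ σ.visited)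

theorem IsStep.of_move {K : Finset (List ℕ)} {i : Fin k} {τ : Exploration k} {u : List ℕ}
    (hv : (τ.move i u).Valid S) (he : τ.Eager) (hvis : τ.visited = σ.visited)
    (hpos : τ.pos = σ.pos) (hmoves : τ.moves = σ.moves)
    (hfull : ∀ w ∈ τ.full, w ∈ σ.full ∨ (w = σ.pos i ∧ ∀ a, a :: w ∈ K → a :: w ∈ σ.visited))
    (hu : (σ.pos i ≠ [] ∧ u = (σ.pos i).tail) ∨
      ∃ a, u = a :: σ.pos i ∧ (a :: σ.pos i ∈ K ∨ a :: σ.pos i ∈ σ.visited)) :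
    IsStep S K i σ (τ.move i u) := by
  have hself : (τ.move i u).pos i = u := Function.update_self _ _ _
  refine ⟨hv, he, ?_, hfull, ?_, ?_, ?_⟩
  · simp [Exploration.move, hmoves]
  · rw [hself, ← hpos]
    rfl
  · rw [hself, ← hvis]
    rfl
  · rwa [hself]

/-- A robot can move unless the known tree is exhausted: the second alternative says that every
visited node has all its known children visited. Without a new child to enter, the number of open
children decides between passing the node in the game and giving up its subtree. -/
theorem Valid.step (h : σ.Valid S) (he : σ.Eager) (hk : 2 ≤ k) (hf : S.IsBounded f)
    (K : Finset (List ℕ)) (i : Fin k)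
    (hK : σ.pos i ∈ σ.full → ∀ a, a :: σ.pos i ∈ K → a :: σ.pos i ∈ σ.visited) :
    (∃ τ, IsStep S K i σ τ) ∨
      ∀ w ∈ σ.visited, w ∈ σ.full ∨ (w = σ.pos i ∧ ∀ a, a :: w ∈ K → a :: w ∈ σ.visited) := by
  have hvis := h.pos_mem i
  have hrob : 1 ≤ σ.robots (σ.pos i) := robotsBelow_pos σ.pos i List.suffix_rfl
  by_cases hcl : σ.pos i ∈ σ.closed
  · have h0 : σ.pos i ≠ [] := fun h0 => h.nil_not_closed hk (h0 ▸ hcl)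
    refine Or.inl ⟨_, IsStep.of_move (h.move_up h0 (h.cover_closed _ hcl) ?_ (Or.inl hcl)) he rfl rfl
      rfl (fun w hw => Or.inl hw) (Or.inl ⟨h0, rfl⟩)⟩
    rw [h.load_eq_zero_of_closed hcl]
    omega
  by_cases hnew : ∃ a, a :: σ.pos i ∈ K ∧ a :: σ.pos i ∉ σ.visited
  · obtain ⟨a, haK, ha⟩ := hnew
    exact Or.inl ⟨_, IsStep.of_move (h.move_new ha fun hfull => ha (hK hfull a haK)) he rfl rfl rfl
      (fun w hw => Or.inl hw) (Or.inr ⟨a, rfl, Or.inl haK⟩)⟩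
  push Not at hnew
  have h1 := h.markFull hvis
  have he1 : (σ.markFull (σ.pos i)).Eager := he
  have hfull1 : ∀ w ∈ (σ.markFull (σ.pos i)).full,
      w ∈ σ.full ∨ (w = σ.pos i ∧ ∀ a, a :: w ∈ K → a :: w ∈ σ.visited) := by
    intro w hw
    rcases Finset.mem_insert.1 hw with rfl | hw
    · exact Or.inr ⟨rfl, hnew⟩
    · exact Or.inl hw
  have hmem1 : σ.pos i ∈ (σ.markFull (σ.pos i)).full := Finset.mem_insert_self _ _
  set σ₁ := σ.markFull (σ.pos i) with hσ₁
  have hlab : ∀ v, σ₁.openLabels v = σ.openLabels v := fun _ => rfl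
  -- A closed position has load 0 and coverage 1, and the robot itself is an excess, so going up is
  -- always affordable there.
  have hclose : ∀ τ : Exploration k, τ.Valid S → τ.visited = σ.visited → τ.pos = σ.pos →
      τ.moves = σ.moves → τ.full = σ₁.full → σ.pos i ∈ τ.closed →
      ∃ υ, IsStep S K i σ υ := by
    intro τ h2 e1 e2 e3 e4 e5
    obtain ⟨υ, h3, h4, h5, -, -⟩ := h2.exists_eager hk hf
    have e5' : υ.pos i ∈ υ.closed := by rw [h5.pos, h5.closed, e2]; exact e5
    have h0 : υ.pos i ≠ [] := fun h0 => h3.nil_not_closed hk (h0 ▸ e5')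
    have hp : υ.pos = σ.pos := h5.pos.trans e2
    refine ⟨_, IsStep.of_move (h3.move_up h0 (h3.cover_closed _ e5') ?_ (Or.inl e5')) h4
      (h5.visited.trans e1) hp (h5.moves.trans e3)
      (by rw [h5.full, e4]; exact hfull1) (Or.inl ⟨by rwa [← hp], by rw [hp]⟩)⟩
    rw [h3.load_eq_zero_of_closed e5']
    exact Nat.lt_of_lt_of_le one_pos (robotsBelow_pos υ.pos i List.suffix_rfl)
  have hinterior : ∀ τ : Exploration k, τ.Valid S → τ.Eager → σ₁.SameTeam τ →
      τ.IsCovered (σ.pos i) → (∀ m ∈ τ.tree.leaves, τ.loc m ≠ σ.pos i) →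
      ∃ υ, IsStep S K i σ υ := by
    intro τ h2 h3 e h4 h5
    have hp : τ.pos = σ.pos := e.pos
    have hff : ∀ w ∈ τ.full, w ∈ σ.full ∨ (w = σ.pos i ∧ ∀ a, a :: w ∈ K → a :: w ∈ σ.visited) := by
      rw [e.full]; exact hfull1
    rw [← hp] at h4 h5
    rcases h2.move_interior h3 h4 h5 with ⟨a, ha, h6⟩ | ⟨h0, h6⟩
    · refine ⟨_, IsStep.of_move h6 h3 e.visited hp e.moves hff (Or.inr ⟨a, by rw [hp], Or.inr ?_⟩)⟩
      have : a :: τ.pos i ∈ σ.visited := by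
        have h7 := e.visited
        change τ.visited = σ.visited at h7
        rwa [← h7]
      rwa [hp] at this
    · exact ⟨_, IsStep.of_move h6 h3 e.visited hp e.moves hff
        (Or.inl ⟨by rwa [← hp], by rw [hp]⟩)⟩
  by_cases hopen : 0 < (σ.openLabels (σ.pos i)).card
  · have h2 := h.card_openLabels_lt i
    -- An open child accounts for a second robot below this node, which excludes partial coverage.
    have hone : σ.cover (σ.pos i) = 1 := by
      by_contra hne
      have := h.robots_eq_one _ hvis hcl (lt_of_le_of_ne (h.cover_le_one _) hne)
      omega
    have hcov : σ.IsCovered (σ.pos i) := by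
      by_contra hcov
      rw [h.cover_of_not_covered _ hcl hcov] at hone
      norm_num at hone
    by_cases hloc : ∃ l ∈ σ.tree.leaves, σ.loc l = σ.pos i
    · obtain ⟨l, hl, hlv⟩ := hloc
      have hload : σ.load (σ.pos i) = σ.conf l := by rw [← hlv]; exact h.load_loc hl σ.conf
      -- Otherwise the game has at least as many robots on `l` as there are real ones, hence more
      -- than there are open children, and `l` can be forked or advanced.
      by_cases hlt : σ.conf l < σ.robots (σ.pos i)
      · have h0 : σ.pos i ≠ [] := by
          intro h0
          rw [← hload, h0, h.load_nil, robots, robotsBelow_nil] at hlt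
          exact lt_irrefl _ hlt
        exact Or.inl ⟨_, IsStep.of_move (h.move_up h0 hone (hload ▸ hlt) (Or.inr (by omega))) he rfl
          rfl rfl (fun w hw => Or.inl hw) (Or.inl ⟨h0, rfl⟩)⟩
      · obtain ⟨τ, h3, h4, h5, h6, h7⟩ := h1.exists_descend hk hf (l := l) hl
          (by change σ.loc l ∈ _; rw [hlv]; exact hmem1)
          (by change σ.cover (σ.loc l) = 1; rw [hlv]; exact hone)
          (by change 0 < (σ.openLabels (σ.loc l)).card; rw [hlv]; exact hopen)
          (by
            change (σ.openLabels (σ.loc l)).card + 1 ≤ σ.conf l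
            rw [hlv]
            omega)
        have e : σ₁.loc l = σ.pos i := hlv
        rw [e] at h6 h7
        exact Or.inl (hinterior τ h3 h4 h5 h6 h7)
    · push Not at hloc
      exact Or.inl (hinterior σ₁ h1 he1 ⟨rfl, rfl, rfl, rfl, rfl⟩ hcov hloc)
  · have hch : ∀ a, a :: σ.pos i ∈ σ.visited → a :: σ.pos i ∈ σ.closed := by
      intro a ha
      by_contra hac
      exact hopen (Finset.card_pos.2 ⟨a, mem_openLabels.2 ⟨ha, hac⟩⟩)
    by_cases hcov : σ.IsCovered (σ.pos i)
    -- If the game went past this node, the branch towards a leaf would be an open child.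
    · obtain ⟨l, hl, hlv⟩ : ∃ l ∈ σ.tree.leaves, σ.loc l = σ.pos i := by
        by_contra! hloc
        obtain ⟨l, hl, hv⟩ := hcov
        obtain ⟨a, ha⟩ := exists_cons_suffix hv (hloc l hl).symm
        have hca : σ.IsCovered (a :: σ.pos i) := ⟨l, hl, ha⟩
        exact h.not_closed_of_covered hca (hch a (h.visited_of_covered hca))
      by_cases h2 : 2 ≤ σ.tree.leaves.card
      · have hkill := h1.killLeaf (l := l) hl h2
          (by change σ.loc l ∈ _; rw [hlv]; exact hmem1)
          (by change ∀ a, a :: σ.loc l ∈ σ.visited → a :: σ.loc l ∈ σ.closed; rw [hlv]; exact hch)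
        refine Or.inl (hclose _ hkill.1 rfl rfl rfl rfl ?_)
        have := hkill.2
        rwa [show σ₁.loc l = σ.pos i from hlv] at this
      -- The last leaf may not be killed; the exploration is over.
      · right
        have hsingle : ∀ m ∈ σ.tree.leaves, m = l := fun m hm =>
          Finset.card_le_one.1 (by omega) m hm l hl
        have hcov' : ∀ w, σ.IsCovered w → w <:+ σ.pos i := by
          rintro w ⟨m, hm, hw⟩
          rw [hsingle m hm, hlv] at hw
          exact hw
        -- Starting from the root, an open child of a node strictly above the only leaf must be
        -- covered, hence is again above that leaf. All other visited nodes are closed.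
        have key : ∀ w ∈ σ.visited, w ∉ σ.closed → w <:+ σ.pos i := by
          intro w
          induction w with
          | nil => intro _ _; exact List.nil_suffix
          | cons a w ih =>
            intro hw hwc
            have hw' := h.parent_mem a w hw
            have hwc' : w ∉ σ.closed := fun hc => hwc (h.closed_cons a w hc hw)
            have hs := ih hw' hwc'
            by_cases hwv : w = σ.pos i
            · rw [hwv] at hw hwc
              exact absurd (hch a hw) hwc
            · refine hcov' _ ((h.covered_cons w ⟨l, hl, hlv ▸ hs⟩ ?_ a hw).resolve_left hwc)
              intro m hm
              rw [hsingle m hm, hlv]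
              exact Ne.symm hwv
        intro w hw
        by_cases hwc : w ∈ σ.closed
        · exact Or.inl (h.closed_subset hwc)
        · have hs := key w hw hwc
          by_cases hwv : w = σ.pos i
          · exact Or.inr ⟨hwv, by rw [hwv]; exact hnew⟩
          · refine Or.inl (h.full_of_covered w ⟨l, hl, hlv ▸ hs⟩ ?_)
            intro m hm
            rw [hsingle m hm, hlv]
            exact Ne.symm hwv
    · exact Or.inl (hclose _ (h1.close hk hmem1 hcl hcov hch) rfl rfl rfl rfl
        (Finset.mem_insert_self _ _))

/-! ### The initial state -/

/-- All robots are at the root, which is the only visited node. -/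
def init (k : ℕ) : Exploration k where
  visited := {[]}
  full := ∅
  closed := ∅
  pos := fun _ => []
  moves := 0
  tree := GameTree.start
  conf := fun v => if v = 1 then k else 0
  cost := 0
  loc := fun _ => []
  cover := fun v => if v = [] then 1 else 0

theorem init_valid (S : CTMStrategy k) (hk : 2 ≤ k) : (init k).Valid S := by
  have hlea : (init k).tree.leaves = {1} := GameTree.start_leaves
  have hcov : ∀ v, (init k).IsCovered v ↔ v = [] := by
    intro v
    constructor
    · rintro ⟨l, -, hv⟩
      exact List.suffix_nil.1 hv
    · rintro rfl
      exact ⟨1, by rw [hlea]; simp, List.nil_suffix⟩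
  have hleaf : ∀ v, (init k).IsCovered v → (∀ l ∈ (init k).tree.leaves, (init k).loc l ≠ v) →
      False := by
    intro v hv hl
    rw [hcov] at hv
    exact hl 1 (by rw [hlea]; simp) hv.symm
  have herase : (init k).visited.erase [] = ∅ := by simp [init]
  refine ⟨CTMStrategy.Reach.start, GameTree.start_good, ⟨?_, ?_⟩, ?_, ?_, ?_, ?_, ?_, ?_, ?_, ?_, ?_,
    ?_, ?_, ?_, ?_, ?_, ?_, ?_, ?_, ?_, ?_, ?_, ?_, ?_⟩
  · intro v hv
    rw [hlea, Finset.mem_singleton] at hv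
    simp [init, hv]
  · rw [hlea]
    simp [init]
  · simp [init]
  · intro a v hv
    simp [init] at hv
  · simp [init]
  · simp [init]
  · intro a v hv
    simp [init] at hv
  · intro i
    simp [init]
  · intro l _
    simp [init]
  · intro l _
    simp [init]
  · intro l hl m hm _
    rw [hlea, Finset.mem_singleton] at hl hm
    rw [hl, hm]
  · exact fun v hv hl => (hleaf v hv hl).elim
  · exact fun v hv hl => (hleaf v hv hl).elim
  · intro v hv _
    rw [show v = [] by simpa [init] using hv]
    rw [robots, robotsBelow_nil]
    omega
  · simp [init]
  · intro v
    simp only [init]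
    split_ifs <;> norm_num
  · intro v
    simp only [init]
    split_ifs <;> norm_num
  · intro v hv
    simp [init] at hv
  · intro v _ hv
    rw [hcov] at hv
    simp [init, hv]
  · exact fun v hv hl => (hleaf v hv hl).elim
  · intro v hv _ hlt
    rw [show v = [] by simpa [init] using hv] at hlt
    simp [init] at hlt
  · intro x x' _ _
    rw [loadDist, herase, Finset.sum_empty]
    exact GameTree.start_transport x x'
  · intro l hl
    have : (init k).tree.depth l = 0 := Finset.sum_eq_zero fun _ _ => rfl
    rw [this]
    simp [init]
  · rw [potential, herase]
    simp [init]

theorem init_eager (k : ℕ) : (init k).Eager := fun _ _ _ => by simp [init]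

/-- The total number of moves. -/
theorem Valid.moves_le_bound (h : σ.Valid S) (hf : S.IsBounded f) {D : ℝ}
    (hD : ∃ l ∈ σ.tree.leaves, σ.tree.depth l ≤ D) :
    (σ.moves : ℝ) ≤ f D + 2 * ((σ.visited.erase []).card : ℝ) := by
  have h1 := h.moves_le
  have h2 := potential_le (V := σ.visited) h.cover_nonneg h.cover_le_one σ.robots σ.load
  have h3 := hf _ _ _ h.reach D hD
  linarith

end Exploration

/-! ## Collective tree exploration -/

namespace Exploration

variable {k : ℕ} {S : CTMStrategy k} {f : ℝ → ℝ}

/-- What a state of the exploration has to do with the explored tree `T`. -/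
structure Sync (S : CTMStrategy k) (T : RTree) (σ : Exploration k) : Prop where
  valid : σ.Valid S
  eager : σ.Eager
  subset : σ.visited ⊆ T.nodes
  children : ∀ w ∈ σ.full, ∀ a, a :: w ∈ T.nodes → a :: w ∈ σ.visited

/-- The robot `i` moves if it can. -/
def next (S : CTMStrategy k) (K : Finset (List ℕ)) (σ : Exploration k) (i : Fin k) :
    Exploration k :=
  if h : ∃ τ, IsStep S K i σ τ then h.choose else σ

/-- The robots move one after the other. -/
def round (S : CTMStrategy k) (K : Finset (List ℕ)) (σ : Exploration k) : Exploration k :=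
  (List.finRange k).foldl (next S K) σ

/-- A robot can go from `u` to `u'` in one round. -/
def Legal (T : RTree) (u u' : List ℕ) : Prop :=
  u' = u ∨ (u ≠ [] ∧ u' = u.tail) ∨ ∃ a, u' = a :: u ∧ a :: u ∈ T.nodes

theorem nodes_subset {T : RTree} {V : Finset (List ℕ)} (h0 : [] ∈ V)
    (h : ∀ w ∈ V, ∀ a, a :: w ∈ T.nodes → a :: w ∈ V) : T.nodes ⊆ V := by
  intro w
  induction w with
  | nil => exact fun _ => h0
  | cons a w ih => exact fun hw => h w (ih (T.parent_mem a w hw)) a hw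

/-- Since `K` contains all the children of the robot's position, a node recorded as full with
respect to `K` is full in `T`. If the robot cannot move, the visited set is stable under children in
`T`, hence is everything. -/
theorem Sync.next {T : RTree} {σ : Exploration k} (h : σ.Sync S T) (hk : 2 ≤ k)
    (hf : S.IsBounded f) {K : Finset (List ℕ)} (hK : K ⊆ T.nodes) {i : Fin k}
    (hi : ∀ a, a :: σ.pos i ∈ T.nodes → a :: σ.pos i ∈ K) :
    (σ.next S K i).Sync S T ∧
      (σ.next S K i).pos = Function.update σ.pos i ((σ.next S K i).pos i) ∧
      (σ.next S K i).visited = insert ((σ.next S K i).pos i) σ.visited ∧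
      Legal T (σ.pos i) ((σ.next S K i).pos i) ∧
      ((σ.next S K i).moves = σ.moves + 1 ∨ σ.visited = T.nodes) := by
  unfold Exploration.next
  split_ifs with hex
  · have hs := hex.choose_spec
    set τ := hex.choose
    have hmem : τ.pos i ∈ T.nodes := by
      rcases hs.up_or_down with ⟨-, hu⟩ | ⟨a, ha, hu⟩
      · rw [hu]
        exact suffix_mem T.parent_mem (List.tail_suffix _) (h.subset (h.valid.pos_mem i))
      · rw [ha]
        rcases hu with hu | hu
        · exact hK hu
        · exact h.subset hu
    refine ⟨⟨hs.valid, hs.eager, ?_, ?_⟩, hs.pos, hs.visited, ?_, Or.inl hs.moves⟩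
    · rw [hs.visited]
      exact Finset.insert_subset hmem h.subset
    · intro w hw a ha
      rw [hs.visited]
      refine Finset.mem_insert_of_mem ?_
      rcases hs.full w hw with hw | ⟨rfl, hw⟩
      · exact h.children w hw a ha
      · exact hw a (hi a ha)
    · rcases hs.up_or_down with hu | ⟨a, ha, hu⟩
      · exact Or.inr (Or.inl hu)
      · exact Or.inr (Or.inr ⟨a, ha, ha ▸ hmem⟩)
  · refine ⟨h, by simp, ?_, Or.inl rfl, Or.inr ?_⟩
    · rw [Finset.insert_eq_of_mem (h.valid.pos_mem i)]
    · have hfin := (h.valid.step h.eager hk hf K i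
        fun hfull a ha => h.children _ hfull a (hK ha)).resolve_left hex
      refine Finset.Subset.antisymm h.subset (nodes_subset h.valid.root_mem fun w hw a ha => ?_)
      rcases hfin w hw with hw | ⟨rfl, hw⟩
      · exact h.children w hw a ha
      · exact hw a (hi a ha)

/-- Robots act one at a time but on the knowledge of the beginning of the round. A robot that has
not acted yet still stands where it was, so the hypothesis on its children persists. As soon as one
robot is idle, all nodes are visited. -/
theorem Sync.foldl {T : RTree} (hk : 2 ≤ k) (hf : S.IsBounded f) {K : Finset (List ℕ)}
    (hK : K ⊆ T.nodes) (l : List (Fin k)) (hl : l.Nodup) :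
    ∀ σ : Exploration k, σ.Sync S T →
      (∀ i ∈ l, ∀ a, a :: σ.pos i ∈ T.nodes → a :: σ.pos i ∈ K) →
      (l.foldl (Exploration.next S K) σ).Sync S T ∧
      (∀ i, i ∉ l → (l.foldl (Exploration.next S K) σ).pos i = σ.pos i) ∧
      (∀ i ∈ l, Legal T (σ.pos i) ((l.foldl (Exploration.next S K) σ).pos i)) ∧
      (l.foldl (Exploration.next S K) σ).visited =
        σ.visited ∪ l.toFinset.image (l.foldl (Exploration.next S K) σ).pos ∧
      ((l.foldl (Exploration.next S K) σ).moves = σ.moves + l.length ∨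
        (l.foldl (Exploration.next S K) σ).visited = T.nodes) := by
  induction l with
  | nil =>
    intro σ h _
    exact ⟨h, fun _ _ => rfl, by simp, by simp, Or.inl rfl⟩
  | cons i l ih =>
    intro σ h hi
    rw [List.nodup_cons] at hl
    obtain ⟨h1, h2, h3, h4, h5⟩ := h.next hk hf hK (i := i) (hi i (by simp))
    have hpos : ∀ j ∈ l, (σ.next S K i).pos j = σ.pos j := by
      intro j hj
      have hji : j ≠ i := by rintro rfl; exact hl.1 hj
      rw [h2, Function.update_of_ne hji]
    obtain ⟨g1, g2, g3, g4, g5⟩ := ih hl.2 (σ.next S K i) h1 (by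
      intro j hj
      rw [hpos j hj]
      exact hi j (by simp [hj]))
    rw [List.foldl_cons]
    set τ := l.foldl (Exploration.next S K) (σ.next S K i) with hτ
    have hτi : τ.pos i = (σ.next S K i).pos i := g2 i hl.1
    refine ⟨g1, ?_, ?_, ?_, ?_⟩
    · intro j hj
      rw [List.mem_cons, not_or] at hj
      rw [g2 j hj.2, h2, Function.update_of_ne hj.1]
    · intro j hj
      rcases List.mem_cons.1 hj with rfl | hj
      · rw [hτi]; exact h4
      · have := g3 j hj
        rwa [hpos j hj] at this
    · rw [g4, h3, List.toFinset_cons, Finset.image_insert, hτi, Finset.union_insert,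
        Finset.insert_union]
    · rcases h5 with h5 | h5
      · rcases g5 with g5 | g5
        · left
          rw [g5, h5, List.length_cons]
          ring
        · exact Or.inr g5
      · right
        refine Finset.Subset.antisymm g1.subset ?_
        rw [g4, h3, ← h5]
        exact (Finset.subset_insert _ _).trans Finset.subset_union_left

/-- The step that leads from `u` to `u'`. -/
def stepTo (u u' : List ℕ) : Step :=
  if u' = u then .stay else if u' = u.tail then .up else .down (u'.headD 0)

theorem Legal.apply_stepTo {T : RTree} {u u' : List ℕ} (h : Legal T u u') :
    (stepTo u u').apply T u = u' := by
  unfold stepTo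
  split_ifs with h1 h2
  · exact h1.symm
  · exact h2.symm
  · rcases h with h | h | ⟨a, rfl, ha⟩
    · exact absurd h h1
    · exact absurd h.2 h2
    · simp [Step.apply, ha]

/-- The state of the exploration, computed from the past views. -/
def ofViews (S : CTMStrategy k) : List (CTEView k) → Exploration k
  | [] => init k
  | v :: past => round S v.discovered (ofViews S past)

end Exploration

open Exploration

/-- The exploration algorithm derived from a strategy of the tree-mining game. All robots return to
the root once all the edges have been traversed. -/
def cteAlgorithm {k : ℕ} (S : CTMStrategy k) : CTEAlgorithm k := fun v past i =>
  if v.visited = v.discovered then .up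
  else stepTo ((ofViews S past).pos i) ((ofViews S (v :: past)).pos i)

namespace CTEAlgorithm

variable {k : ℕ} {S : CTMStrategy k} {f : ℝ → ℝ}

/-- The first phase of the exploration: every robot has moved in each of the `t` rounds. -/
structure Exploring (S : CTMStrategy k) (T : RTree) (t : ℕ) : Prop where
  sync : (ofViews S ((cteAlgorithm S).run T t).2).Sync S T
  view : ((cteAlgorithm S).run T t).1 = CTEView.of T
    (ofViews S ((cteAlgorithm S).run T t).2).visited (ofViews S ((cteAlgorithm S).run T t).2).pos
  moves : (ofViews S ((cteAlgorithm S).run T t).2).moves = k * t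

/-- The second phase: all nodes have been visited. -/
def Explored (A : CTEAlgorithm k) (T : RTree) (t : ℕ) : Prop :=
  (A.run T t).1.visited = T.nodes ∧ (∀ i, (A.run T t).1.pos i ∈ T.nodes) ∧
    (A.run T t).1.discovered = T.nodes

theorem filter_tail_eq (T : RTree) : T.nodes.filter (fun u => u.tail ∈ T.nodes) = T.nodes :=
  Finset.filter_true_of_mem fun _ hu => suffix_mem T.parent_mem (List.tail_suffix _) hu

theorem Exploring.succ (hk : 2 ≤ k) (hf : S.IsBounded f) {T : RTree} {t : ℕ}
    (h : Exploring S T t) :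
    (cteAlgorithm S).Explored T t ∨ (cteAlgorithm S).Explored T (t + 1) ∨
      Exploring S T (t + 1) := by
  obtain ⟨hs, hv, hm⟩ := h
  set r := (cteAlgorithm S).run T t with hr
  set σ := ofViews S r.2 with hσ
  have hdisc : r.1.discovered = T.nodes.filter fun u => u.tail ∈ σ.visited := by rw [hv]; rfl
  have hvis : r.1.visited = σ.visited := by rw [hv]; rfl
  have hpos : r.1.pos = σ.pos := by rw [hv]; rfl
  by_cases hex : σ.visited = T.nodes
  · refine Or.inl ⟨hvis.trans hex, fun i => ?_, ?_⟩
    · rw [← hr, hpos]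
      exact hs.subset (hs.valid.pos_mem i)
    · rw [← hr, hdisc, hex]
      exact filter_tail_eq T
  right
  -- The team itself can see whether dangling edges are left, and this is the test that starts the
  -- return to the root.
  have hne : r.1.visited ≠ r.1.discovered := by
    intro heq
    rw [hvis, hdisc] at heq
    refine hex (Finset.Subset.antisymm hs.subset (nodes_subset hs.valid.root_mem ?_))
    intro w hw a ha
    rw [heq, Finset.mem_filter]
    exact ⟨ha, hw⟩
  have hfold := Sync.foldl hk hf (K := r.1.discovered) (T := T)
    (by rw [hdisc]; exact Finset.filter_subset _ _) (List.finRange k) (List.nodup_finRange k) σ hs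
    (by
      intro i _ a ha
      rw [hdisc, Finset.mem_filter]
      exact ⟨ha, hs.valid.pos_mem i⟩)
  obtain ⟨g1, -, g3, g4, g5⟩ := hfold
  set τ := (List.finRange k).foldl (Exploration.next S r.1.discovered) σ with hτ
  have hτ' : ofViews S (r.1 :: r.2) = τ := rfl
  have hact : (fun i => ((cteAlgorithm S) r.1 r.2 i).apply T (r.1.pos i)) = τ.pos := by
    funext i
    unfold cteAlgorithm
    rw [if_neg hne, hpos, hτ', ← hσ]
    exact (g3 i (by simp)).apply_stepTo
  have hrun : (cteAlgorithm S).run T (t + 1) =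
      (CTEView.of T (r.1.visited ∪ Finset.univ.image
        (fun i => ((cteAlgorithm S) r.1 r.2 i).apply T (r.1.pos i)))
        (fun i => ((cteAlgorithm S) r.1 r.2 i).apply T (r.1.pos i)), r.1 :: r.2) := rfl
  have hvis' : r.1.visited ∪ Finset.univ.image τ.pos = τ.visited := by
    rw [hvis, g4, List.toFinset_finRange]
  rw [hact, hvis'] at hrun
  rcases g5 with g5 | g5
  · right
    refine ⟨?_, ?_, ?_⟩
    · rw [hrun]; exact g1
    · rw [hrun]
      rfl
    · rw [hrun]
      change τ.moves = _
      rw [g5, hm, List.length_finRange]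
      ring
  · left
    refine ⟨?_, fun i => ?_, ?_⟩
    · rw [hrun]; exact g5
    · rw [hrun]; exact g1.subset (g1.valid.pos_mem i)
    · rw [hrun]
      change T.nodes.filter (fun u => u.tail ∈ τ.visited) = _
      rw [g5]
      exact filter_tail_eq T

/-- All robots go up in every round, and the root is its own tail. The truncated difference
therefore bounds the remaining distances. -/
theorem Explored.add {T : RTree} {t : ℕ} (h : (cteAlgorithm S).Explored T t) (j : ℕ) :
    (cteAlgorithm S).Explored T (t + j) ∧
      ∀ i, (((cteAlgorithm S).run T (t + j)).1.pos i).length ≤ T.depth - j := by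
  induction j with
  | zero =>
    refine ⟨h, fun i => ?_⟩
    exact Finset.le_sup (f := List.length) (h.2.1 i)
  | succ j ih =>
    obtain ⟨⟨h1, h2, h3⟩, h4⟩ := ih
    rw [← add_assoc]
    set r := (cteAlgorithm S).run T (t + j) with hr
    have hact : (fun i => ((cteAlgorithm S) r.1 r.2 i).apply T (r.1.pos i)) =
        fun i => (r.1.pos i).tail := by
      funext i
      unfold cteAlgorithm
      rw [if_pos (h1.trans h3.symm)]
      rfl
    have hrun : (cteAlgorithm S).run T (t + j + 1) =
        (CTEView.of T (r.1.visited ∪ Finset.univ.image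
          (fun i => ((cteAlgorithm S) r.1 r.2 i).apply T (r.1.pos i)))
          (fun i => ((cteAlgorithm S) r.1 r.2 i).apply T (r.1.pos i)), r.1 :: r.2) := rfl
    have hmem : ∀ i, (r.1.pos i).tail ∈ T.nodes := fun i =>
      suffix_mem T.parent_mem (List.tail_suffix _) (h2 i)
    have hvis : r.1.visited ∪ Finset.univ.image (fun i => (r.1.pos i).tail) = T.nodes := by
      rw [h1, Finset.union_eq_left]
      intro u hu
      obtain ⟨i, -, rfl⟩ := Finset.mem_image.1 hu
      exact hmem i
    rw [hact, hvis] at hrun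
    rw [Explored, hrun]
    refine ⟨⟨rfl, hmem, filter_tail_eq T⟩, fun i => ?_⟩
    change ((r.1.pos i).tail).length ≤ _
    rw [List.length_tail]
    have := h4 i
    omega

theorem exploring_zero (S : CTMStrategy k) (hk : 2 ≤ k) (T : RTree) : Exploring S T 0 where
  sync :=
    { valid := init_valid S hk
      eager := init_eager k
      subset := Finset.singleton_subset_iff.2 T.root_mem
      children := fun w hw => absurd hw (Finset.notMem_empty w) }
  view := rfl
  moves := rfl

theorem Exploring.moves_le (hf : S.IsBounded f) (hk : 2 ≤ k) {T : RTree} {t : ℕ}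
    (h : Exploring S T t) : (k : ℝ) * t ≤ f T.depth + 2 * T.nodes.card := by
  have hv := h.sync.valid
  obtain ⟨l, hl⟩ := hv.leaves_nonempty hk
  have h1 := hv.moves_le_bound hf (D := T.depth) ⟨l, hl, (hv.depth_le hl).trans (by
    exact_mod_cast Finset.le_sup (f := List.length) (h.sync.subset (hv.loc_mem l hl)))⟩
  rw [h.moves] at h1
  have h2 : ((((ofViews S ((cteAlgorithm S).run T t).2).visited.erase []).card : ℕ) : ℝ) ≤
      T.nodes.card := by
    exact_mod_cast Finset.card_le_card ((Finset.erase_subset _ _).trans h.sync.subset)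
  push_cast at h1
  linarith

theorem exists_explored (hf : S.IsBounded f) (hk : 2 ≤ k) (T : RTree) :
    ∃ t, Exploring S T t ∧
      ((cteAlgorithm S).Explored T t ∨ (cteAlgorithm S).Explored T (t + 1)) := by
  by_contra! hne
  have hall : ∀ t, Exploring S T t := by
    intro t
    induction t with
    | zero => exact exploring_zero S hk T
    | succ t ih =>
      rcases ih.succ hk hf with h | h | h
      · exact absurd h (hne t ih).1
      · exact absurd h (hne t ih).2
      · exact h
  obtain ⟨t, ht⟩ := exists_nat_gt (f T.depth + 2 * T.nodes.card)
  have h1 := (hall t).moves_le hf hk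
  have h2 : (2 : ℝ) ≤ k := by exact_mod_cast hk
  have h3 : (0 : ℝ) ≤ t := Nat.cast_nonneg t
  nlinarith

theorem runtime_le (hf : S.IsBounded f) (hk : 2 ≤ k) (T : RTree) :
    ∃ t : ℕ, (cteAlgorithm S).runtime T = t ∧
      (t : ℝ) ≤ (2 * (T.nodes.card : ℝ) + f T.depth) / k + T.depth + 1 := by
  have hfin : ∃ t, (cteAlgorithm S).Finished T t ∧
      (t : ℝ) ≤ (2 * (T.nodes.card : ℝ) + f T.depth) / k + T.depth + 1 := by
    obtain ⟨t, h1, h2⟩ := exists_explored hf hk T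
    have h3 := h1.moves_le hf hk
    have hk0 : (0 : ℝ) < k := by exact_mod_cast (by omega : 0 < k)
    have h4 : (t : ℝ) ≤ (2 * (T.nodes.card : ℝ) + f T.depth) / k := by
      rw [le_div_iff₀ hk0]
      linarith
    have key : ∀ s, (cteAlgorithm S).Explored T s → (cteAlgorithm S).Finished T (s + T.depth) := by
      intro s hs
      obtain ⟨h5, h6⟩ := hs.add T.depth
      refine ⟨h5.1, fun i => ?_⟩
      have := h6 i
      rw [Nat.sub_self] at this
      exact List.eq_nil_of_length_eq_zero (Nat.le_zero.1 this)
    -- In the second case the last round was incomplete; it accounts for the summand 1.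
    rcases h2 with h2 | h2
    · refine ⟨_, key _ h2, ?_⟩
      push_cast
      linarith
    · refine ⟨_, key _ h2, ?_⟩
      push_cast
      linarith
  obtain ⟨t, ht, hle⟩ := hfin
  have hex : ∃ t, (cteAlgorithm S).Finished T t := ⟨t, ht⟩
  refine ⟨Nat.find hex, ?_, ?_⟩
  · refine le_antisymm (sInf_le ⟨Nat.find hex, Nat.find_spec hex, rfl⟩) (le_sInf ?_)
    rintro _ ⟨s, hs, rfl⟩
    exact_mod_cast Nat.find_min' hex hs
  · exact le_trans (by exact_mod_cast Nat.find_min' hex ht) hle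

end CTEAlgorithm

/-! ## Contraction of the edges of length zero -/

/-- The list of the edges of positive length above a node, which is a node of the tree obtained by
contracting the edges of length zero. -/
def label (len : List ℕ → ℕ) : List ℕ → List ℕ
  | [] => []
  | a :: u => if len (a :: u) = 0 then label len u else Encodable.encode (a :: u) :: label len u

theorem label_suffix (len : List ℕ → ℕ) {u v : List ℕ} (h : u <:+ v) :
    label len u <:+ label len v := by
  induction v with
  | nil => rw [List.suffix_nil.1 h]
  | cons a v ih =>
    rcases List.suffix_cons_iff.1 h with rfl | h
    · exact List.suffix_rfl
    · rw [label]
      split_ifs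
      · exact ih h
      · exact (ih h).trans (List.suffix_cons _ _)

theorem label_of_len_ne {len : List ℕ → ℕ} {w : List ℕ} (hw : w ≠ []) (hlen : len w ≠ 0) :
    label len w = Encodable.encode w :: label len w.tail := by
  obtain ⟨a, u, rfl⟩ := List.exists_cons_of_ne_nil hw
  rw [label, if_neg hlen, List.tail_cons]

/-- Every node of the contracted tree above a node comes from an edge of positive length. -/
theorem exists_of_cons_suffix_label {len : List ℕ → ℕ} {c : ℕ} {s v : List ℕ}
    (h : c :: s <:+ label len v) : ∃ w, w <:+ v ∧ w ≠ [] ∧ len w ≠ 0 ∧ Encodable.encode w = c ∧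
      label len w.tail = s := by
  induction v with
  | nil =>
    rw [label, List.suffix_nil] at h
    simp at h
  | cons a v ih =>
    rw [label] at h
    split_ifs at h with hlen
    · obtain ⟨w, hw, h'⟩ := ih h
      exact ⟨w, hw.trans (List.suffix_cons _ _), h'⟩
    · rcases List.suffix_cons_iff.1 h with h | h
      · rw [List.cons_eq_cons] at h
        exact ⟨a :: v, List.suffix_rfl, by simp, hlen, h.1.symm, h.2.symm⟩
      · obtain ⟨w, hw, h'⟩ := ih h
        exact ⟨w, hw.trans (List.suffix_cons _ _), h'⟩

/-- The head of the label of `w` encodes the whole node `w`, so it determines `w` wherever it occurs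
in a label. -/
theorem suffix_of_label_suffix {len : List ℕ → ℕ} {w v : List ℕ} (hw : w ≠ []) (hlen : len w ≠ 0)
    (h : label len w <:+ label len v) : w <:+ v := by
  rw [label_of_len_ne hw hlen] at h
  obtain ⟨w', h1, -, -, h2, -⟩ := exists_of_cons_suffix_label h
  rwa [← Encodable.encode_injective h2]

/-- The number of edges between two nodes. -/
def edgeDist (u v : List ℕ) : ℕ := (symmDiff u.tails.toFinset v.tails.toFinset).card

theorem edgeDist_self (u : List ℕ) : edgeDist u u = 0 := by simp [edgeDist]

theorem edgeDist_comm (u v : List ℕ) : edgeDist u v = edgeDist v u := by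
  unfold edgeDist
  rw [symmDiff_comm]

theorem edgeDist_triangle (u v w : List ℕ) : edgeDist u w ≤ edgeDist u v + edgeDist v w := by
  unfold edgeDist
  refine (Finset.card_le_card ?_).trans (Finset.card_union_le _ _)
  exact symmDiff_triangle _ _ _

theorem edgeDist_cons (a : ℕ) (u : List ℕ) : edgeDist u (a :: u) ≤ 1 := by
  unfold edgeDist
  have : symmDiff u.tails.toFinset (a :: u).tails.toFinset ⊆ {a :: u} := by
    intro w hw
    simp only [Finset.mem_symmDiff, List.mem_toFinset, List.mem_tails, List.suffix_cons_iff,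
      Finset.mem_singleton] at hw ⊢
    tauto
  simpa using Finset.card_le_card this

theorem sum_le_card_filter {ι : Type*} (s : Finset ι) (g : ι → ℕ) (hg : ∀ i, g i ≤ 1) :
    ∑ i ∈ s, g i = (s.filter fun i => g i ≠ 0).card := by
  rw [Finset.card_filter]
  refine Finset.sum_congr rfl fun i _ => ?_
  have := hg i
  split_ifs <;> omega

/-- The distance counts the edges of length 1 on the path. Taking labels maps their lower ends
injectively to edges on the path between the two contracted nodes. -/
theorem LayeredTree.dist_le_edgeDist (T : LayeredTree) (u v : List ℕ) :
    T.dist u v ≤ edgeDist (label T.len u) (label T.len v) := by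
  unfold LayeredTree.dist edgeDist
  rw [sum_le_card_filter _ _ T.len_le_one]
  have hne : ∀ w ∈ (symmDiff u.tails.toFinset v.tails.toFinset).filter (fun w => T.len w ≠ 0),
      w ≠ [] ∧ T.len w ≠ 0 := by
    intro w hw
    rw [Finset.mem_filter] at hw
    refine ⟨?_, hw.2⟩
    rintro rfl
    simp [Finset.mem_symmDiff] at hw
  refine Finset.card_le_card_of_injOn (label T.len) ?_ ?_
  · intro w hw
    obtain ⟨h0, hlen⟩ := hne w hw
    have hw := (Finset.mem_filter.1 hw).1
    simp only [Finset.mem_coe, Finset.mem_symmDiff, List.mem_toFinset, List.mem_tails] at hw ⊢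
    rcases hw with ⟨h1, h2⟩ | ⟨h1, h2⟩
    · exact Or.inl ⟨label_suffix _ h1, fun h => h2 (suffix_of_label_suffix h0 hlen h)⟩
    · exact Or.inr ⟨label_suffix _ h1, fun h => h2 (suffix_of_label_suffix h0 hlen h)⟩
  · intro w hw w' hw' h
    obtain ⟨h0, hlen⟩ := hne w hw
    obtain ⟨h0', hlen'⟩ := hne w' hw'
    rw [label_of_len_ne h0 hlen, label_of_len_ne h0' hlen', List.cons_eq_cons] at h
    exact Encodable.encode_injective h.1

theorem LayeredTree.length_label (T : LayeredTree) (u : List ℕ) :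
    (label T.len u).length = T.dist [] u := by
  have key : ∀ v : List ℕ, symmDiff ([] : List ℕ).tails.toFinset v.tails.toFinset =
      v.tails.toFinset.erase [] := by
    intro v
    ext w
    simp only [Finset.mem_symmDiff, List.mem_toFinset, List.mem_tails, List.suffix_nil,
      Finset.mem_erase]
    constructor
    · rintro (⟨rfl, h⟩ | h)
      · exact absurd List.nil_suffix h
      · exact h.symm
    · rintro ⟨h1, h2⟩
      exact Or.inr ⟨h2, h1⟩
  unfold LayeredTree.dist
  rw [key]
  induction u with
  | nil => simp [label]
  | cons a u ih =>
    have h1 : (a :: u).tails.toFinset.erase [] = insert (a :: u) (u.tails.toFinset.erase []) := by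
      ext w
      simp only [Finset.mem_erase, Finset.mem_insert, List.mem_toFinset, List.mem_tails,
        List.suffix_cons_iff]
      constructor
      · tauto
      · rintro (rfl | h)
        · simp
        · tauto
    rw [h1, Finset.sum_insert, ← ih, label]
    · have := T.len_le_one (a :: u)
      split_ifs with h
      · rw [h, zero_add]
      · rw [List.length_cons]
        omega
    · simp [not_cons_suffix_self]

/-! ## Exploring until all robots are in a given set of nodes -/

namespace Exploration

variable {k : ℕ} {S : CTMStrategy k} {f : ℝ → ℝ}

/-- What a state of the exploration has to do with the set `K` of the known nodes and the set `F` of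
those that may still have unknown children. -/
structure Knows (S : CTMStrategy k) (K F : Finset (List ℕ)) (σ : Exploration k) : Prop where
  valid : σ.Valid S
  eager : σ.Eager
  subset : σ.visited ⊆ K
  full : ∀ w ∈ σ.full, w ∉ F ∧ ∀ a, a :: w ∈ K → a :: w ∈ σ.visited

/-- From `σ` to `τ`, the robots go to nodes of `F`. -/
structure IsStage (S : CTMStrategy k) (K F : Finset (List ℕ)) (σ τ : Exploration k) : Prop where
  knows : τ.Knows S K F
  pos_mem : ∀ i, τ.pos i ∈ F
  dist_le : ∑ i, edgeDist (σ.pos i) (τ.pos i) + σ.moves ≤ τ.moves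

theorem IsStep.edgeDist_le {K : Finset (List ℕ)} {i : Fin k} {σ τ : Exploration k}
    (h : IsStep S K i σ τ) : ∑ j, edgeDist (σ.pos j) (τ.pos j) ≤ 1 := by
  rw [Finset.sum_eq_single i]
  · rcases h.up_or_down with ⟨h0, hu⟩ | ⟨a, ha, -⟩
    · obtain ⟨a, u, hau⟩ := List.exists_cons_of_ne_nil h0
      rw [hu, hau, List.tail_cons, edgeDist_comm]
      exact edgeDist_cons a u
    · rw [ha]
      exact edgeDist_cons _ _
  · intro j _ hj
    rw [h.pos, Function.update_of_ne hj, edgeDist_self]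
  · simp

/-- Only robots outside `F` are moved. They are never blocked: exhaustion of `K` would make every
node full except the position of the moving robot, whereas nodes of `F` are never full. Since the
number of moves is bounded by `B`, all robots end up in `F`. -/
theorem Knows.exists_stage_aux (hk : 2 ≤ k) (hf : S.IsBounded f) {K F : Finset (List ℕ)}
    (hK : ∀ a v, a :: v ∈ K → v ∈ K) (hF : F.Nonempty) (hFK : F ⊆ K) (B : ℕ)
    (hB : ∀ σ : Exploration k, σ.Knows S K F → σ.moves ≤ B) (N : ℕ) :
    ∀ σ : Exploration k, σ.Knows S K F → B - σ.moves < N → ∃ τ, IsStage S K F σ τ := by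
  induction N with
  | zero => intro σ _ h; omega
  | succ N ih =>
    intro σ h hN
    by_cases hall : ∀ i, σ.pos i ∈ F
    · exact ⟨σ, h, hall, by simp [edgeDist_self]⟩
    · push Not at hall
      obtain ⟨i, hi⟩ := hall
      rcases h.valid.step h.eager hk hf K i fun hfull => (h.full _ hfull).2 with ⟨τ, hs⟩ | hfin
      · have hmem : τ.pos i ∈ K := by
          rcases hs.up_or_down with ⟨-, hu⟩ | ⟨a, ha, hu⟩
          · rw [hu]
            exact suffix_mem hK (List.tail_suffix _) (h.subset (h.valid.pos_mem i))
          · rw [ha]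
            rcases hu with hu | hu
            · exact hu
            · exact h.subset hu
        have hτ : τ.Knows S K F := by
          refine ⟨hs.valid, hs.eager, ?_, ?_⟩
          · rw [hs.visited]
            exact Finset.insert_subset hmem h.subset
          · intro w hw
            rw [hs.visited]
            rcases hs.full w hw with hw | ⟨rfl, hw⟩
            · exact ⟨(h.full w hw).1, fun a ha =>
                Finset.mem_insert_of_mem ((h.full w hw).2 a ha)⟩
            · exact ⟨hi, fun a ha => Finset.mem_insert_of_mem (hw a ha)⟩
        have hm := hs.moves
        have hb := hB τ hτ
        obtain ⟨υ, h1, h2, h3⟩ := ih τ hτ (by omega)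
        refine ⟨υ, h1, h2, ?_⟩
        have h4 : ∑ j, edgeDist (σ.pos j) (υ.pos j) ≤
            ∑ j, edgeDist (σ.pos j) (τ.pos j) + ∑ j, edgeDist (τ.pos j) (υ.pos j) := by
          rw [← Finset.sum_add_distrib]
          exact Finset.sum_le_sum fun j _ => edgeDist_triangle _ _ _
        have h5 := hs.edgeDist_le
        omega
      · exfalso
        have hsub : K ⊆ σ.visited := by
          intro w
          induction w with
          | nil => exact fun _ => h.valid.root_mem
          | cons a w ihw =>
            intro hw
            rcases hfin w (ihw (hK a w hw)) with h' | ⟨-, h'⟩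
            · exact (h.full w h').2 a hw
            · exact h' a hw
        obtain ⟨w, hw⟩ := hF
        rcases hfin w (hsub (hFK hw)) with h' | ⟨rfl, -⟩
        · exact (h.full w h').1 hw
        · exact hi hw

theorem Knows.exists_stage (hk : 2 ≤ k) (hf : S.IsBounded f) {K F : Finset (List ℕ)}
    (hK : ∀ a v, a :: v ∈ K → v ∈ K) (hF : F.Nonempty) (hFK : F ⊆ K) {σ : Exploration k}
    (h : σ.Knows S K F) : ∃ τ, IsStage S K F σ τ := by
  obtain ⟨B, hB⟩ := exists_nat_ge (f ((K.sup List.length : ℕ) : ℝ) + 2 * K.card)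
  refine Knows.exists_stage_aux hk hf hK hF hFK B (fun τ hτ => ?_) _ σ h (Nat.lt_succ_self _)
  obtain ⟨l, hl⟩ := hτ.valid.leaves_nonempty hk
  have h1 := hτ.valid.moves_le_bound hf (D := ((K.sup List.length : ℕ) : ℝ))
    ⟨l, hl, (hτ.valid.depth_le hl).trans (by
      exact_mod_cast Finset.le_sup (f := List.length) (hτ.subset (hτ.valid.loc_mem l hl)))⟩
  have h2 : ((τ.visited.erase []).card : ℝ) ≤ K.card := by
    exact_mod_cast Finset.card_le_card ((Finset.erase_subset _ _).trans hτ.subset)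
  have h3 : (τ.moves : ℝ) ≤ B := by linarith
  exact_mod_cast h3

/-- The robots move until they are all in `F`. -/
def stage (S : CTMStrategy k) (K F : Finset (List ℕ)) (σ : Exploration k) : Exploration k :=
  if h : ∃ τ, IsStage S K F σ τ then h.choose else σ

theorem isStage_stage {K F : Finset (List ℕ)} {σ : Exploration k}
    (h : ∃ τ, IsStage S K F σ τ) : IsStage S K F σ (stage S K F σ) := by
  unfold stage
  rw [dif_pos h]
  exact h.choose_spec

end Exploration

/-! ## Layered tree traversal -/

namespace LTTView

/-- The nodes of the contracted tree that occur in the layers `0, …, j`. -/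
def known (w : LTTView) (j : ℕ) : Finset (List ℕ) :=
  (w.nodes.filter fun u => u.length ≤ j).image (label w.len)

/-- The nodes of the contracted tree that occur in the layer `j`. -/
def front (w : LTTView) (j : ℕ) : Finset (List ℕ) :=
  (w.nodes.filter fun u => u.length = j).image (label w.len)

end LTTView

open Exploration

/-- The state of the robots when the layers `0, …, j` of the view have been used. -/
def lttState {k : ℕ} (S : CTMStrategy k) (w : LTTView) : ℕ → Exploration k
  | 0 => init k
  | j + 1 => stage S (w.known (j + 1)) (w.front (j + 1)) (lttState S w j)

/-- A node of the last layer whose image in the contracted tree is `p`, if there is one. -/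
def pick (w : LTTView) (p : List ℕ) : List ℕ :=
  if h : ∃ u ∈ w.nodes, u.length = w.nodes.sup List.length ∧ label w.len u = p then h.choose
  -- The fallbacks only make the algorithm total; the views of an actual run fall under the first
  -- case.
  else if h : ∃ u ∈ w.nodes, u.length = w.nodes.sup List.length then h.choose else []

theorem pick_mem {w : LTTView} (h : ∃ u ∈ w.nodes, u.length = w.nodes.sup List.length)
    (p : List ℕ) : pick w p ∈ w.nodes ∧ (pick w p).length = w.nodes.sup List.length := by
  unfold pick
  split_ifs with h1
  · exact ⟨h1.choose_spec.1, h1.choose_spec.2.1⟩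
  · exact h.choose_spec

theorem label_pick {w : LTTView} {p : List ℕ}
    (h : ∃ u ∈ w.nodes, u.length = w.nodes.sup List.length ∧ label w.len u = p) :
    label w.len (pick w p) = p := by
  unfold pick
  rw [dif_pos h]
  exact h.choose_spec.2.2

namespace LayeredTree

variable (T : LayeredTree)

theorem exists_mem_layer {j : ℕ} (hj : j ≤ T.target.length) : ∃ u ∈ T.nodes, u.length = j := by
  refine ⟨T.target.drop (T.target.length - j), suffix_mem T.parent_mem (List.drop_suffix _ _)
    T.target_mem, ?_⟩
  rw [List.length_drop]
  omega

theorem mem_reveal {i : ℕ} {u : List ℕ} : u ∈ (T.reveal i).nodes ↔ u ∈ T.nodes ∧ u.length ≤ i :=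
  Finset.mem_filter

theorem sup_reveal {i : ℕ} (hi : i ≤ T.target.length) :
    (T.reveal i).nodes.sup List.length = i := by
  refine le_antisymm (Finset.sup_le fun u hu => ((T.mem_reveal).1 hu).2) ?_
  obtain ⟨u, hu, hui⟩ := T.exists_mem_layer hi
  have := Finset.le_sup (f := List.length) (T.mem_reveal.2 ⟨hu, hui.le⟩)
  rwa [hui] at this

theorem label_reveal {i : ℕ} {u : List ℕ} (hu : u ∈ T.nodes) (hi : u.length ≤ i) :
    label (T.reveal i).len u = label T.len u := by
  induction u with
  | nil => rfl
  | cons a u ih =>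
    have h : (T.reveal i).len (a :: u) = T.len (a :: u) := if_pos ⟨hu, hi⟩
    simp only [label, h, ih (T.parent_mem a u hu) ((Nat.le_succ _).trans hi)]

/-- The whole tree as a view. -/
def fullView : LTTView := ⟨T.nodes, T.len⟩

theorem known_reveal {i j : ℕ} (hij : j ≤ i) : (T.reveal i).known j = T.fullView.known j := by
  have h : (T.reveal i).nodes.filter (fun u => u.length ≤ j) =
      T.nodes.filter (fun u => u.length ≤ j) := by
    ext u
    rw [Finset.mem_filter, Finset.mem_filter, mem_reveal]
    exact ⟨fun h => ⟨h.1.1, h.2⟩, fun h => ⟨⟨h.1, h.2.trans hij⟩, h.2⟩⟩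
  unfold LTTView.known
  rw [h]
  refine Finset.image_congr fun u hu => ?_
  have hu := Finset.mem_filter.1 hu
  exact T.label_reveal hu.1 (hu.2.trans hij)

theorem front_reveal {i j : ℕ} (hij : j ≤ i) : (T.reveal i).front j = T.fullView.front j := by
  have h : (T.reveal i).nodes.filter (fun u => u.length = j) =
      T.nodes.filter (fun u => u.length = j) := by
    ext u
    rw [Finset.mem_filter, Finset.mem_filter, mem_reveal]
    exact ⟨fun h => ⟨h.1.1, h.2⟩, fun h => ⟨⟨h.1, h.2.le.trans hij⟩, h.2⟩⟩
  unfold LTTView.front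
  rw [h]
  refine Finset.image_congr fun u hu => ?_
  have hu := Finset.mem_filter.1 hu
  exact T.label_reveal hu.1 (hu.2.le.trans hij)

/-- Stages up to `j` depend on the first `j` layers only, so the states that the searcher recomputes
at successive steps belong to one single run. -/
theorem lttState_reveal {k : ℕ} (S : CTMStrategy k) {i j : ℕ} (hij : j ≤ i) :
    lttState S (T.reveal i) j = lttState S T.fullView j := by
  induction j with
  | zero => rfl
  | succ j ih =>
    rw [lttState, lttState, ih ((Nat.le_succ j).trans hij), T.known_reveal hij, T.front_reveal hij]

variable {T}

theorem mem_known {j : ℕ} {w : List ℕ} :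
    w ∈ T.fullView.known j ↔ ∃ u ∈ T.nodes, u.length ≤ j ∧ label T.len u = w := by
  simp [LTTView.known, fullView, and_assoc]

theorem mem_front {j : ℕ} {w : List ℕ} :
    w ∈ T.fullView.front j ↔ ∃ u ∈ T.nodes, u.length = j ∧ label T.len u = w := by
  simp [LTTView.front, fullView, and_assoc]

theorem known_parent {j a : ℕ} {w : List ℕ} (h : a :: w ∈ T.fullView.known j) :
    w ∈ T.fullView.known j := by
  obtain ⟨u, hu, huj, hl⟩ := mem_known.1 h
  obtain ⟨v, hv, -, -, -, hvl⟩ := exists_of_cons_suffix_label (len := T.len)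
    (hl ▸ List.suffix_rfl : a :: w <:+ label T.len u)
  have hs : v.tail <:+ u := (List.tail_suffix v).trans hv
  exact mem_known.2 ⟨v.tail, suffix_mem T.parent_mem hs hu, hs.length_le.trans huj, hvl⟩

theorem front_subset_known (T : LayeredTree) (j : ℕ) : T.fullView.front j ⊆ T.fullView.known j := by
  intro w hw
  obtain ⟨u, hu, huj, hl⟩ := mem_front.1 hw
  exact mem_known.2 ⟨u, hu, huj.le, hl⟩

/-- A node of the contracted tree that does not occur in the last layer is completely known. -/
theorem known_succ_of_not_front {j : ℕ} {w : List ℕ} (hw : w ∈ T.fullView.known j)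
    (hwF : w ∉ T.fullView.front j) : w ∉ T.fullView.front (j + 1) ∧
      ∀ a, a :: w ∈ T.fullView.known (j + 1) → a :: w ∈ T.fullView.known j := by
  constructor
  · intro hw1
    obtain ⟨u, hu, huj, hl⟩ := mem_front.1 hw1
    obtain ⟨b, u', rfl⟩ := List.exists_cons_of_length_eq_add_one huj
    have hu' := T.parent_mem b u' hu
    have huj' : u'.length = j := by simpa using huj
    rw [label] at hl
    split_ifs at hl with hlen
    · exact hwF (mem_front.2 ⟨u', hu', huj', hl⟩)
    · obtain ⟨v, hv, hvj, hvl⟩ := mem_known.1 hw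
      obtain ⟨v', h1, -, -, h2, -⟩ := exists_of_cons_suffix_label (len := T.len)
        (by rw [hvl, ← hl] :
          Encodable.encode (b :: u') :: label T.len u' <:+ label T.len v)
      rw [Encodable.encode_injective h2] at h1
      have := h1.length_le
      omega
  · intro a ha
    obtain ⟨u, hu, huj, hl⟩ := mem_known.1 ha
    by_cases hlt : u.length ≤ j
    · exact mem_known.2 ⟨u, hu, hlt, hl⟩
    · have huj : u.length = j + 1 := by omega
      obtain ⟨b, u', rfl⟩ := List.exists_cons_of_length_eq_add_one huj
      have hu' := T.parent_mem b u' hu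
      have huj' : u'.length = j := by simpa using huj
      rw [label] at hl
      split_ifs at hl with hlen
      · exact mem_known.2 ⟨u', hu', huj'.le, hl⟩
      · exact absurd (mem_front.2 ⟨u', hu', huj', (List.cons_eq_cons.1 hl).2⟩) hwF

/-- Each contracted node other than the root is the label of the lower end of an edge of length 1.
-/
theorem card_known_le (T : LayeredTree) (j : ℕ) :
    ((T.fullView.known j).erase []).card ≤ T.length := by
  unfold LayeredTree.length
  rw [sum_le_card_filter _ _ T.len_le_one]
  refine (Finset.card_le_card ?_).trans (Finset.card_image_le (f := label T.len))
  intro w hw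
  obtain ⟨hw0, hw⟩ := Finset.mem_erase.1 hw
  obtain ⟨u, hu, -, hl⟩ := mem_known.1 hw
  obtain ⟨c, s, rfl⟩ := List.exists_cons_of_ne_nil hw0
  obtain ⟨v, h1, h2, h3, h4, h5⟩ := exists_of_cons_suffix_label (len := T.len)
    (hl ▸ List.suffix_rfl : c :: s <:+ label T.len u)
  refine Finset.mem_image.2 ⟨v, ?_, ?_⟩
  · rw [Finset.mem_filter, Finset.mem_erase]
    exact ⟨⟨h2, suffix_mem T.parent_mem h1 hu⟩, h3⟩
  · rw [label_of_len_ne h2 h3, h4, h5]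

end LayeredTree

/-- The searcher imitates the robot `r`. -/
def lttAlgorithm {k : ℕ} (S : CTMStrategy k) (r : Fin k) : LTTAlgorithm where
  -- The position of the searcher is not needed, as the view determines the whole run. The supremum
  -- of the lengths recovers the index of the last layer.
  next w _ := pick w ((lttState S w (w.nodes.sup List.length)).pos r)
  next_mem := by
    intro T i u hi _
    have hsup := T.sup_reveal (i := i + 1) hi
    obtain ⟨v, hv, hvi⟩ := T.exists_mem_layer (j := i + 1) hi
    have h := pick_mem (w := T.reveal (i + 1)) ⟨v, T.mem_reveal.2 ⟨hv, hvi.le⟩, by rw [hvi, hsup]⟩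
      ((lttState S (T.reveal (i + 1)) ((T.reveal (i + 1)).nodes.sup List.length)).pos r)
    rw [LayeredTree.layer, Finset.mem_filter]
    exact ⟨(T.mem_reveal.1 h.1).1, h.2.trans hsup⟩

namespace LayeredTree

variable {T : LayeredTree} {k : ℕ} {S : CTMStrategy k} {f : ℝ → ℝ}

/-- Full nodes stay full when a layer is revealed: they are outside the previous front, so no new
edge can be attached to them. -/
theorem isStage_succ (hk : 2 ≤ k) (hf : S.IsBounded f) {j : ℕ} (hj : j < T.target.length)
    (h : (lttState S T.fullView j).Knows S (T.fullView.known j) (T.fullView.front j)) :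
    IsStage S (T.fullView.known (j + 1)) (T.fullView.front (j + 1)) (lttState S T.fullView j)
      (lttState S T.fullView (j + 1)) := by
  have hsub : T.fullView.known j ⊆ T.fullView.known (j + 1) := by
    intro w hw
    obtain ⟨u, hu, huj, hl⟩ := mem_known.1 hw
    exact mem_known.2 ⟨u, hu, huj.trans (Nat.le_succ j), hl⟩
  have h' : (lttState S T.fullView j).Knows S (T.fullView.known (j + 1))
      (T.fullView.front (j + 1)) := by
    refine ⟨h.valid, h.eager, h.subset.trans hsub, fun w hw => ?_⟩
    have h1 := known_succ_of_not_front (h.subset (h.valid.full_subset hw)) (h.full w hw).1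
    exact ⟨h1.1, fun a ha => (h.full w hw).2 a (h1.2 a ha)⟩
  obtain ⟨u, hu, huj⟩ := T.exists_mem_layer hj
  exact isStage_stage (h'.exists_stage hk hf (fun _ _ => known_parent)
    ⟨_, mem_front.2 ⟨u, hu, huj, rfl⟩⟩ (T.front_subset_known (j + 1)))

theorem knows_lttState (hk : 2 ≤ k) (hf : S.IsBounded f) {j : ℕ} (hj : j ≤ T.target.length) :
    (lttState S T.fullView j).Knows S (T.fullView.known j) (T.fullView.front j) ∧
      ∀ i, (lttState S T.fullView j).pos i ∈ T.fullView.front j := by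
  induction j with
  | zero =>
    refine ⟨⟨init_valid S hk, init_eager k, ?_, ?_⟩, fun i => ?_⟩
    · exact Finset.singleton_subset_iff.2 (mem_known.2 ⟨[], T.root_mem, le_rfl, rfl⟩)
    · exact fun w hw => absurd hw (Finset.notMem_empty w)
    · exact mem_front.2 ⟨[], T.root_mem, rfl, rfl⟩
  | succ j ih =>
    have hs := isStage_succ hk hf hj (ih ((Nat.le_succ j).trans hj)).1
    exact ⟨hs.knows, hs.pos_mem⟩

theorem label_pos (hk : 2 ≤ k) (hf : S.IsBounded f) (r : Fin k) {j : ℕ}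
    (hj : j ≤ T.target.length) :
    label T.len ((lttAlgorithm S r).pos T j) = (lttState S T.fullView j).pos r := by
  cases j with
  | zero => rfl
  | succ j =>
    have hsup := T.sup_reveal hj
    have hpos : (lttAlgorithm S r).pos T (j + 1) =
        pick (T.reveal (j + 1)) ((lttState S T.fullView (j + 1)).pos r) := by
      rw [← T.lttState_reveal S (le_refl (j + 1))]
      change pick _ ((lttState S _ ((T.reveal (j + 1)).nodes.sup List.length)).pos r) = _
      rw [hsup]
    obtain ⟨u, hu, huj, hl⟩ := mem_front.1 ((knows_lttState (S := S) hk hf hj).2 r)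
    have hex : ∃ u ∈ (T.reveal (j + 1)).nodes, u.length =
        (T.reveal (j + 1)).nodes.sup List.length ∧ label (T.reveal (j + 1)).len u =
          (lttState S T.fullView (j + 1)).pos r :=
      ⟨u, T.mem_reveal.2 ⟨hu, huj.le⟩, by rw [huj, hsup], by rw [T.label_reveal hu huj.le, hl]⟩
    have h1 := label_pick hex
    have h2 := T.mem_reveal.1
      (pick_mem ⟨u, T.mem_reveal.2 ⟨hu, huj.le⟩, by rw [huj, hsup]⟩
        ((lttState S T.fullView (j + 1)).pos r)).1
    rw [T.label_reveal h2.1 h2.2] at h1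
    rw [hpos, h1]

/-- The sum of the costs of the `k` searchers is at most the number of moves of the robots. -/
theorem sum_cost_le (hk : 2 ≤ k) (hf : S.IsBounded f) (T : LayeredTree) :
    ((∑ r : Fin k, (lttAlgorithm S r).cost T : ℕ) : ℝ) ≤ 2 * (T.length : ℝ) + f T.depth := by
  set n := T.target.length with hn
  have hpart : ∀ j ≤ n, ∑ r : Fin k, ∑ i ∈ Finset.range j,
      T.dist ((lttAlgorithm S r).pos T i) ((lttAlgorithm S r).pos T (i + 1)) ≤
      (lttState S T.fullView j).moves := by
    intro j
    induction j with
    | zero => simp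
    | succ j ih =>
      intro hj
      have h1 := ih ((Nat.le_succ j).trans hj)
      have h2 := (isStage_succ hk hf hj
        (knows_lttState (T := T) (S := S) hk hf ((Nat.le_succ j).trans hj)).1).dist_le
      have h3 : ∑ r : Fin k,
          T.dist ((lttAlgorithm S r).pos T j) ((lttAlgorithm S r).pos T (j + 1)) ≤
          ∑ r, edgeDist ((lttState S T.fullView j).pos r)
            ((lttState S T.fullView (j + 1)).pos r) := by
        refine Finset.sum_le_sum fun r _ => (T.dist_le_edgeDist _ _).trans ?_
        rw [label_pos hk hf r hj, label_pos hk hf r ((Nat.le_succ j).trans hj)]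
      simp only [Finset.sum_range_succ]
      rw [Finset.sum_add_distrib]
      omega
  obtain ⟨h, -⟩ := knows_lttState (T := T) (S := S) hk hf le_rfl
  rw [← hn] at h
  have htar : label T.len T.target ∈ T.fullView.front n := mem_front.2 ⟨_, T.target_mem, rfl, rfl⟩
  -- A final stage gathers all robots at the target. It pays for the last walk of each searcher.
  have h' : (lttState S T.fullView n).Knows S (T.fullView.known n) {label T.len T.target} := by
    refine ⟨h.valid, h.eager, h.subset, fun w hw => ⟨?_, (h.full w hw).2⟩⟩
    rw [Finset.mem_singleton]
    rintro rfl
    exact (h.full _ hw).1 htar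
  obtain ⟨τ, h1, h2, h3⟩ := h'.exists_stage hk hf (fun _ _ => known_parent)
    (Finset.singleton_nonempty _)
    (Finset.singleton_subset_iff.2 (T.front_subset_known n htar))
  have hpos : ∀ i, τ.pos i = label T.len T.target := fun i => Finset.mem_singleton.1 (h2 i)
  have hcost : ∑ r : Fin k, (lttAlgorithm S r).cost T ≤ τ.moves := by
    have h4 := hpart n le_rfl
    have h5 : ∑ r : Fin k, T.dist ((lttAlgorithm S r).pos T n) T.target ≤
        ∑ r, edgeDist ((lttState S T.fullView n).pos r) (τ.pos r) := by
      refine Finset.sum_le_sum fun r _ => (T.dist_le_edgeDist _ _).trans ?_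
      rw [label_pos hk hf r le_rfl, hpos r]
    unfold LTTAlgorithm.cost
    rw [Finset.sum_add_distrib, ← hn]
    omega
  have hmoves : (τ.moves : ℝ) ≤ f T.depth + 2 * ((τ.visited.erase []).card : ℝ) := by
    obtain ⟨l, hl⟩ := h1.valid.leaves_nonempty hk
    refine h1.valid.moves_le_bound hf ⟨l, hl, (h1.valid.depth_le hl).trans ?_⟩
    -- The location of a leaf is open, so some robot is below it. All robots are at the target,
    -- hence the leaf lies above the target and has depth at most `D`, even if the explored tree is
    -- deeper.
    have h4 : 0 < (Finset.univ.filter fun i => τ.loc l <:+ τ.pos i).card :=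
      h1.valid.robots_pos _ (h1.valid.loc_mem l hl) (h1.valid.loc_not_closed l hl)
    obtain ⟨i, hi⟩ := Finset.card_pos.1 h4
    have h5 := (Finset.mem_filter.1 hi).2
    rw [hpos i] at h5
    have h6 := h5.length_le
    rw [T.length_label] at h6
    exact_mod_cast h6
  have hcard : ((τ.visited.erase []).card : ℝ) ≤ T.length := by
    exact_mod_cast (Finset.card_le_card (Finset.erase_subset_erase _ h1.subset)).trans
      (T.card_known_le n)
  have h6 : ((∑ r : Fin k, (lttAlgorithm S r).cost T : ℕ) : ℝ) ≤ τ.moves := by exact_mod_cast hcost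
  linarith

end LayeredTree

/-! ### The randomized algorithm -/

/-- The searcher imitates a robot that is chosen uniformly at random. -/
def randomizedLTTAlgorithm {k : ℕ} [NeZero k] (S : CTMStrategy k) : RandomizedLTTAlgorithm :=
  (PMF.uniformOfFintype (Fin k)).map (lttAlgorithm S)

/-- Exchanging the two sums avoids asking whether different robots give different deterministic
algorithms. -/
theorem expectedCost_eq {k : ℕ} [NeZero k] (S : CTMStrategy k) (T : LayeredTree) :
    (randomizedLTTAlgorithm S).expectedCost T =
      (k : ℝ≥0∞)⁻¹ * ((∑ r : Fin k, (lttAlgorithm S r).cost T : ℕ) : ℝ≥0∞) := by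
  unfold RandomizedLTTAlgorithm.expectedCost randomizedLTTAlgorithm
  simp only [PMF.map_apply, PMF.uniformOfFintype_apply, Fintype.card_fin, tsum_fintype,
    Finset.sum_mul]
  rw [Summable.tsum_finsetSum fun _ _ => ENNReal.summable, Nat.cast_sum, Finset.mul_sum]
  refine Finset.sum_congr rfl fun r _ => ?_
  rw [tsum_eq_single (lttAlgorithm S r)]
  · rw [if_pos rfl]
  · intro B hB
    rw [if_neg hB, zero_mul]

theorem expectedCost_le {k : ℕ} [NeZero k] {S : CTMStrategy k} {f : ℝ → ℝ} (hk : 2 ≤ k)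
    (hf : S.IsBounded f) (T : LayeredTree) : (randomizedLTTAlgorithm S).expectedCost T ≤
      ENNReal.ofReal ((2 * (T.length : ℝ) + f T.depth) / k + 1) := by
  have hk0 : (0 : ℝ) < k := by exact_mod_cast (by omega : 0 < k)
  have h := LayeredTree.sum_cost_le hk hf T
  rw [expectedCost_eq, mul_comm, ← div_eq_mul_inv]
  rw [← ENNReal.ofReal_natCast, ← ENNReal.ofReal_natCast, ← ENNReal.ofReal_div_of_pos hk0]
  refine ENNReal.ofReal_le_ofReal ?_
  -- The estimate holds without the summand 1, which is dropped.
  have := div_le_div_of_nonneg_right h hk0.le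
  linarith

end TreeMining

end

/-! ### Both bounds for a given strategy. -/

theorem mainTheorem6 (f : ℕ → ℝ → ℝ) (k : ℕ) (hk : 2 ≤ k)
    (S : TreeMining.CTMStrategy k) (hS : S.IsBounded (f k)) :
    (∃ A : TreeMining.CTEAlgorithm k, ∀ T : TreeMining.RTree,
      ∃ t : ℕ, A.runtime T = t ∧
        (t : ℝ) ≤ (2 * (T.nodes.card : ℝ) + f k (T.depth : ℝ)) / (k : ℝ) + (T.depth : ℝ) + 1) ∧
    (∃ A : TreeMining.RandomizedLTTAlgorithm, ∀ T : TreeMining.LayeredTree,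
      A.expectedCost T ≤
        ENNReal.ofReal ((2 * (T.length : ℝ) + f k (T.depth : ℝ)) / (k : ℝ) + 1)) := by
  have : NeZero k := ⟨by omega⟩
  exact ⟨⟨TreeMining.cteAlgorithm S, TreeMining.CTEAlgorithm.runtime_le hS hk⟩,
    TreeMining.randomizedLTTAlgorithm S, TreeMining.expectedCost_le hk hS⟩
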